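/- Scalars are real or complex; the statement holds in both cases. **Objects.** An *MI-space* is a Banach lattice $X$ with an order unit $e\ge 0$ (every $x\in X$ satisfies $|x|\le\lambda e$ for some $\lambda>0$) whose norm is $\|x\|=\min\{\lambda\ge 0 : |x|\le\lambda e\}$. In the complex case an MI-space is the complexification $X+iX$ of a real MI-space $X$, with modulus $|x+iy|=\sup_\theta(x\cos\theta+y\sin\theta)$, norm $\|z\|=\|\,|z|\,\|$ and unit $e$; order-theoretic properties of it are those of its real part $X$. A poset is *countably complete* if every nonempty countable subset that is bounded above has a supremum and every nonempty countable subset that is bounded below has an infimum; it is *Dedekind complete* if every nonempty subset that is bounded above has a supremum. An *abstract $L_\infty$ space* is a countably complete MI-space; it is *proper* if it is isometrically isomorphic to the dual of some Banach space. A *ccb-algebra* is a countably complete boolean algebra; a *Dcb-algebra* is a Dedekind complete boolean algebra; an *mcb-algebra* is a Dcb-algebra $\mathcal B$ with a function $\mu:\mathcal B\to[0,\infty]$, $\mu(0)=0$, that is countably additive on disjoint sequences, strictly positive ($x\ne0\Rightarrow\mu(x)>0$), and semi-finite (if $\mu(x)=\infty$, there is $y\le x$ with $0<\mu(y)<\infty$).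 A map of posets is *order continuous* if it is order preserving and preserves all existing suprema of nonempty upwards directed sets and all existing infima of nonempty downwards directed sets. **Morphisms.** Riesz homomorphisms are linear maps $f$ with $f(|x|)=|f(x)|$; they are *unit preserving* if $f(e)=e$. Boolean homomorphisms preserve $\wedge,\vee,0,1$. **The functor $\mathrm L_\infty$.** For a boolean algebra $\mathcal B$ let $S(\mathcal B)$ be the real vector space of formal linear combinations of elements of $\mathcal B$ modulo the relations $x\vee y=x+y$ for $x\wedge y=0$, let $\chi(x)$ be the class of $x$, order $S(\mathcal B)$ by the cone of combinations of the $\chi(x)$ with nonnegative coefficients, and let $\|f\|_\infty=\min\{\lambda\ge0:|f|\le\lambda\chi(1)\}$. $L_\infty(\mathcal B)$ is the completion of $S(\mathcal B)$ (in the complex case, its complexification), an MI-space with unit $\chi(1)$. A boolean homomorphism $f$ is sent to the continuous linear map determined by $\chi(x)\mapsto\chi(f(x))$. **The functor $\mathrm{PrjB}$.** Put $Z^{\perp}=\{x:|x|\wedge|y|=0\ \forall y\in Z\}$. A *projection band* of $X$ is a subset $P$ with $P+P^\perp=X$; the projection bands form a boolean algebra $\mathrm{PrjB}(X)$, ordered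 by inclusion, with $P\wedge Q=P\cap Q$, $P\vee Q=(P+Q)^{\perp\perp}$, $\neg P=P^\perp$. A unit preserving Riesz homomorphism $f:X\to Y$ of MI-spaces is sent to the boolean homomorphism $P\mapsto f(P)^{\perp\perp}$. **Claim.** For each of the following pairs of categories, $\mathrm L_\infty$ restricts to a functor from the first to the second, $\mathrm{PrjB}$ restricts to a functor from the second to the first, and the restrictions satisfy $\mathrm L_\infty\circ\mathrm{PrjB}\cong\mathrm{id}$ and $\mathrm{PrjB}\circ\mathrm L_\infty\cong\mathrm{id}$ (natural isomorphisms in the categories concerned): 1. $\mathsf B$: boolean algebras and boolean homomorphisms; $\mathsf{bL}_\infty$: MI-spaces isomorphic to $L_\infty(\mathcal B)$ for some boolean algebra $\mathcal B$, and unit preserving Riesz homomorphisms. 2. $\mathsf{ccB}$: ccb-algebras and boolean homomorphisms; $\mathsf{aL}_\infty$: abstract $L_\infty$ spaces and unit preserving Riesz homomorphisms. 3. $\mathsf{DcBc}$: Dcb-algebras and order continuous boolean homomorphisms; $\mathsf{DcaL}_\infty\mathsf c$: Dedekind complete abstract $L_\infty$ spaces and order continuous unit preserving Riesz homomorphisms.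 4. $\mathsf{mcBc}$: mcb-algebras and order continuous boolean homomorphisms; $\mathsf L_\infty\mathsf c$: proper abstract $L_\infty$ spaces and order continuous unit preserving Riesz homomorphisms. 5. $\mathsf{ccBi}$: ccb-algebras and injective boolean homomorphisms; $\mathsf{aL}_\infty\mathsf i$: abstract $L_\infty$ spaces and injective unit preserving Riesz homomorphisms. 6. $\mathsf{ccBIso}$: ccb-algebras and boolean isomorphisms; $\mathsf{aL}_\infty\mathsf{Iso}$: abstract $L_\infty$ spaces and unit preserving isometric Riesz isomorphisms. 7. $\mathsf{mcBIso}$: mcb-algebras and boolean isomorphisms; $\mathsf L_\infty\mathsf{Iso}$: proper abstract $L_\infty$ spaces and unit preserving isometric Riesz isomorphisms. Moreover these are subcategories of one another as follows: $\mathsf{mcBc}\subseteq\mathsf{DcBc}\subseteq\mathsf{ccB}\subseteq\mathsf B$, $\mathsf{mcBIso}\subseteq\mathsf{ccBIso}\subseteq\mathsf{ccBi}\subseteq\mathsf{ccB}$, $\mathsf{mcBIso}\subseteq\mathsf{mcBc}$, and $\mathsf L_\infty\mathsf c\subseteq\mathsf{DcaL}_\infty\mathsf c\subseteq\mathsf{aL}_\infty\subseteq\mathsf{bL}_\infty$,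 $\mathsf L_\infty\mathsf{Iso}\subseteq\mathsf{aL}_\infty\mathsf{Iso}\subseteq\mathsf{aL}_\infty\mathsf i\subseteq\mathsf{aL}_\infty$, $\mathsf L_\infty\mathsf{Iso}\subseteq\mathsf L_\infty\mathsf c$, so that the equivalences are compatible with these inclusions. -/

import Mathlib

set_option linter.unusedSectionVars false

open CategoryTheory
open scoped Pointwise

universe u v

namespace RieszBool

/-! ### Orders -/

/-- Every nonempty subset that is bounded above has a supremum. -/
def DedekindComplete (α : Type*) [Preorder α] : Prop :=
  ∀ s : Set α, s.Nonempty → BddAbove s → ∃ a, IsLUB s a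

/-- Every nonempty countable subset that is bounded above has a supremum, and every nonempty
countable subset that is bounded below has an infimum. -/
def CountablyComplete (α : Type*) [Preorder α] : Prop :=
  (∀ s : Set α, s.Nonempty → s.Countable → BddAbove s → ∃ a, IsLUB s a) ∧
  (∀ s : Set α, s.Nonempty → s.Countable → BddBelow s → ∃ a, IsGLB s a)

/-- Order preserving maps that preserve the existing suprema of nonempty upwards directed sets
and the existing infima of nonempty downwards directed sets. -/
structure OrderContinuous {α β : Type*} [Preorder α] [Preorder β] (f : α → β) : Prop where
  monotone : Monotone f
  map_isLUB : ∀ (s : Set α) (a : α), s.Nonempty → DirectedOn (· ≤ ·) s → IsLUB s a →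
    IsLUB (f '' s) (f a)
  map_isGLB : ∀ (s : Set α) (a : α), s.Nonempty → DirectedOn (· ≥ ·) s → IsGLB s a →
    IsGLB (f '' s) (f a)

theorem OrderContinuous.id {α : Type*} [Preorder α] : OrderContinuous (fun x : α => x) :=
  ⟨fun _ _ h => h, fun s a _ _ h => by simpa using h, fun s a _ _ h => by simpa using h⟩

theorem OrderContinuous.comp {α β γ : Type*} [Preorder α] [Preorder β] [Preorder γ]
    {g : β → γ} {f : α → β} (hg : OrderContinuous g) (hf : OrderContinuous f) :
    OrderContinuous (fun x => g (f x)) := by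
  refine ⟨fun _ _ h => hg.monotone (hf.monotone h), fun s a hs hd h => ?_, fun s a hs hd h => ?_⟩
  · have := hg.map_isLUB (f '' s) (f a) (hs.image f)
      (by
        rintro _ ⟨x, hx, rfl⟩ _ ⟨y, hy, rfl⟩
        obtain ⟨z, hz, h1, h2⟩ := hd x hx y hy
        exact ⟨f z, ⟨z, hz, rfl⟩, hf.monotone h1, hf.monotone h2⟩)
      (hf.map_isLUB s a hs hd h)
    rwa [Set.image_image] at this
  · have := hg.map_isGLB (f '' s) (f a) (hs.image f)
      (by
        rintro _ ⟨x, hx, rfl⟩ _ ⟨y, hy, rfl⟩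
        obtain ⟨z, hz, h1, h2⟩ := hd x hx y hy
        exact ⟨f z, ⟨z, hz, rfl⟩, hf.monotone h1, hf.monotone h2⟩)
      (hf.map_isGLB s a hs hd h)
    rwa [Set.image_image] at this

/-! ### Projection bands of a Riesz space -/

section Bands

variable {X : Type u} [AddCommGroup X] [Lattice X] [IsOrderedAddMonoid X]

/-- The disjoint complement `{x | |x| ∧ |y| = 0 for all y ∈ Z}`. -/
def disjCompl (Z : Set X) : Set X := {x | ∀ y ∈ Z, |x| ⊓ |y| = 0}

theorem add_inf_le {a b c : X} (ha : 0 ≤ a) (hb : 0 ≤ b) (hc : 0 ≤ c) :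
    (a + b) ⊓ c ≤ a ⊓ c + b ⊓ c := by
  rw [add_inf, inf_add, inf_add]
  refine le_inf (le_inf inf_le_left ?_) (le_inf ?_ ?_)
  · exact inf_le_right.trans (le_add_of_nonneg_right hb)
  · exact inf_le_right.trans (le_add_of_nonneg_left ha)
  · exact inf_le_right.trans (le_add_of_nonneg_right hc)

theorem disj_of_le {x x' y : X} (h : |x| ≤ |x'|) (h' : |x'| ⊓ |y| = 0) : |x| ⊓ |y| = 0 :=
  le_antisymm ((inf_le_inf_right _ h).trans h'.le) (le_inf (abs_nonneg _) (abs_nonneg _))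

theorem disj_add {x x' y : X} (h : |x| ⊓ |y| = 0) (h' : |x'| ⊓ |y| = 0) :
    |x + x'| ⊓ |y| = 0 := by
  refine le_antisymm ?_ (le_inf (abs_nonneg _) (abs_nonneg _))
  calc |x + x'| ⊓ |y| ≤ (|x| + |x'|) ⊓ |y| := inf_le_inf_right _ (abs_add_le x x')
    _ ≤ |x| ⊓ |y| + |x'| ⊓ |y| := add_inf_le (abs_nonneg _) (abs_nonneg _) (abs_nonneg _)
    _ = 0 := by rw [h, h', add_zero]

theorem eq_zero_of_abs_le_zero {x : X} (h : |x| ≤ 0) : x = 0 :=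
  le_antisymm ((le_abs_self x).trans h) (neg_nonpos.1 ((neg_le_abs x).trans h))

theorem disj_self {x : X} (h : |x| ⊓ |x| = 0) : x = 0 :=
  eq_zero_of_abs_le_zero (by rw [inf_idem] at h; exact h.le)

theorem disjCompl_anti {Y Z : Set X} (h : Y ⊆ Z) : disjCompl Z ⊆ disjCompl Y :=
  fun _ hx y hy => hx y (h hy)

theorem subset_disjCompl_disjCompl (Z : Set X) : Z ⊆ disjCompl (disjCompl Z) :=
  fun x hx y hy => by rw [inf_comm]; exact hy x hx

theorem disjCompl_triple (Z : Set X) : disjCompl (disjCompl (disjCompl Z)) = disjCompl Z :=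
  Set.Subset.antisymm (disjCompl_anti (subset_disjCompl_disjCompl Z))
    (subset_disjCompl_disjCompl _)

theorem zero_mem_disjCompl (Z : Set X) : (0 : X) ∈ disjCompl Z := fun y _ => by
  simp

theorem disjCompl_solid {Z : Set X} {x y : X} (h : |x| ≤ |y|) (hy : y ∈ disjCompl Z) :
    x ∈ disjCompl Z := fun z hz => disj_of_le h (hy z hz)

theorem disjCompl_add {Z : Set X} {x y : X} (hx : x ∈ disjCompl Z) (hy : y ∈ disjCompl Z) :
    x + y ∈ disjCompl Z := fun z hz => disj_add (hx z hz) (hy z hz)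

theorem disjCompl_neg {Z : Set X} {x : X} (hx : x ∈ disjCompl Z) : -x ∈ disjCompl Z :=
  disjCompl_solid (by simp) hx

theorem eq_zero_of_mem_disjCompl {Z : Set X} {x : X} (hx : x ∈ Z) (hx' : x ∈ disjCompl Z) :
    x = 0 := disj_self (hx' x hx)

/-- For disjoint elements, `|x + y| = |x| + |y|`. -/
theorem abs_add_of_disj {x y : X} (h : |x| ⊓ |y| = 0) : |x + y| = |x| + |y| := by
  refine le_antisymm (abs_add_le x y) ?_
  have h1 : |x| + |y| = |x| ⊔ |y| := by
    have := inf_add_sup |x| |y|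
    rw [h, zero_add] at this
    exact this.symm
  have key : ∀ a b : X, |a| ⊓ |b| = 0 → |a| ≤ |a + b| := by
    intro a b hab
    have h2 : |a| ≤ |a + b| + |b| := by
      have := abs_add_le (a + b) (-b)
      rwa [add_neg_cancel_right, abs_neg] at this
    calc |a| = (|a + b| + |b|) ⊓ |a| := (inf_eq_right.2 h2).symm
      _ ≤ |a + b| ⊓ |a| + |b| ⊓ |a| :=
        add_inf_le (abs_nonneg _) (abs_nonneg _) (abs_nonneg _)
      _ = |a + b| ⊓ |a| := by rw [inf_comm |b|, hab, add_zero]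
      _ ≤ |a + b| := inf_le_left
  rw [h1]
  refine sup_le (key x y h) ?_
  rw [add_comm x y]
  exact key y x (by rw [inf_comm]; exact h)

/-- A subset `Y` with `Y + Yᵈ = X`. -/
def IsProjectionBand (Y : Set X) : Prop := Y + disjCompl Y = Set.univ

theorem isProjectionBand_iff {Y : Set X} :
    IsProjectionBand Y ↔ ∀ x, ∃ y ∈ Y, ∃ z ∈ disjCompl Y, y + z = x := by
  simp only [IsProjectionBand, Set.eq_univ_iff_forall, Set.mem_add]

theorem IsProjectionBand.disjCompl_disjCompl {Y : Set X} (hY : IsProjectionBand Y) :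
    disjCompl (disjCompl Y) = Y := by
  refine Set.Subset.antisymm (fun x hx => ?_) (subset_disjCompl_disjCompl Y)
  obtain ⟨y, hy, z, hz, rfl⟩ := isProjectionBand_iff.1 hY x
  have : z ∈ disjCompl (disjCompl Y) := by
    have := disjCompl_add hx (disjCompl_neg (subset_disjCompl_disjCompl Y hy))
    simpa using this
  rw [eq_zero_of_mem_disjCompl hz this, add_zero]
  exact hy

theorem IsProjectionBand.compl {Y : Set X} (hY : IsProjectionBand Y) :
    IsProjectionBand (disjCompl Y) := by
  rw [isProjectionBand_iff]
  intro x
  obtain ⟨y, hy, z, hz, rfl⟩ := isProjectionBand_iff.1 hY x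
  exact ⟨z, hz, y, subset_disjCompl_disjCompl Y hy, add_comm z y⟩

theorem IsProjectionBand.solid {Y : Set X} (hY : IsProjectionBand Y) {x y : X}
    (h : |x| ≤ |y|) (hy : y ∈ Y) : x ∈ Y := by
  rw [← hY.disjCompl_disjCompl] at hy ⊢
  exact disjCompl_solid h hy

theorem IsProjectionBand.zero_mem {Y : Set X} (hY : IsProjectionBand Y) : (0 : X) ∈ Y := by
  rw [← hY.disjCompl_disjCompl]
  exact zero_mem_disjCompl _

theorem IsProjectionBand.inter {Y Z : Set X} (hY : IsProjectionBand Y)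
    (hZ : IsProjectionBand Z) : IsProjectionBand (Y ∩ Z) := by
  rw [isProjectionBand_iff]
  intro x
  obtain ⟨y, hy, y', hy', rfl⟩ := isProjectionBand_iff.1 hY x
  obtain ⟨z, hz, z', hz', rfl⟩ := isProjectionBand_iff.1 hZ y
  have hd : |z| ⊓ |z'| = 0 := by rw [inf_comm]; exact hz' z hz
  have hle : |z| ≤ |z + z'| := by
    rw [abs_add_of_disj hd]; exact le_add_of_nonneg_right (abs_nonneg _)
  refine ⟨z, ⟨hY.solid hle hy, hz⟩, z' + y', disjCompl_add ?_ ?_, by abel⟩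
  · exact disjCompl_anti Set.inter_subset_right hz'
  · exact disjCompl_anti Set.inter_subset_left hy'

theorem disjCompl_add_set {Y Z : Set X} (hY : IsProjectionBand Y) (hZ : IsProjectionBand Z) :
    disjCompl (Y + Z) = disjCompl Y ∩ disjCompl Z := by
  refine Set.Subset.antisymm (Set.subset_inter (disjCompl_anti fun y hy => ?_)
    (disjCompl_anti fun z hz => ?_)) ?_
  · exact ⟨y, hy, 0, hZ.zero_mem, add_zero y⟩
  · exact ⟨0, hY.zero_mem, z, hz, zero_add z⟩
  · rintro x ⟨hx, hx'⟩ _ ⟨y, hy, z, hz, rfl⟩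
    rw [inf_comm]
    exact disj_add (by rw [inf_comm]; exact hx y hy) (by rw [inf_comm]; exact hx' z hz)

theorem IsProjectionBand.join {Y Z : Set X} (hY : IsProjectionBand Y)
    (hZ : IsProjectionBand Z) : IsProjectionBand (disjCompl (disjCompl (Y + Z))) := by
  rw [disjCompl_add_set hY hZ]
  exact (hY.compl.inter hZ.compl).compl

theorem isProjectionBand_univ : IsProjectionBand (Set.univ : Set X) :=
  isProjectionBand_iff.2 fun x => ⟨x, trivial, 0, zero_mem_disjCompl _, add_zero x⟩

theorem disjCompl_univ : disjCompl (Set.univ : Set X) = {0} :=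
  Set.Subset.antisymm (fun _ hx => eq_zero_of_mem_disjCompl (Set.mem_univ _) hx)
    (by rintro _ rfl; exact zero_mem_disjCompl _)

theorem disjCompl_singleton_zero : disjCompl ({0} : Set X) = Set.univ := by
  refine Set.eq_univ_of_forall fun x y hy => ?_
  rw [Set.mem_singleton_iff.1 hy]
  simp

theorem inter_subset_iff {A B C : Set X} (hA : IsProjectionBand A) (hB : IsProjectionBand B)
    (hC : IsProjectionBand C) : A ∩ B ⊆ C ↔ B ⊆ disjCompl (A ∩ disjCompl C) := by
  constructor
  · rintro h v hv w ⟨hwA, hwC⟩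
    have h0 : 0 ≤ |v| ⊓ |w| := le_inf (abs_nonneg _) (abs_nonneg _)
    have hle1 : |(|v| ⊓ |w|)| ≤ |v| := by rw [abs_of_nonneg h0]; exact inf_le_left
    have hle2 : |(|v| ⊓ |w|)| ≤ |w| := by rw [abs_of_nonneg h0]; exact inf_le_right
    exact eq_zero_of_mem_disjCompl (h ⟨hA.solid hle2 hwA, hB.solid hle1 hv⟩)
      (disjCompl_solid hle2 hwC)
  · rintro h v ⟨hvA, hvB⟩
    obtain ⟨p, hp, q, hq, rfl⟩ := isProjectionBand_iff.1 hC v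
    have hd : |p| ⊓ |q| = 0 := by rw [inf_comm]; exact hq p hp
    have hle : |q| ≤ |p + q| := by
      rw [abs_add_of_disj hd]; exact le_add_of_nonneg_left (abs_nonneg _)
    rw [eq_zero_of_mem_disjCompl (Z := A ∩ disjCompl C) ⟨hA.solid hle hvA, hq⟩
      (disjCompl_solid hle (h hvB)), add_zero]
    exact hp

variable (X) in
/-- The projection bands of `X`. -/
def ProjBand : Type u := {Y : Set X // IsProjectionBand Y}

theorem join_subset {Y Z W : Set X} (hW : IsProjectionBand W) (h1 : Y ⊆ W) (h2 : Z ⊆ W) :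
    disjCompl (disjCompl (Y + Z)) ⊆ W := by
  rw [← hW.disjCompl_disjCompl]
  refine disjCompl_anti (disjCompl_anti ?_)
  rintro _ ⟨y, hy, z, hz, rfl⟩
  rw [← hW.disjCompl_disjCompl]
  exact disjCompl_add (subset_disjCompl_disjCompl _ (h1 hy)) (subset_disjCompl_disjCompl _ (h2 hz))

theorem subset_join_left {Y Z : Set X} (hZ : IsProjectionBand Z) :
    Y ⊆ disjCompl (disjCompl (Y + Z)) := fun y hy =>
  subset_disjCompl_disjCompl _ ⟨y, hy, 0, hZ.zero_mem, add_zero y⟩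

theorem subset_join_right {Y Z : Set X} (hY : IsProjectionBand Y) :
    Z ⊆ disjCompl (disjCompl (Y + Z)) := fun z hz =>
  subset_disjCompl_disjCompl _ ⟨0, hY.zero_mem, z, hz, zero_add z⟩

instance ProjBand.instLattice : Lattice (ProjBand X) where
  le Y Z := Y.1 ⊆ Z.1
  le_refl Y := Set.Subset.refl _
  le_trans _ _ _ h h' := Set.Subset.trans h h'
  le_antisymm _ _ h h' := Subtype.ext (Set.Subset.antisymm h h')
  sup Y Z := ⟨disjCompl (disjCompl (Y.1 + Z.1)), Y.2.join Z.2⟩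
  inf Y Z := ⟨Y.1 ∩ Z.1, Y.2.inter Z.2⟩
  le_sup_left _ Z := subset_join_left Z.2
  le_sup_right Y _ := subset_join_right Y.2
  sup_le _ _ W h h' := join_subset W.2 h h'
  inf_le_left _ _ := Set.inter_subset_left
  inf_le_right _ _ := Set.inter_subset_right
  le_inf _ _ _ h h' := Set.subset_inter h h'

instance ProjBand.instDistribLattice : DistribLattice (ProjBand X) :=
  DistribLattice.ofInfSupLe fun a b c => by
    have hd := (a ⊓ b ⊔ a ⊓ c).2
    refine (inter_subset_iff a.2 (b ⊔ c).2 hd).2 ?_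
    refine join_subset (a.2.inter hd.compl).compl ?_ ?_
    · exact (inter_subset_iff a.2 b.2 hd).1 (le_sup_left (a := a ⊓ b) (b := a ⊓ c))
    · exact (inter_subset_iff a.2 c.2 hd).1 (le_sup_right (a := a ⊓ b) (b := a ⊓ c))

/-- The boolean algebra of projection bands: `Y ∧ Z = Y ∩ Z`, `Y ∨ Z = (Y + Z)ᵈᵈ`, `¬Y = Yᵈ`,
ordered by inclusion. -/
instance ProjBand.instBooleanAlgebra : BooleanAlgebra (ProjBand X) where
  __ := ProjBand.instDistribLattice
  compl Y := ⟨disjCompl Y.1, Y.2.compl⟩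
  top := ⟨Set.univ, isProjectionBand_univ⟩
  bot := ⟨{0}, by rw [← disjCompl_univ]; exact isProjectionBand_univ.compl⟩
  inf_compl_le_bot Y := by
    rintro x ⟨hx, hx'⟩
    exact eq_zero_of_mem_disjCompl hx hx'
  top_le_sup_compl Y := by
    intro x _
    refine subset_disjCompl_disjCompl _ ?_
    exact (isProjectionBand_iff.1 Y.2 x)
  le_top Y := Set.subset_univ _
  bot_le Y := by
    rintro _ rfl
    exact Y.2.zero_mem

end Bands

/-! ### MI-spaces -/

/-- An MI-space: a (real) Banach lattice together with an order unit `unit` such that its norm is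
the order unit norm `‖x‖ = min {r ≥ 0 | |x| ≤ r • unit}`. -/
structure MISpace : Type (u + 1) where
  carrier : Type u
  [normedAddCommGroup : NormedAddCommGroup carrier]
  [normedSpace : NormedSpace ℝ carrier]
  [lattice : Lattice carrier]
  [isOrderedAddMonoid : IsOrderedAddMonoid carrier]
  [isOrderedModule : IsOrderedModule ℝ carrier]
  [hasSolidNorm : HasSolidNorm carrier]
  [completeSpace : CompleteSpace carrier]
  unit : carrier
  unit_nonneg : 0 ≤ unit
  isOrderUnit : ∀ x : carrier, ∃ r : ℝ, 0 < r ∧ |x| ≤ r • unit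
  isLeast_norm : ∀ x : carrier, IsLeast {r : ℝ | 0 ≤ r ∧ |x| ≤ r • unit} ‖x‖

namespace MISpace

instance : CoeSort MISpace.{u} (Type u) := ⟨MISpace.carrier⟩

attribute [instance] normedAddCommGroup normedSpace lattice isOrderedAddMonoid isOrderedModule
  hasSolidNorm completeSpace

/-- Unit preserving Riesz homomorphisms. -/
@[ext]
structure Hom (X Y : MISpace.{u}) where
  toLinearMap : X →ₗ[ℝ] Y
  map_sup' : ∀ x y, toLinearMap (x ⊔ y) = toLinearMap x ⊔ toLinearMap y
  map_unit' : toLinearMap X.unit = Y.unit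

/-- The category of MI-spaces and unit preserving Riesz homomorphisms. -/
instance : Category MISpace.{u} where
  Hom := Hom
  id X := ⟨LinearMap.id, fun _ _ => rfl, rfl⟩
  comp f g := ⟨g.toLinearMap.comp f.toLinearMap,
    fun x y => by simp [f.map_sup', g.map_sup'], by simp [f.map_unit', g.map_unit']⟩

instance {X Y : MISpace.{u}} : CoeFun (X ⟶ Y) (fun _ => X → Y) :=
  ⟨fun f => f.toLinearMap⟩

section

variable {X Y Z : MISpace.{u}}

@[simp] theorem id_apply (x : X) : (𝟙 X : X ⟶ X) x = x := rfl

@[simp] theorem comp_apply (f : X ⟶ Y) (g : Y ⟶ Z) (x : X) : (f ≫ g) x = g (f x) := rfl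

@[ext] theorem hom_ext {f g : X ⟶ Y} (h : ∀ x : X, f x = g x) : f = g :=
  Hom.ext (LinearMap.ext h)

theorem map_add (f : X ⟶ Y) (x y : X) : f (x + y) = f x + f y := f.toLinearMap.map_add x y

theorem map_neg (f : X ⟶ Y) (x : X) : f (-x) = -f x := f.toLinearMap.map_neg x

theorem map_smul (f : X ⟶ Y) (r : ℝ) (x : X) : f (r • x) = r • f x := f.toLinearMap.map_smul r x

theorem map_zero (f : X ⟶ Y) : f 0 = 0 := f.toLinearMap.map_zero

theorem map_sup (f : X ⟶ Y) (x y : X) : f (x ⊔ y) = f x ⊔ f y := f.map_sup' x y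

theorem map_unit (f : X ⟶ Y) : f X.unit = Y.unit := f.map_unit'

theorem map_inf (f : X ⟶ Y) (x y : X) : f (x ⊓ y) = f x ⊓ f y := by
  have h : ∀ {W : MISpace.{u}} (a b : W), a ⊓ b = -(-a ⊔ -b) := fun a b => by
    rw [neg_sup, neg_neg, neg_neg]
  rw [h, h, map_neg, map_sup, map_neg, map_neg]

theorem map_abs (f : X ⟶ Y) (x : X) : f |x| = |f x| := by
  show f (x ⊔ -x) = f x ⊔ -f x
  rw [map_sup, map_neg]

theorem monotone (f : X ⟶ Y) : Monotone (f : X → Y) := fun x y h => by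
  rw [← sup_eq_right] at h ⊢
  rw [← map_sup, h]

end

end MISpace

section PrjBMap

open MISpace

variable {X Y Z : MISpace.{u}}

theorem disj_smul_nonneg {x y : X} (hx : 0 ≤ x) (hy : 0 ≤ y) (h : x ⊓ y = 0) {r s : ℝ}
    (hr : 0 ≤ r) (hs : 0 ≤ s) : (r • x) ⊓ (s • y) = 0 := by
  have key : ∀ {a b : X}, 0 ≤ a → 0 ≤ b → a ⊓ b = 0 → ∀ {t : ℝ}, 0 ≤ t → (t • a) ⊓ b = 0 := by
    intro a b ha hb hab t ht
    have ht1 : 0 < t + 1 := by linarith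
    have h1 : (t • a) ⊓ b ≤ ((t + 1) • a) ⊓ ((t + 1) • b) := by
      refine inf_le_inf (smul_le_smul_of_nonneg_right (by linarith) ha) ?_
      calc b = (1 : ℝ) • b := (one_smul _ _).symm
        _ ≤ (t + 1) • b := smul_le_smul_of_nonneg_right (by linarith) hb
    have h2 : ((t + 1) • a) ⊓ ((t + 1) • b) ≤ 0 := by
      have h3 : (t + 1)⁻¹ • (((t + 1) • a) ⊓ ((t + 1) • b)) ≤ a ⊓ b := by
        refine le_inf ?_ ?_
        · calc _ ≤ (t + 1)⁻¹ • ((t + 1) • a) :=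
                smul_le_smul_of_nonneg_left inf_le_left (by positivity)
            _ = a := by rw [smul_smul, inv_mul_cancel₀ ht1.ne', one_smul]
        · calc _ ≤ (t + 1)⁻¹ • ((t + 1) • b) :=
                smul_le_smul_of_nonneg_left inf_le_right (by positivity)
            _ = b := by rw [smul_smul, inv_mul_cancel₀ ht1.ne', one_smul]
      have h4 := smul_le_smul_of_nonneg_left h3 ht1.le
      rwa [smul_smul, mul_inv_cancel₀ ht1.ne', one_smul, hab, smul_zero] at h4
    exact le_antisymm (h1.trans h2) (le_inf (smul_nonneg ht ha) hb)
  have h1 := key hx hy h hr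
  rw [inf_comm] at h1 ⊢
  exact key hy (smul_nonneg hr hx) h1 hs

/-- `p` and `q` are complementary components of the order unit. -/
structure IsSplit (p q : X) : Prop where
  nonneg_left : 0 ≤ p
  nonneg_right : 0 ≤ q
  inf_eq : p ⊓ q = 0
  add_eq : p + q = X.unit

theorem IsSplit.symm {p q : X} (h : IsSplit p q) : IsSplit q p :=
  ⟨h.2, h.1, by rw [inf_comm, h.3], by rw [add_comm, h.4]⟩

theorem IsSplit.map {p q : X} (h : IsSplit p q) (f : X ⟶ Y) : IsSplit (f p) (f q) := by
  refine ⟨?_, ?_, ?_, ?_⟩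
  · rw [← map_zero f]; exact monotone f h.1
  · rw [← map_zero f]; exact monotone f h.2
  · rw [← map_inf, h.3, map_zero]
  · rw [← map_add, h.4, map_unit]

theorem IsSplit.mem_disjCompl_singleton {p q : X} (h : IsSplit p q) {x : X} :
    x ∈ disjCompl {p} ↔ |x| ⊓ p = 0 := by
  simp [disjCompl, abs_of_nonneg h.1]

theorem le_of_le_add_of_inf_eq_zero {x a b : X} (ha : 0 ≤ a) (hb : 0 ≤ b) (hx : 0 ≤ x)
    (h : x ≤ a + b) (hxb : x ⊓ b = 0) : x ≤ a :=
  calc x = (a + b) ⊓ x := (inf_eq_right.2 h).symm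
    _ ≤ a ⊓ x + b ⊓ x := add_inf_le ha hb hx
    _ = a ⊓ x := by rw [inf_comm b, hxb, add_zero]
    _ ≤ a := inf_le_left

theorem IsSplit.exists_abs_le {p q : X} (h : IsSplit p q) {x : X} (hx : |x| ⊓ q = 0) :
    ∃ r : ℝ, 0 ≤ r ∧ |x| ≤ r • p := by
  obtain ⟨r, hr, hle⟩ := X.isOrderUnit x
  refine ⟨r, hr.le, ?_⟩
  rw [← h.add_eq, smul_add] at hle
  refine le_of_le_add_of_inf_eq_zero (smul_nonneg hr.le h.1) (smul_nonneg hr.le h.2)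
    (abs_nonneg x) hle ?_
  have := disj_smul_nonneg (abs_nonneg x) h.2 hx zero_le_one hr.le
  rwa [one_smul] at this

theorem IsSplit.disj_of_abs_le {p q : X} (h : IsSplit p q) {x : X} {r : ℝ} (hr : 0 ≤ r)
    (hx : |x| ≤ r • p) : |x| ⊓ q = 0 := by
  have := disj_smul_nonneg h.1 h.2 h.3 hr zero_le_one
  rw [one_smul] at this
  exact le_antisymm ((inf_le_inf_right _ hx).trans this.le) (le_inf (abs_nonneg _) h.2)

theorem IsSplit.disjCompl_eq {p q : X} (h : IsSplit p q) :
    disjCompl (disjCompl {p}) = disjCompl {q} := by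
  refine Set.Subset.antisymm (disjCompl_anti ?_) fun x hx y hy => ?_
  · rintro _ rfl
    rw [h.mem_disjCompl_singleton, abs_of_nonneg h.2, inf_comm, h.3]
  · rw [h.symm.mem_disjCompl_singleton] at hx
    rw [h.mem_disjCompl_singleton] at hy
    obtain ⟨r, hr, hle⟩ := h.exists_abs_le hx
    obtain ⟨s, hs, hle'⟩ := h.symm.exists_abs_le hy
    exact le_antisymm ((inf_le_inf hle hle').trans (disj_smul_nonneg h.1 h.2 h.3 hr hs).le)
      (le_inf (abs_nonneg _) (abs_nonneg _))

theorem IsSplit.isProjectionBand {p q : X} (h : IsSplit p q) :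
    IsProjectionBand (disjCompl (disjCompl {p})) := by
  have hpos : ∀ x : X, 0 ≤ x → ∃ y ∈ disjCompl (disjCompl {p}),
      ∃ z ∈ disjCompl (disjCompl (disjCompl {p})), y + z = x := by
    intro x hx
    obtain ⟨r, hr, hle⟩ := X.isOrderUnit x
    rw [abs_of_nonneg hx, ← h.add_eq, smul_add] at hle
    have h1 : 0 ≤ x ⊓ r • p := le_inf hx (smul_nonneg hr.le h.1)
    have h2 : 0 ≤ x - x ⊓ r • p := sub_nonneg.2 inf_le_left
    refine ⟨x ⊓ r • p, ?_, x - x ⊓ r • p, ?_, by abel⟩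
    · rw [h.disjCompl_eq, h.symm.mem_disjCompl_singleton]
      exact h.disj_of_abs_le hr.le (by rw [abs_of_nonneg h1]; exact inf_le_right)
    · rw [disjCompl_triple, h.mem_disjCompl_singleton]
      refine h.symm.disj_of_abs_le hr.le ?_
      rw [abs_of_nonneg h2, sub_le_comm]
      refine le_inf (sub_le_self _ (smul_nonneg hr.le h.2)) ?_
      rw [sub_le_iff_le_add]
      exact hle
  rw [isProjectionBand_iff]
  intro x
  obtain ⟨y, hy, z, hz, hyz⟩ := hpos x⁺ (posPart_nonneg x)
  obtain ⟨y', hy', z', hz', hyz'⟩ := hpos x⁻ (negPart_nonneg x)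
  refine ⟨y + -y', disjCompl_add hy (disjCompl_neg hy'), z + -z',
    disjCompl_add hz (disjCompl_neg hz'), ?_⟩
  calc y + -y' + (z + -z') = (y + z) - (y' + z') := by abel
    _ = x := by rw [hyz, hyz', posPart_sub_negPart]

/-- Every projection band is generated by the component of the order unit in it. -/
theorem exists_isSplit {P : Set X} (hP : IsProjectionBand P) :
    ∃ p q : X, p ∈ P ∧ q ∈ disjCompl P ∧ IsSplit p q := by
  obtain ⟨p, hp, q, hq, hpq⟩ := isProjectionBand_iff.1 hP X.unit
  have hd : |p| ⊓ |q| = 0 := by rw [inf_comm]; exact hq p hp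
  have habs : |p| + |q| = p + q := by
    rw [← abs_add_of_disj hd, hpq, abs_of_nonneg X.unit_nonneg]
  have h1 : |p| = p := by
    refine le_antisymm ?_ (le_abs_self p)
    have : |p| + |q| ≤ p + |q| := by rw [habs]; exact add_le_add_right (le_abs_self q) p
    exact le_of_add_le_add_right this
  have h2 : |q| = q := by rw [h1] at habs; exact add_left_cancel habs
  rw [h1, h2] at hd
  exact ⟨p, q, hp, hq, h1 ▸ abs_nonneg p, h2 ▸ abs_nonneg q, hd, hpq⟩

theorem eq_of_isSplit {P : Set X} (hP : IsProjectionBand P) {p q : X} (hp : p ∈ P)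
    (hq : q ∈ disjCompl P) (h : IsSplit p q) : P = disjCompl (disjCompl {p}) := by
  refine Set.Subset.antisymm ?_ ?_
  · rw [h.disjCompl_eq]
    intro x hx
    rw [h.symm.mem_disjCompl_singleton, ← abs_of_nonneg h.2, inf_comm]
    exact hq x hx
  · have : ({p} : Set X) ⊆ P := by rintro _ rfl; exact hp
    rw [← hP.disjCompl_disjCompl]
    exact disjCompl_anti (disjCompl_anti this)

theorem image_eq_of_isSplit {P : Set X} {p q : X} (hp : p ∈ P)
    (hq : q ∈ disjCompl P) (h : IsSplit p q) (f : X ⟶ Y) :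
    disjCompl (disjCompl (f '' P)) = disjCompl (disjCompl {f p}) := by
  refine Set.Subset.antisymm ?_ (disjCompl_anti (disjCompl_anti ?_))
  · have hsub : f '' P ⊆ disjCompl (disjCompl {f p}) := by
      rintro _ ⟨x, hx, rfl⟩
      rw [(h.map f).disjCompl_eq, (h.map f).symm.mem_disjCompl_singleton, ← map_abs, ← map_inf]
      have : |x| ⊓ q = 0 := by
        rw [← abs_of_nonneg h.2, inf_comm]
        exact hq x hx
      rw [this, map_zero]
    calc disjCompl (disjCompl (f '' P))
        ⊆ disjCompl (disjCompl (disjCompl (disjCompl {f p}))) :=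
          disjCompl_anti (disjCompl_anti hsub)
      _ = disjCompl (disjCompl {f p}) := by rw [disjCompl_triple]
  · rintro _ rfl
    exact ⟨p, hp, rfl⟩

/-- The map on projection bands determined by a unit preserving Riesz homomorphism `f`: the
projection band `P` is sent to the band `f(P)ᵈᵈ` generated by its image. -/
def ProjBand.map (f : X ⟶ Y) (P : ProjBand X) : ProjBand Y :=
  ⟨disjCompl (disjCompl (f '' P.1)), by
    obtain ⟨p, q, hp, hq, h⟩ := exists_isSplit P.2
    rw [image_eq_of_isSplit hp hq h f]
    exact (h.map f).isProjectionBand⟩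

/-- The projection band generated by a component of the order unit. -/
def IsSplit.band {p q : X} (h : IsSplit p q) : ProjBand X :=
  ⟨disjCompl (disjCompl {p}), h.isProjectionBand⟩

theorem IsSplit.band_map {p q : X} (h : IsSplit p q) (f : X ⟶ Y) :
    ProjBand.map f h.band = (h.map f).band :=
  Subtype.ext (image_eq_of_isSplit (subset_disjCompl_disjCompl _ (Set.mem_singleton p))
    (by
      show q ∈ disjCompl (disjCompl (disjCompl {p}))
      rw [disjCompl_triple, ← h.symm.disjCompl_eq]
      exact subset_disjCompl_disjCompl _ (Set.mem_singleton q)) h f)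

theorem ProjBand.exists_eq_band (P : ProjBand X) : ∃ p q : X, ∃ h : IsSplit p q, P = h.band := by
  obtain ⟨p, q, hp, hq, h⟩ := exists_isSplit P.2
  exact ⟨p, q, h, Subtype.ext (eq_of_isSplit P.2 hp hq h)⟩

theorem IsSplit.band_compl {p q : X} (h : IsSplit p q) : h.bandᶜ = h.symm.band :=
  Subtype.ext (by
    show disjCompl (disjCompl (disjCompl {p})) = disjCompl (disjCompl {q})
    rw [disjCompl_triple, h.symm.disjCompl_eq])

theorem ProjBand.map_compl (f : X ⟶ Y) (P : ProjBand X) :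
    ProjBand.map f Pᶜ = (ProjBand.map f P)ᶜ := by
  obtain ⟨p, q, h, rfl⟩ := P.exists_eq_band
  rw [h.band_compl, h.symm.band_map, h.band_map, (h.map f).band_compl]

theorem ProjBand.map_mono (f : X ⟶ Y) {P Q : ProjBand X} (h : P ≤ Q) :
    ProjBand.map f P ≤ ProjBand.map f Q :=
  disjCompl_anti (disjCompl_anti (Set.image_mono h))

theorem ProjBand.map_bot (f : X ⟶ Y) : ProjBand.map f ⊥ = ⊥ :=
  Subtype.ext (by
    show disjCompl (disjCompl (f '' {0})) = {0}
    rw [Set.image_singleton, map_zero, disjCompl_singleton_zero, disjCompl_univ])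

theorem ProjBand.map_sup (f : X ⟶ Y) (P Q : ProjBand X) :
    ProjBand.map f (P ⊔ Q) = ProjBand.map f P ⊔ ProjBand.map f Q := by
  refine le_antisymm ?_ (sup_le (map_mono f le_sup_left) (map_mono f le_sup_right))
  obtain ⟨p, q, hp, hq, h⟩ := exists_isSplit (P ⊔ Q).2
  have hR := (ProjBand.map f P ⊔ ProjBand.map f Q).2
  show disjCompl (disjCompl (f '' (P ⊔ Q).1)) ⊆ (ProjBand.map f P ⊔ ProjBand.map f Q).1
  rw [← hR.disjCompl_disjCompl, image_eq_of_isSplit hp hq h f]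
  refine disjCompl_anti (disjCompl_anti ?_)
  rintro _ rfl
  obtain ⟨a, ha, b, hb, rfl⟩ : p ∈ P.1 + Q.1 := by
    obtain ⟨a, ha, a', ha', rfl⟩ := isProjectionBand_iff.1 P.2 p
    refine ⟨a, ha, a', ?_, rfl⟩
    obtain ⟨b, hb, b', hb', rfl⟩ := isProjectionBand_iff.1 Q.2 a'
    have hd : |b| ⊓ |b'| = 0 := by rw [inf_comm]; exact hb' b hb
    have hb'P : b' ∈ disjCompl P.1 := disjCompl_solid
      (by rw [abs_add_of_disj hd]; exact le_add_of_nonneg_left (abs_nonneg _)) ha'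
    have haJ : a ∈ (P ⊔ Q).1 := subset_join_left Q.2 ha
    have hbJ : b ∈ (P ⊔ Q).1 := subset_join_right P.2 hb
    have hb'J : b' ∈ (P ⊔ Q).1 := by
      rw [← (P ⊔ Q).2.disjCompl_disjCompl] at hp haJ hbJ ⊢
      have := disjCompl_add hp (disjCompl_neg (disjCompl_add haJ hbJ))
      have h2 : a + (b + b') + -(a + b) = b' := by abel
      rwa [h2] at this
    have hb'0 : b' = 0 := by
      refine eq_zero_of_mem_disjCompl hb'J ?_
      have : b' ∈ disjCompl (P.1 + Q.1) := by
        rw [disjCompl_add_set P.2 Q.2]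
        exact ⟨hb'P, hb'⟩
      show b' ∈ disjCompl (disjCompl (disjCompl (P.1 + Q.1)))
      rwa [disjCompl_triple]
    rw [hb'0, add_zero]
    exact hb
  show f (a + b) ∈ _
  rw [MISpace.map_add, ← hR.disjCompl_disjCompl]
  refine disjCompl_add (subset_disjCompl_disjCompl _ ?_) (subset_disjCompl_disjCompl _ ?_)
  · exact subset_join_left (ProjBand.map f Q).2 (subset_disjCompl_disjCompl _ ⟨a, ha, rfl⟩)
  · exact subset_join_right (ProjBand.map f P).2 (subset_disjCompl_disjCompl _ ⟨b, hb, rfl⟩)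

/-- `ProjBand.map` as a boolean homomorphism. -/
def ProjBand.mapHom (f : X ⟶ Y) : BoundedLatticeHom (ProjBand X) (ProjBand Y) where
  toFun := ProjBand.map f
  map_sup' := ProjBand.map_sup f
  map_inf' P Q := by
    show ProjBand.map f (P ⊓ Q) = ProjBand.map f P ⊓ ProjBand.map f Q
    have : P ⊓ Q = (Pᶜ ⊔ Qᶜ)ᶜ := by simp
    rw [this, ProjBand.map_compl, ProjBand.map_sup, ProjBand.map_compl, ProjBand.map_compl]
    simp
  map_top' := by
    show ProjBand.map f ⊤ = ⊤
    rw [← compl_bot, ProjBand.map_compl, ProjBand.map_bot, compl_bot]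
  map_bot' := ProjBand.map_bot f

theorem ProjBand.map_id (P : ProjBand X) : ProjBand.map (𝟙 X) P = P := by
  obtain ⟨p, q, h, rfl⟩ := P.exists_eq_band
  rw [h.band_map]

theorem ProjBand.map_comp (f : X ⟶ Y) (g : Y ⟶ Z) (P : ProjBand X) :
    ProjBand.map (f ≫ g) P = ProjBand.map g (ProjBand.map f P) := by
  obtain ⟨p, q, h, rfl⟩ := P.exists_eq_band
  rw [h.band_map, h.band_map, (h.map f).band_map]

end PrjBMap

/-- The functor `PrjB`: an MI-space is sent to the boolean algebra of its projection bands, and a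
unit preserving Riesz homomorphism `f` to `P ↦ f(P)ᵈᵈ`. -/
def PrjB : MISpace.{u} ⥤ BoolAlg.{u} where
  obj X := BoolAlg.of (ProjBand X)
  map f := BoolAlg.ofHom (ProjBand.mapHom f)
  map_id _ := BoolAlg.ext fun P => ProjBand.map_id P
  map_comp f g := BoolAlg.ext fun P => ProjBand.map_comp f g P

/-! ### The Banach lattice `L∞(B)` of a boolean algebra -/

section SimpleFunctions

noncomputable section

variable (B : Type u) [BooleanAlgebra B]

/-- The span of the elements `(x ∨ y) - x - y` with `x ∧ y = 0` in the vector space of formal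
real linear combinations of elements of `B`. -/
def addRel : Submodule ℝ (B →₀ ℝ) :=
  Submodule.span ℝ {v | ∃ x y : B, x ⊓ y = ⊥ ∧
    v = Finsupp.single (x ⊔ y) 1 - Finsupp.single x 1 - Finsupp.single y 1}

/-- The vector space of formal real linear combinations of elements of `B`, modulo the
relations `x ∨ y = x + y` for disjoint `x` and `y`. -/
def Simple : Type u := (B →₀ ℝ) ⧸ addRel B

instance : AddCommGroup (Simple B) := inferInstanceAs (AddCommGroup ((B →₀ ℝ) ⧸ addRel B))

instance : Module ℝ (Simple B) := inferInstanceAs (Module ℝ ((B →₀ ℝ) ⧸ addRel B))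

namespace Simple

/-- The quotient map. -/
def mk : (B →₀ ℝ) →ₗ[ℝ] Simple B := (addRel B).mkQ

variable {B}

/-- The image of `x ∈ B` in `Simple B`. -/
def chi (x : B) : Simple B := mk B (Finsupp.single x 1)

theorem chi_sup {x y : B} (h : x ⊓ y = ⊥) : chi (x ⊔ y) = chi x + chi y := by
  have : mk B (Finsupp.single (x ⊔ y) 1 - Finsupp.single x 1 - Finsupp.single y 1) = 0 :=
    (Submodule.Quotient.mk_eq_zero _).2 (Submodule.subset_span ⟨x, y, h, rfl⟩)
  rw [_root_.map_sub, _root_.map_sub] at this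
  rw [← sub_eq_zero, ← sub_sub]
  exact this

theorem chi_bot : chi (⊥ : B) = 0 := by
  have := chi_sup (x := (⊥ : B)) (y := ⊥) (by simp)
  simpa using this

theorem mk_single (x : B) (r : ℝ) : mk B (Finsupp.single x r) = r • chi x := by
  rw [chi, ← _root_.map_smul, Finsupp.smul_single, smul_eq_mul, mul_one]

theorem induction {p : Simple B → Prop} (zero : p 0)
    (add : ∀ (f : Simple B) (r : ℝ) (x : B), p f → p (f + r • chi x)) (f : Simple B) : p f := by
  obtain ⟨c, rfl⟩ := Submodule.mkQ_surjective (addRel B) f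
  change p (mk B c)
  induction c using Finsupp.induction with
  | zero => simpa using zero
  | single_add a b f _ _ ih =>
    rw [add_comm, _root_.map_add, mk_single]
    exact add _ _ _ ih

/-- The order: `f ≤ g` iff `g - f` is a combination of elements of `B` with nonnegative
coefficients. -/
instance : LE (Simple B) := ⟨fun f g => ∃ c : B →₀ ℝ, (∀ x, 0 ≤ c x) ∧ mk B c = g - f⟩

theorem le_def {f g : Simple B} : f ≤ g ↔ ∃ c : B →₀ ℝ, (∀ x, 0 ≤ c x) ∧ mk B c = g - f := Iff.rfl

open Classical in
/-- Evaluation at a point of the dual space of `B`. -/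
def ev (p : BoundedLatticeHom B Prop) : Simple B →ₗ[ℝ] ℝ :=
  (addRel B).liftQ (Finsupp.linearCombination ℝ fun x => if p x then (1 : ℝ) else 0) (by
    rw [addRel, Submodule.span_le]
    rintro _ ⟨x, y, h, rfl⟩
    have h1 : p (x ⊔ y) ↔ p x ∨ p y := by rw [SupHomClass.map_sup]; rfl
    have h2 : ¬ (p x ∧ p y) := by
      have : p (x ⊓ y) ↔ p x ∧ p y := by rw [InfHomClass.map_inf]; rfl
      rw [← this, h, BotHomClass.map_bot]
      exact id
    simp only [SetLike.mem_coe, LinearMap.mem_ker, _root_.map_sub,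
      Finsupp.linearCombination_single, smul_eq_mul, one_mul]
    by_cases hx : p x <;> by_cases hy : p y <;> simp_all)

open Classical in
theorem ev_mk (p : BoundedLatticeHom B Prop) (c : B →₀ ℝ) :
    ev p (mk B c) = Finsupp.linearCombination ℝ (fun x => if p x then (1 : ℝ) else 0) c :=
  Submodule.liftQ_apply _ _ _

open Classical in
theorem ev_chi (p : BoundedLatticeHom B Prop) (x : B) :
    ev p (chi x) = if p x then 1 else 0 := by
  rw [chi, ev_mk, Finsupp.linearCombination_single, one_smul]

theorem ev_mk_nonneg (p : BoundedLatticeHom B Prop) {c : B →₀ ℝ} (hc : ∀ x, 0 ≤ c x) :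
    0 ≤ ev p (mk B c) := by
  rw [ev_mk, Finsupp.linearCombination_apply]
  refine Finset.sum_nonneg fun x _ => mul_nonneg (hc x) ?_
  split_ifs <;> norm_num

theorem exists_point {x : B} (hx : x ≠ ⊥) : ∃ p : BoundedLatticeHom B Prop, p x := by
  have hd : Disjoint ((Order.PFilter.principal x : Order.PFilter B) : Set B)
      ((Order.Ideal.principal (⊥ : B) : Order.Ideal B) : Set B) := by
    rw [Set.disjoint_left]
    intro y hy hy'
    have h1 : x ≤ y := hy
    have h2 : y ≤ ⊥ := hy'
    exact hx (le_bot_iff.1 (h1.trans h2))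
  obtain ⟨J, hJ, -, hJd⟩ := DistribLattice.prime_ideal_of_disjoint_filter_ideal hd
  have hxJ : x ∉ J := fun h => Set.disjoint_left.1 hJd (show x ≤ x from le_rfl) h
  refine ⟨⟨⟨⟨fun y => y ∉ J, fun a b => ?_⟩, fun a b => ?_⟩, ?_, ?_⟩, hxJ⟩
  · show (a ⊔ b ∉ J) = (a ∉ J ∨ b ∉ J)
    rw [Order.Ideal.sup_mem_iff]
    exact propext (by tauto)
  · show (a ⊓ b ∉ J) = (a ∉ J ∧ b ∉ J)
    refine propext ⟨fun h => ⟨fun ha => h (J.lower inf_le_left ha),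
      fun hb => h (J.lower inf_le_right hb)⟩, fun h h' => ?_⟩
    rcases hJ.mem_or_mem h' with ha | hb
    · exact h.1 ha
    · exact h.2 hb
  · show (⊤ ∉ J) = True
    exact propext ⟨fun _ => trivial, fun _ h => hxJ (J.lower le_top h)⟩
  · show (⊥ ∉ J) = False
    exact propext ⟨fun h => h J.bot_mem, False.elim⟩

/-- Every element of `Simple B` is a linear combination of pairwise disjoint elements of `B`. -/
theorem exists_disjoint (f : Simple B) : ∃ (n : ℕ) (x : Fin n → B) (a : Fin n → ℝ),
    (∀ i j, i ≠ j → x i ⊓ x j = ⊥) ∧ f = ∑ i, a i • chi (x i) := by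
  suffices h : ∃ (ι : Type) (_ : Fintype ι) (x : ι → B) (a : ι → ℝ),
      (∀ i j, i ≠ j → x i ⊓ x j = ⊥) ∧ f = ∑ i, a i • chi (x i) by
    obtain ⟨ι, _, x, a, hx, hf⟩ := h
    let e := (Fintype.equivFin ι).symm
    refine ⟨Fintype.card ι, x ∘ e, a ∘ e, fun i j hij => hx _ _ (e.injective.ne hij), ?_⟩
    rw [hf]
    exact (Equiv.sum_comp e fun i => a i • chi (x i)).symm
  induction f using Simple.induction with
  | zero => exact ⟨Empty, inferInstance, Empty.elim, Empty.elim, fun i => i.elim, by simp⟩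
  | add f r b ih =>
    obtain ⟨ι, _, x, a, hx, rfl⟩ := ih
    let s : B := Finset.univ.sup x
    refine ⟨(ι ⊕ ι) ⊕ Unit, inferInstance,
      Sum.elim (Sum.elim (fun i => x i ⊓ b) (fun i => x i ⊓ bᶜ)) (fun _ => b ⊓ sᶜ),
      Sum.elim (Sum.elim (fun i => a i + r) a) (fun _ => r), ?_, ?_⟩
    · have h1 : ∀ i j (c d : B), i ≠ j → (x i ⊓ c) ⊓ (x j ⊓ d) = ⊥ := fun i j c d hij => by
        rw [inf_inf_inf_comm, hx i j hij, bot_inf_eq]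
      have h2 : ∀ i j (c d : B), c ⊓ d = ⊥ → (x i ⊓ c) ⊓ (x j ⊓ d) = ⊥ := fun i j c d h => by
        rw [inf_inf_inf_comm, h, inf_bot_eq]
      have h3 : ∀ i (c d : B), (x i ⊓ c) ⊓ (d ⊓ sᶜ) = ⊥ := fun i c d => by
        have : x i ≤ s := Finset.le_sup (Finset.mem_univ i)
        rw [inf_comm d, inf_inf_inf_comm, ← le_bot_iff]
        calc x i ⊓ sᶜ ⊓ (c ⊓ d) ≤ x i ⊓ sᶜ := inf_le_left
          _ ≤ s ⊓ sᶜ := inf_le_inf_right _ this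
          _ = ⊥ := inf_compl_eq_bot
      rintro ((i | i) | i) ((j | j) | j) hij
      · exact h1 i j b b fun h => hij (by rw [h])
      · exact h2 i j b bᶜ inf_compl_eq_bot
      · exact h3 i b b
      · exact h2 i j bᶜ b compl_inf_eq_bot
      · exact h1 i j bᶜ bᶜ fun h => hij (by rw [h])
      · exact h3 i bᶜ b
      · exact (inf_comm _ _).trans (h3 j b b)
      · exact (inf_comm _ _).trans (h3 j bᶜ b)
      · exact absurd rfl hij
    · have hs : chi b = ∑ i, chi (x i ⊓ b) + chi (b ⊓ sᶜ) := by
        have h1 : ∀ t : Finset ι, chi (t.sup x ⊓ b) = ∑ i ∈ t, chi (x i ⊓ b) := by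
          classical
          intro t
          induction t using Finset.induction_on with
          | empty => simp [chi_bot]
          | insert i t hi ih =>
            rw [Finset.sup_insert, inf_sup_right, chi_sup, ih, Finset.sum_insert hi]
            rw [inf_inf_inf_comm]
            have : x i ⊓ t.sup x = ⊥ := by
              rw [Finset.sup_inf_distrib_left, Finset.sup_eq_bot_iff]
              exact fun j hj => hx i j (by rintro rfl; exact hi hj)
            rw [this, bot_inf_eq]
        rw [← h1, ← chi_sup]
        · show chi b = chi (s ⊓ b ⊔ b ⊓ sᶜ)
          rw [inf_comm s, ← inf_sup_left, sup_compl_eq_top, inf_top_eq]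
        · show (s ⊓ b) ⊓ (b ⊓ sᶜ) = ⊥
          rw [inf_comm b, inf_inf_inf_comm, inf_compl_eq_bot, bot_inf_eq]
      have hi : ∀ i, chi (x i) = chi (x i ⊓ b) + chi (x i ⊓ bᶜ) := fun i => by
        rw [← chi_sup, ← inf_sup_left, sup_compl_eq_top, inf_top_eq]
        rw [inf_inf_inf_comm, inf_compl_eq_bot, inf_bot_eq]
      simp only [Fintype.sum_sum_type, Sum.elim_inl, Sum.elim_inr, Finset.univ_unique,
        Finset.sum_const, Finset.card_singleton, one_smul, add_smul, Finset.sum_add_distrib]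
      rw [hs, smul_add, Finset.smul_sum]
      simp_rw [hi, smul_add, Finset.sum_add_distrib]
      abel

theorem ev_sum_disjoint {n : ℕ} {x : Fin n → B} (a : Fin n → ℝ)
    (hx : ∀ i j, i ≠ j → x i ⊓ x j = ⊥) (p : BoundedLatticeHom B Prop) (φ : ℝ → ℝ)
    (hφ : φ 0 = 0) : ev p (∑ i, φ (a i) • chi (x i)) = φ (ev p (∑ i, a i • chi (x i))) := by
  classical
  have hev : ∀ b : Fin n → ℝ, ev p (∑ i, b i • chi (x i)) =
      ∑ i, if p (x i) then b i else 0 := fun b => by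
    rw [_root_.map_sum]
    refine Finset.sum_congr rfl fun i _ => ?_
    rw [_root_.map_smul, ev_chi, smul_eq_mul]
    split_ifs <;> simp
  rw [hev, hev]
  by_cases h : ∃ i, p (x i)
  · obtain ⟨i, hi⟩ := h
    have hj : ∀ j, j ≠ i → ¬ p (x j) := fun j hji hj => by
      have h1 : p (x j ⊓ x i) = (p (x j) ∧ p (x i)) := by rw [InfHomClass.map_inf]; rfl
      rw [hx j i hji, BotHomClass.map_bot] at h1
      exact h1.mpr ⟨hj, hi⟩
    rw [Finset.sum_eq_single i (fun j _ hji => by rw [if_neg (hj j hji)]) (by simp),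
      Finset.sum_eq_single i (fun j _ hji => by rw [if_neg (hj j hji)]) (by simp), if_pos hi,
      if_pos hi]
  · push Not at h
    simp [h, hφ]

theorem nonneg_of_ev {f : Simple B} (h : ∀ p, 0 ≤ ev p f) :
    ∃ c : B →₀ ℝ, (∀ x, 0 ≤ c x) ∧ mk B c = f := by
  classical
  obtain ⟨n, x, a, hx, rfl⟩ := exists_disjoint f
  refine ⟨∑ i, Finsupp.single (x i) (max (a i) 0), fun y => ?_, ?_⟩
  · rw [Finsupp.finsetSum_apply]
    refine Finset.sum_nonneg fun i _ => ?_
    rw [Finsupp.single_apply]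
    split_ifs
    · exact le_max_right _ _
    · exact le_rfl
  · rw [_root_.map_sum]
    refine Finset.sum_congr rfl fun i _ => ?_
    rw [mk_single]
    by_cases hi : x i = ⊥
    · rw [hi, chi_bot, smul_zero, smul_zero]
    · obtain ⟨p, hp⟩ := exists_point hi
      have h1 := h p
      have hj : ∀ j, j ≠ i → ¬ p (x j) := fun j hji hj => by
        have h1 : p (x j ⊓ x i) = (p (x j) ∧ p (x i)) := by rw [InfHomClass.map_inf]; rfl
        rw [hx j i hji, BotHomClass.map_bot] at h1
        exact h1.mpr ⟨hj, hp⟩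
      rw [_root_.map_sum, Finset.sum_eq_single i (fun j _ hji => by
        rw [_root_.map_smul, ev_chi, if_neg (hj j hji), smul_zero]) (by simp),
        _root_.map_smul, ev_chi, if_pos hp, smul_eq_mul, mul_one] at h1
      rw [max_eq_left h1]

theorem le_iff_ev {f g : Simple B} : f ≤ g ↔ ∀ p, ev p f ≤ ev p g := by
  rw [le_def]
  constructor
  · rintro ⟨c, hc, h⟩ p
    rw [← sub_nonneg, ← _root_.map_sub, ← h]
    exact ev_mk_nonneg p hc
  · intro h
    refine nonneg_of_ev fun p => ?_
    rw [_root_.map_sub, sub_nonneg]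
    exact h p

theorem ext_ev {f g : Simple B} (h : ∀ p, ev p f = ev p g) : f = g := by
  rw [← sub_eq_zero]
  obtain ⟨n, x, a, hx, hf⟩ := exists_disjoint (f - g)
  rw [hf]
  refine Finset.sum_eq_zero fun i _ => ?_
  by_cases hi : x i = ⊥
  · rw [hi, chi_bot, smul_zero]
  · classical
    obtain ⟨p, hp⟩ := exists_point hi
    have h1 : ev p (f - g) = 0 := by rw [_root_.map_sub, h p, sub_self]
    have hj : ∀ j, j ≠ i → ¬ p (x j) := fun j hji hj => by
      have h1 : p (x j ⊓ x i) = (p (x j) ∧ p (x i)) := by rw [InfHomClass.map_inf]; rfl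
      rw [hx j i hji, BotHomClass.map_bot] at h1
      exact h1.mpr ⟨hj, hp⟩
    rw [hf, _root_.map_sum, Finset.sum_eq_single i (fun j _ hji => by
      rw [_root_.map_smul, ev_chi, if_neg (hj j hji), smul_zero]) (by simp),
      _root_.map_smul, ev_chi, if_pos hp, smul_eq_mul, mul_one] at h1
    rw [h1, zero_smul]

instance : PartialOrder (Simple B) where
  le_refl f := le_iff_ev.2 fun _ => le_rfl
  le_trans f g h h1 h2 := le_iff_ev.2 fun p => (le_iff_ev.1 h1 p).trans (le_iff_ev.1 h2 p)
  le_antisymm f g h1 h2 := ext_ev fun p => le_antisymm (le_iff_ev.1 h1 p) (le_iff_ev.1 h2 p)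

theorem exists_sup (f g : Simple B) : ∃ h : Simple B, ∀ p, ev p h = max (ev p f) (ev p g) := by
  obtain ⟨n, x, a, hx, hf⟩ := exists_disjoint (f - g)
  refine ⟨∑ i, max (a i) 0 • chi (x i) + g, fun p => ?_⟩
  rw [_root_.map_add, ev_sum_disjoint a hx p (fun t => max t 0) (by simp), ← hf, _root_.map_sub,
    max_add, zero_add, sub_add_cancel]

/-- Suprema and infima for the order of `Simple B`. -/
instance : Lattice (Simple B) where
  sup f g := (exists_sup f g).choose
  inf f g := -(exists_sup (-f) (-g)).choose
  le_sup_left f g := le_iff_ev.2 fun p => by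
    rw [(exists_sup f g).choose_spec p]; exact le_max_left _ _
  le_sup_right f g := le_iff_ev.2 fun p => by
    rw [(exists_sup f g).choose_spec p]; exact le_max_right _ _
  sup_le f g h h1 h2 := le_iff_ev.2 fun p => by
    rw [(exists_sup f g).choose_spec p]; exact max_le (le_iff_ev.1 h1 p) (le_iff_ev.1 h2 p)
  inf_le_left f g := le_iff_ev.2 fun p => by
    rw [_root_.map_neg, (exists_sup (-f) (-g)).choose_spec p, _root_.map_neg, neg_le]
    exact le_max_left _ _
  inf_le_right f g := le_iff_ev.2 fun p => by
    rw [_root_.map_neg, (exists_sup (-f) (-g)).choose_spec p, _root_.map_neg, _root_.map_neg,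
      neg_le]
    exact le_max_right _ _
  le_inf f g h h1 h2 := le_iff_ev.2 fun p => by
    rw [_root_.map_neg, (exists_sup (-g) (-h)).choose_spec p, _root_.map_neg, _root_.map_neg,
      le_neg]
    exact max_le (neg_le_neg (le_iff_ev.1 h1 p)) (neg_le_neg (le_iff_ev.1 h2 p))

theorem ev_sup (p : BoundedLatticeHom B Prop) (f g : Simple B) :
    ev p (f ⊔ g) = max (ev p f) (ev p g) := (exists_sup f g).choose_spec p

theorem ev_abs (p : BoundedLatticeHom B Prop) (f : Simple B) : ev p |f| = |ev p f| := by
  show ev p (f ⊔ -f) = _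
  rw [ev_sup, _root_.map_neg]
  rfl

instance : IsOrderedAddMonoid (Simple B) where
  add_le_add_left f g h k := le_iff_ev.2 fun p => by
    rw [_root_.map_add, _root_.map_add]
    exact add_le_add_left (le_iff_ev.1 h p) _

theorem ev_chi_top (p : BoundedLatticeHom B Prop) : ev p (chi ⊤) = 1 := by
  classical
  rw [ev_chi, if_pos]
  rw [TopHomClass.map_top]
  trivial

theorem abs_le_iff_ev {f : Simple B} {r : ℝ} : |f| ≤ r • chi ⊤ ↔ ∀ p, |ev p f| ≤ r := by
  rw [le_iff_ev]
  refine forall_congr' fun p => ?_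
  rw [ev_abs, _root_.map_smul, ev_chi_top, smul_eq_mul, mul_one]

/-- The norm `‖f‖ = min {r ≥ 0 | |f| ≤ r • χ(1)}`. -/
instance : Norm (Simple B) := ⟨fun f => sInf {r : ℝ | 0 ≤ r ∧ |f| ≤ r • chi ⊤}⟩

theorem exists_abs_le (f : Simple B) : ∃ r : ℝ, 0 ≤ r ∧ |f| ≤ r • chi ⊤ := by
  classical
  induction f using Simple.induction with
  | zero => exact ⟨0, le_rfl, abs_le_iff_ev.2 fun p => by simp⟩
  | add f r b ih =>
    obtain ⟨s, hs, h⟩ := ih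
    refine ⟨s + |r|, add_nonneg hs (abs_nonneg r), abs_le_iff_ev.2 fun p => ?_⟩
    rw [_root_.map_add]
    refine (abs_add_le _ _).trans (add_le_add (abs_le_iff_ev.1 h p) ?_)
    rw [_root_.map_smul, ev_chi, smul_eq_mul, abs_mul]
    split_ifs <;> simp

theorem isLeast_norm (f : Simple B) : IsLeast {r : ℝ | 0 ≤ r ∧ |f| ≤ r • chi ⊤} ‖f‖ := by
  have hne : {r : ℝ | 0 ≤ r ∧ |f| ≤ r • chi ⊤}.Nonempty := exists_abs_le f
  have hbdd : BddBelow {r : ℝ | 0 ≤ r ∧ |f| ≤ r • chi ⊤} := ⟨0, fun r hr => hr.1⟩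
  refine ⟨⟨le_csInf hne fun r hr => hr.1, abs_le_iff_ev.2 fun p => ?_⟩,
    fun r hr => csInf_le hbdd hr⟩
  exact le_csInf hne fun r hr => abs_le_iff_ev.1 hr.2 p

theorem norm_le_iff {f : Simple B} {r : ℝ} (hr : 0 ≤ r) : ‖f‖ ≤ r ↔ ∀ p, |ev p f| ≤ r :=
  ⟨fun h p => (abs_le_iff_ev.1 (isLeast_norm f).1.2 p).trans h,
    fun h => (isLeast_norm f).2 ⟨hr, abs_le_iff_ev.2 h⟩⟩

theorem norm_nonneg' (f : Simple B) : 0 ≤ ‖f‖ := (isLeast_norm f).1.1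

theorem abs_ev_le (p : BoundedLatticeHom B Prop) (f : Simple B) : |ev p f| ≤ ‖f‖ :=
  (norm_le_iff (norm_nonneg' f)).1 le_rfl p

instance : NormedAddCommGroup (Simple B) :=
  AddGroupNorm.toNormedAddCommGroup
    { toFun := fun f => ‖f‖
      map_zero' := le_antisymm ((norm_le_iff le_rfl).2 fun p => by simp) (norm_nonneg' _)
      add_le' := fun f g =>
        (norm_le_iff (add_nonneg (norm_nonneg' f) (norm_nonneg' g))).2 fun p => by
          rw [_root_.map_add]
          exact (abs_add_le _ _).trans (add_le_add (abs_ev_le p f) (abs_ev_le p g))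
      neg' := fun f => by
        have : ∀ g : Simple B, ‖-g‖ ≤ ‖g‖ := fun g => (norm_le_iff (norm_nonneg' g)).2 fun p => by
          rw [_root_.map_neg, abs_neg]; exact abs_ev_le p g
        exact le_antisymm (this f) (by simpa using this (-f))
      eq_zero_of_map_eq_zero' := fun f hf => ext_ev fun p => by
        have h : |ev p f| ≤ 0 := hf ▸ abs_ev_le p f
        rw [_root_.map_zero]
        exact abs_nonpos_iff.1 h }

instance : NormedSpace ℝ (Simple B) where
  norm_smul_le r f := (norm_le_iff (mul_nonneg (norm_nonneg r) (norm_nonneg' f))).2 fun p => by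
    rw [_root_.map_smul, smul_eq_mul, abs_mul]
    exact mul_le_mul_of_nonneg_left (abs_ev_le p f) (abs_nonneg r)

instance : HasSolidNorm (Simple B) where
  solid {f g} h := (norm_le_iff (norm_nonneg' g)).2 fun p => by
    have := le_iff_ev.1 h p
    rw [ev_abs, ev_abs] at this
    exact this.trans (abs_ev_le p g)

instance : IsOrderedModule ℝ (Simple B) where
  smul_le_smul_of_nonneg_left {r} hr {f g} h := le_iff_ev.2 fun p => by
    simp only [_root_.map_smul, smul_eq_mul]
    exact mul_le_mul_of_nonneg_left (le_iff_ev.1 h p) hr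
  smul_le_smul_of_nonneg_right {f} hf {r s} h := le_iff_ev.2 fun p => by
    simp only [_root_.map_smul, smul_eq_mul]
    refine mul_le_mul_of_nonneg_right h ?_
    simpa using le_iff_ev.1 hf p

end Simple

end

end SimpleFunctions

section Completion

open UniformSpace

noncomputable section

variable {E : Type u} [NormedAddCommGroup E] [Lattice E] [IsOrderedAddMonoid E] [HasSolidNorm E]

theorem uniformContinuous₂_sup : UniformContinuous₂ (fun x y : E => x ⊔ y) := by
  refine Metric.uniformContinuous_iff.2 fun ε hε => ⟨ε / 2, half_pos hε, ?_⟩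
  rintro ⟨a, b⟩ ⟨c, d⟩ h
  rw [Prod.dist_eq, max_lt_iff, dist_eq_norm, dist_eq_norm] at h
  show dist (a ⊔ b) (c ⊔ d) < ε
  rw [dist_eq_norm]
  have := norm_sup_sub_sup_le_add_norm a b c d
  linarith [h.1, h.2]

theorem uniformContinuous₂_inf : UniformContinuous₂ (fun x y : E => x ⊓ y) := by
  refine Metric.uniformContinuous_iff.2 fun ε hε => ⟨ε / 2, half_pos hε, ?_⟩
  rintro ⟨a, b⟩ ⟨c, d⟩ h
  rw [Prod.dist_eq, max_lt_iff, dist_eq_norm, dist_eq_norm] at h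
  show dist (a ⊓ b) (c ⊓ d) < ε
  rw [dist_eq_norm]
  have := norm_inf_sub_inf_le_add_norm a b c d
  linarith [h.1, h.2]

/-- The continuous extension of `⊔` to the completion. -/
instance : Max (Completion E) := ⟨Completion.map₂ (fun x y : E => x ⊔ y)⟩

/-- The continuous extension of `⊓` to the completion. -/
instance : Min (Completion E) := ⟨Completion.map₂ (fun x y : E => x ⊓ y)⟩

theorem completion_coe_sup (x y : E) : ((x ⊔ y : E) : Completion E) = (x : Completion E) ⊔ y :=
  (Completion.map₂_coe_coe x y _ uniformContinuous₂_sup).symm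

theorem completion_coe_inf (x y : E) : ((x ⊓ y : E) : Completion E) = (x : Completion E) ⊓ y :=
  (Completion.map₂_coe_coe x y _ uniformContinuous₂_inf).symm

theorem continuous_completion_sup {α : Type*} [TopologicalSpace α] {f g : α → Completion E}
    (hf : Continuous f) (hg : Continuous g) : Continuous fun a => f a ⊔ g a :=
  Completion.continuous_map₂ hf hg

theorem continuous_completion_inf {α : Type*} [TopologicalSpace α] {f g : α → Completion E}
    (hf : Continuous f) (hg : Continuous g) : Continuous fun a => f a ⊓ g a :=
  Completion.continuous_map₂ hf hg

/-- The completion of a normed Riesz space is a lattice, with the continuous extensions of the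
lattice operations. Its order is `x ≤ y ↔ x ⊔ y = y`. -/
instance completionLattice : Lattice (Completion E) :=
  Lattice.mk'
    (fun a b => Completion.induction_on₂ a b
      (isClosed_eq (continuous_completion_sup continuous_fst continuous_snd)
        (continuous_completion_sup continuous_snd continuous_fst))
      fun a b => by rw [← completion_coe_sup, ← completion_coe_sup, sup_comm])
    (fun a b c => Completion.induction_on₃ a b c
      (isClosed_eq
        (continuous_completion_sup (continuous_completion_sup continuous_fst
          (continuous_fst.comp continuous_snd)) (continuous_snd.comp continuous_snd))
        (continuous_completion_sup continuous_fst (continuous_completion_sup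
          (continuous_fst.comp continuous_snd) (continuous_snd.comp continuous_snd))))
      fun a b c => by simp only [← completion_coe_sup, sup_assoc])
    (fun a b => Completion.induction_on₂ a b
      (isClosed_eq (continuous_completion_inf continuous_fst continuous_snd)
        (continuous_completion_inf continuous_snd continuous_fst))
      fun a b => by rw [← completion_coe_inf, ← completion_coe_inf, inf_comm])
    (fun a b c => Completion.induction_on₃ a b c
      (isClosed_eq
        (continuous_completion_inf (continuous_completion_inf continuous_fst
          (continuous_fst.comp continuous_snd)) (continuous_snd.comp continuous_snd))
        (continuous_completion_inf continuous_fst (continuous_completion_inf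
          (continuous_fst.comp continuous_snd) (continuous_snd.comp continuous_snd))))
      fun a b c => by simp only [← completion_coe_inf, inf_assoc])
    (fun a b => Completion.induction_on₂ a b
      (isClosed_eq (continuous_completion_sup continuous_fst
        (continuous_completion_inf continuous_fst continuous_snd)) continuous_fst)
      fun a b => by rw [← completion_coe_inf, ← completion_coe_sup, sup_inf_self])
    (fun a b => Completion.induction_on₂ a b
      (isClosed_eq (continuous_completion_inf continuous_fst
        (continuous_completion_sup continuous_fst continuous_snd)) continuous_fst)
      fun a b => by rw [← completion_coe_sup, ← completion_coe_inf, inf_sup_self])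

theorem completion_le_iff {x y : Completion E} : x ≤ y ↔ x ⊔ y = y := sup_eq_right.symm

theorem completion_coe_abs (x : E) : ((|x| : E) : Completion E) = |(x : Completion E)| := by
  show ((x ⊔ -x : E) : Completion E) = (x : Completion E) ⊔ -(x : Completion E)
  rw [completion_coe_sup, Completion.coe_neg]

theorem continuous_completion_abs {α : Type*} [TopologicalSpace α] {f : α → Completion E}
    (hf : Continuous f) : Continuous fun a => |f a| :=
  continuous_completion_sup hf hf.neg

instance : IsOrderedAddMonoid (Completion E) where
  add_le_add_left a b h c := by
    have key : ∀ a b c : Completion E, (a + c) ⊔ (b + c) = (a ⊔ b) + c := fun a b c =>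
      Completion.induction_on₃ a b c
        (isClosed_eq
          (continuous_completion_sup (by fun_prop) (by fun_prop))
          (Continuous.add (continuous_completion_sup (by fun_prop) (by fun_prop)) (by fun_prop)))
        fun a b c => by
          rw [← Completion.coe_add, ← Completion.coe_add, ← completion_coe_sup,
            ← completion_coe_sup, ← Completion.coe_add, sup_add]
    rw [completion_le_iff] at h ⊢
    rw [key, h]

instance : HasSolidNorm (Completion E) where
  solid {a b} h := by
    have h1 : ∀ a : Completion E, ‖|a|‖ = ‖a‖ := fun a =>
      Completion.induction_on a
        (isClosed_eq (continuous_completion_abs continuous_id).norm continuous_norm)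
        fun a => by rw [← completion_coe_abs, Completion.norm_coe, Completion.norm_coe,
          norm_abs_eq_norm]
    have h2 : ∀ a b : Completion E, ‖|a| ⊓ |b|‖ ≤ ‖b‖ := fun a b =>
      Completion.induction_on₂ a b
        (isClosed_le (continuous_completion_inf (continuous_completion_abs continuous_fst)
          (continuous_completion_abs continuous_snd)).norm continuous_snd.norm)
        fun a b => by
          rw [← completion_coe_abs, ← completion_coe_abs, ← completion_coe_inf,
            Completion.norm_coe, Completion.norm_coe]
          refine HasSolidNorm.solid ?_
          rw [abs_of_nonneg (le_inf (abs_nonneg a) (abs_nonneg b))]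
          exact inf_le_right
    rw [← h1 a]
    have := h2 a b
    rwa [inf_eq_left.2 h] at this

theorem smul_sup_of_nonneg [NormedSpace ℝ E] [IsOrderedModule ℝ E] {r : ℝ} (hr : 0 ≤ r)
    (a b : E) : (r • a) ⊔ (r • b) = r • (a ⊔ b) := by
  rcases hr.eq_or_lt with rfl | hr'
  · simp
  · refine le_antisymm (sup_le (smul_le_smul_of_nonneg_left le_sup_left hr)
      (smul_le_smul_of_nonneg_left le_sup_right hr)) ?_
    have : a ⊔ b ≤ r⁻¹ • ((r • a) ⊔ (r • b)) := by
      refine sup_le ?_ ?_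
      · calc a = r⁻¹ • (r • a) := by rw [smul_smul, inv_mul_cancel₀ hr'.ne', one_smul]
          _ ≤ _ := smul_le_smul_of_nonneg_left le_sup_left (by positivity)
      · calc b = r⁻¹ • (r • b) := by rw [smul_smul, inv_mul_cancel₀ hr'.ne', one_smul]
          _ ≤ _ := smul_le_smul_of_nonneg_left le_sup_right (by positivity)
    calc r • (a ⊔ b) ≤ r • (r⁻¹ • ((r • a) ⊔ (r • b))) :=
          smul_le_smul_of_nonneg_left this hr
      _ = _ := by rw [smul_smul, mul_inv_cancel₀ hr'.ne', one_smul]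

theorem completion_smul_sup [NormedSpace ℝ E] [IsOrderedModule ℝ E] {r : ℝ} (hr : 0 ≤ r)
    (a b : Completion E) : (r • a) ⊔ (r • b) = r • (a ⊔ b) := by
  refine Completion.induction_on₂ a b
    (isClosed_eq (continuous_completion_sup (continuous_fst.const_smul r)
      (continuous_snd.const_smul r))
      ((continuous_completion_sup continuous_fst continuous_snd).const_smul r)) fun a b => ?_
  rw [← Completion.coe_smul, ← Completion.coe_smul, ← completion_coe_sup,
    ← completion_coe_sup, ← Completion.coe_smul, smul_sup_of_nonneg hr]

theorem completion_smul_abs_nonneg [NormedSpace ℝ E] [IsOrderedModule ℝ E] {r : ℝ} (hr : 0 ≤ r)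
    (a : Completion E) : 0 ≤ r • |a| := by
  rw [completion_le_iff]
  refine Completion.induction_on a
    (isClosed_eq (continuous_completion_sup continuous_const
      ((continuous_completion_abs continuous_id).const_smul r))
      ((continuous_completion_abs continuous_id).const_smul r)) fun a => ?_
  rw [← completion_coe_abs, ← Completion.coe_smul, ← Completion.coe_zero,
    ← completion_coe_sup, sup_eq_right.2]
  exact smul_nonneg hr (abs_nonneg a)

instance [NormedSpace ℝ E] [IsOrderedModule ℝ E] : IsOrderedModule ℝ (Completion E) where
  smul_le_smul_of_nonneg_left {r} hr {a b} h := by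
    rw [completion_le_iff] at h ⊢
    rw [completion_smul_sup hr, h]
  smul_le_smul_of_nonneg_right {a} ha {r s} h := by
    have := completion_smul_abs_nonneg (sub_nonneg.2 h) a
    rwa [abs_of_nonneg ha, sub_smul, sub_nonneg] at this

end

end Completion

section Linf

open UniformSpace

noncomputable section

variable {A B C : Type u} [BooleanAlgebra A] [BooleanAlgebra B] [BooleanAlgebra C]

namespace Simple

theorem abs_le_norm_smul (f : Simple B) : |f| ≤ ‖f‖ • chi ⊤ := (isLeast_norm f).1.2

theorem norm_chi_top_le : ‖chi (⊤ : B)‖ ≤ 1 :=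
  (norm_le_iff zero_le_one).2 fun p => by rw [ev_chi_top, abs_one]

/-- The map of `Simple A` to `Simple B` determined by `χ(x) ↦ χ(f(x))`. -/
def map (f : BoundedLatticeHom A B) : Simple A →ₗ[ℝ] Simple B :=
  (addRel A).mapQ (addRel B) (Finsupp.lmapDomain ℝ ℝ f) (by
    rw [addRel, Submodule.span_le]
    rintro _ ⟨x, y, h, rfl⟩
    refine Submodule.subset_span ⟨f x, f y, ?_, ?_⟩
    · rw [← InfHomClass.map_inf, h, BotHomClass.map_bot]
    · simp only [Finsupp.lmapDomain_apply, _root_.map_sub]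
      rw [← SupHomClass.map_sup]
      simp [sub_eq_add_neg, Finsupp.mapDomain_single])

theorem map_chi (f : BoundedLatticeHom A B) (x : A) : map f (chi x) = chi (f x) := by
  show mk B (Finsupp.mapDomain f (Finsupp.single x 1)) = _
  rw [Finsupp.mapDomain_single]
  rfl

theorem ev_map (f : BoundedLatticeHom A B) (p : BoundedLatticeHom B Prop) (v : Simple A) :
    ev p (map f v) = ev (p.comp f) v := by
  classical
  induction v using Simple.induction with
  | zero => simp
  | add v r x ih =>
    simp only [_root_.map_add, _root_.map_smul, ih, map_chi, ev_chi]
    rfl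

theorem norm_map_le (f : BoundedLatticeHom A B) (v : Simple A) : ‖map f v‖ ≤ ‖v‖ :=
  (norm_le_iff (norm_nonneg' v)).2 fun p => by rw [ev_map]; exact abs_ev_le _ _

theorem map_sup (f : BoundedLatticeHom A B) (v w : Simple A) :
    map f (v ⊔ w) = map f v ⊔ map f w :=
  ext_ev fun p => by simp only [ev_map, ev_sup]

theorem uniformContinuous_map (f : BoundedLatticeHom A B) : UniformContinuous (map f) :=
  AddMonoidHomClass.uniformContinuous_of_bound (map f) 1 fun v => by
    rw [one_mul]; exact norm_map_le f v

end Simple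

theorem completion_abs_le (x : Completion (Simple B)) :
    |x| ≤ ‖x‖ • ((Simple.chi (⊤ : B) : Simple B) : Completion (Simple B)) := by
  rw [completion_le_iff]
  refine Completion.induction_on x
    (isClosed_eq (continuous_completion_sup (continuous_completion_abs continuous_id)
      (continuous_norm.smul continuous_const)) (continuous_norm.smul continuous_const))
    fun x => ?_
  rw [← completion_coe_abs, Completion.norm_coe, ← Completion.coe_smul, ← completion_coe_sup,
    sup_eq_right.2 (Simple.abs_le_norm_smul x)]

theorem completion_chi_top_nonneg :
    0 ≤ ((Simple.chi (⊤ : B) : Simple B) : Completion (Simple B)) := by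
  rw [completion_le_iff, ← Completion.coe_zero, ← completion_coe_sup, sup_eq_right.2]
  exact Simple.le_iff_ev.2 fun p => by rw [Simple.ev_chi_top, map_zero]; exact zero_le_one

variable (B) in
/-- `L∞(B)`: the norm completion of `Simple B`, with order unit `χ(1)`. -/
def LinfObj : MISpace.{u} where
  carrier := Completion (Simple B)
  unit := (Simple.chi (⊤ : B) : Simple B)
  unit_nonneg := completion_chi_top_nonneg
  isOrderUnit x := ⟨‖x‖ + 1, by positivity, (completion_abs_le x).trans
    (smul_le_smul_of_nonneg_right (by linarith) completion_chi_top_nonneg)⟩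
  isLeast_norm x := ⟨⟨norm_nonneg x, completion_abs_le x⟩, fun r ⟨hr, hx⟩ => by
    have h0 : |x| ≤ |r • ((Simple.chi (⊤ : B) : Simple B) : Completion (Simple B))| :=
      hx.trans (le_abs_self _)
    refine (HasSolidNorm.solid h0).trans ?_
    rw [norm_smul, Completion.norm_coe, Real.norm_of_nonneg hr]
    exact mul_le_of_le_one_right hr Simple.norm_chi_top_le⟩

/-- The continuous linear extension of `Simple.map f` to the completions. -/
def Simple.completionMap (f : BoundedLatticeHom A B) :
    Completion (Simple A) →ₗ[ℝ] Completion (Simple B) where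
  toFun := Completion.map (Simple.map f)
  map_add' x y := by
    have hc : Continuous (Completion.map (Simple.map f)) := Completion.continuous_map
    refine Completion.induction_on₂ x y
      (isClosed_eq (hc.comp (continuous_fst.add continuous_snd))
        ((hc.comp continuous_fst).add (hc.comp continuous_snd))) fun x y => ?_
    have h := Simple.uniformContinuous_map f
    rw [← Completion.coe_add, Completion.map_coe h, Completion.map_coe h, Completion.map_coe h,
      _root_.map_add, Completion.coe_add]
  map_smul' r x := by
    have hc : Continuous (Completion.map (Simple.map f)) := Completion.continuous_map
    refine Completion.induction_on x
      (isClosed_eq (hc.comp (continuous_id.const_smul r)) (hc.const_smul r)) fun x => ?_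
    have h := Simple.uniformContinuous_map f
    rw [← Completion.coe_smul, Completion.map_coe h, Completion.map_coe h, _root_.map_smul,
      Completion.coe_smul, RingHom.id_apply]

theorem Simple.completionMap_coe (f : BoundedLatticeHom A B) (v : Simple A) :
    completionMap f (v : Completion (Simple A)) = ((map f v : Simple B) : Completion (Simple B)) :=
  Completion.map_coe (uniformContinuous_map f) v

theorem Simple.continuous_completionMap (f : BoundedLatticeHom A B) :
    Continuous (completionMap f) :=
  Completion.continuous_map (f := Simple.map f)

theorem Simple.completionMap_sup (f : BoundedLatticeHom A B) (x y : Completion (Simple A)) :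
    completionMap f (x ⊔ y) = completionMap f x ⊔ completionMap f y := by
  have hc := continuous_completionMap f
  refine Completion.induction_on₂ x y
    (isClosed_eq (hc.comp (continuous_completion_sup continuous_fst continuous_snd))
      (continuous_completion_sup (hc.comp continuous_fst) (hc.comp continuous_snd)))
    fun x y => ?_
  rw [← completion_coe_sup, completionMap_coe, completionMap_coe, completionMap_coe, map_sup,
    completion_coe_sup]

theorem Simple.completionMap_id (x : Completion (Simple A)) :
    completionMap (BoundedLatticeHom.id A) x = x := by
  refine Completion.induction_on x
    (isClosed_eq (continuous_completionMap _) continuous_id) fun x => ?_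
  rw [completionMap_coe]
  congr 1
  exact ext_ev fun p => by rw [ev_map]; rfl

theorem Simple.completionMap_comp (g : BoundedLatticeHom B C) (f : BoundedLatticeHom A B)
    (x : Completion (Simple A)) :
    completionMap (g.comp f) x = completionMap g (completionMap f x) := by
  refine Completion.induction_on x
    (isClosed_eq (continuous_completionMap _)
      ((continuous_completionMap g).comp (continuous_completionMap f))) fun x => ?_
  rw [completionMap_coe, completionMap_coe, completionMap_coe]
  congr 1
  exact ext_ev fun p => by rw [ev_map, ev_map, ev_map]; rfl

/-- The map `L∞(f)`, which is the continuous linear map determined by `χ(x) ↦ χ(f(x))`. -/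
def LinfMap (f : BoundedLatticeHom A B) : LinfObj A ⟶ LinfObj B where
  toLinearMap := Simple.completionMap f
  map_sup' := Simple.completionMap_sup f
  map_unit' := by
    refine (Simple.completionMap_coe f (Simple.chi ⊤)).trans ?_
    rw [Simple.map_chi, TopHomClass.map_top]
    rfl

/-- The functor `L∞` from boolean algebras to MI-spaces. -/
def Linf : BoolAlg.{u} ⥤ MISpace.{u} where
  obj B := LinfObj B
  map f := LinfMap f.hom
  map_id _ := MISpace.hom_ext Simple.completionMap_id
  map_comp f g := MISpace.hom_ext (Simple.completionMap_comp g.hom f.hom)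

end

end Linf

/-! ### Complexification -/

section Complexification

noncomputable section

/-- In an MI-space every nonempty norm compact set has a supremum, and the supremum is a norm
limit of suprema of finite subsets. -/
theorem exists_isLUB_of_isCompact {X : MISpace.{u}} {S : Set X} (hS : IsCompact S)
    (hne : S.Nonempty) : ∃ v : X, IsLUB S v ∧
      ∀ ε : ℝ, 0 < ε → ∃ F : Finset X, ∃ hF : F.Nonempty, (F : Set X) ⊆ S ∧
        v ≤ F.sup' hF id + ε • X.unit := by
  have hle : ∀ (x : X) (r : ℝ), ‖x‖ ≤ r → x ≤ r • X.unit := fun x r h =>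
    (le_abs_self x).trans ((X.isLeast_norm x).1.2.trans
      (smul_le_smul_of_nonneg_right h X.unit_nonneg))
  have hunit : ‖X.unit‖ ≤ 1 :=
    (X.isLeast_norm X.unit).2 ⟨zero_le_one, by rw [abs_of_nonneg X.unit_nonneg, one_smul]⟩
  have key : ∀ n : ℕ, ∃ F : Finset X, ∃ hF : F.Nonempty, (F : Set X) ⊆ S ∧
      ∀ s ∈ S, s ≤ F.sup' hF id + (1 / ((n : ℝ) + 1)) • X.unit := by
    intro n
    have hpos : (0 : ℝ) < 1 / ((n : ℝ) + 1) := by positivity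
    obtain ⟨t, htS, htf, hcov⟩ := hS.finite_cover_balls hpos
    have htne : t.Nonempty := by
      obtain ⟨s, hs⟩ := hne
      obtain ⟨x, hx, -⟩ := Set.mem_iUnion₂.1 (hcov hs)
      exact ⟨x, hx⟩
    refine ⟨htf.toFinset, (htf.toFinset_nonempty).2 htne, by simpa using htS, fun s hs => ?_⟩
    obtain ⟨x, hx, hsx⟩ := Set.mem_iUnion₂.1 (hcov hs)
    rw [Metric.mem_ball, dist_eq_norm] at hsx
    have h1 := hle _ _ hsx.le
    rw [sub_le_iff_le_add] at h1
    rw [add_comm]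
    exact h1.trans (add_le_add le_rfl (Finset.le_sup' id (htf.mem_toFinset.2 hx)))
  choose F hF hFS hFle using key
  let w : ℕ → X := fun n => (F n).sup' (hF n) id
  have hw : ∀ n m, w m - w n ≤ (1 / ((n : ℝ) + 1)) • X.unit := fun n m => by
    rw [sub_le_iff_le_add, add_comm]
    exact Finset.sup'_le _ _ fun s hs => hFle n s (hFS m hs)
  have hmono : ∀ {N n : ℕ}, N ≤ n → 1 / ((n : ℝ) + 1) ≤ 1 / ((N : ℝ) + 1) := fun {N n} h => by
    apply one_div_le_one_div_of_le (by positivity)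
    have : (N : ℝ) ≤ n := by exact_mod_cast h
    linarith
  have hcauchy : CauchySeq w := by
    refine cauchySeq_of_le_tendsto_0 (fun N : ℕ => 1 / ((N : ℝ) + 1)) (fun n m N hn hm => ?_)
      tendsto_one_div_add_atTop_nhds_zero_nat
    rw [dist_eq_norm]
    have hN : (0 : ℝ) ≤ 1 / ((N : ℝ) + 1) := by positivity
    refine (X.isLeast_norm _).2 ⟨hN, ?_⟩
    refine abs_le'.2 ⟨(hw m n).trans (smul_le_smul_of_nonneg_right (hmono hm) X.unit_nonneg), ?_⟩
    rw [neg_sub]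
    exact (hw n m).trans (smul_le_smul_of_nonneg_right (hmono hn) X.unit_nonneg)
  obtain ⟨v, hv⟩ := cauchySeq_tendsto_of_complete hcauchy
  have hε : Filter.Tendsto (fun n : ℕ => (1 / ((n : ℝ) + 1)) • X.unit) Filter.atTop (nhds 0) := by
    have := tendsto_one_div_add_atTop_nhds_zero_nat (𝕜 := ℝ).smul_const X.unit
    simpa using this
  refine ⟨v, ⟨fun s hs => ?_, fun b hb => ?_⟩, fun ε hpos => ?_⟩
  · have := hv.add hε
    rw [add_zero] at this
    exact ge_of_tendsto' this fun n => hFle n s hs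
  · exact le_of_tendsto' hv fun n => Finset.sup'_le _ _ fun s hs => hb (hFS n hs)
  · obtain ⟨n, hn⟩ := exists_nat_one_div_lt hpos
    refine ⟨F n, hF n, hFS n, ?_⟩
    have h1 : v ≤ w n + (1 / ((n : ℝ) + 1)) • X.unit :=
      le_of_tendsto' hv fun m => by
        have := hw n m
        rwa [sub_le_iff_le_add, add_comm] at this
    exact h1.trans (add_le_add le_rfl (smul_le_smul_of_nonneg_right hn.le X.unit_nonneg))

theorem le_of_forall_le_add_smul_unit {X : MISpace.{u}} {x y : X}
    (h : ∀ ε : ℝ, 0 < ε → x ≤ y + ε • X.unit) : x ≤ y := by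
  have hε : Filter.Tendsto (fun n : ℕ => y + (1 / ((n : ℝ) + 1)) • X.unit) Filter.atTop
      (nhds y) := by
    have := (tendsto_one_div_add_atTop_nhds_zero_nat (𝕜 := ℝ).smul_const X.unit).const_add y
    simpa using this
  exact ge_of_tendsto' hε fun n => h _ (by positivity)

theorem map_isLUB_of_isCompact {X Y : MISpace.{u}} (f : X ⟶ Y) {S : Set X} (hS : IsCompact S)
    (hne : S.Nonempty) {v : X} (hv : IsLUB S v) : IsLUB ((fun x => f x) '' S) (f v) := by
  obtain ⟨v', hv', happ⟩ := exists_isLUB_of_isCompact hS hne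
  obtain rfl := hv.unique hv'
  refine ⟨?_, fun b hb => ?_⟩
  · rintro _ ⟨x, hx, rfl⟩
    exact MISpace.monotone f (hv.1 hx)
  · refine le_of_forall_le_add_smul_unit fun ε hε => ?_
    obtain ⟨F, hF, hFS, hle⟩ := happ ε hε
    have h1 := MISpace.monotone f hle
    rw [MISpace.map_add, MISpace.map_smul, MISpace.map_unit] at h1
    refine h1.trans (add_le_add ?_ le_rfl)
    have h2 : f (F.sup' hF id) = F.sup' hF (fun x => f x) :=
      Finset.apply_sup'_eq_sup'_comp hF (fun x => f x) (MISpace.map_sup f)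
    rw [h2]
    exact Finset.sup'_le _ _ fun s hs => hb ⟨s, hFS hs, rfl⟩

/-- The complexification `X + iX` of a real vector space `X`. -/
@[ext]
structure Cplx (X : Type u) : Type u where
  re : X
  im : X

namespace Cplx

section

variable {X : Type u} [AddCommGroup X] [Module ℝ X]

instance : Zero (Cplx X) := ⟨⟨0, 0⟩⟩
instance : Add (Cplx X) := ⟨fun z w => ⟨z.re + w.re, z.im + w.im⟩⟩
instance : Neg (Cplx X) := ⟨fun z => ⟨-z.re, -z.im⟩⟩
instance : Sub (Cplx X) := ⟨fun z w => ⟨z.re - w.re, z.im - w.im⟩⟩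
instance : SMul ℂ (Cplx X) :=
  ⟨fun c z => ⟨c.re • z.re - c.im • z.im, c.re • z.im + c.im • z.re⟩⟩

@[simp] theorem zero_re : (0 : Cplx X).re = 0 := rfl
@[simp] theorem zero_im : (0 : Cplx X).im = 0 := rfl
@[simp] theorem add_re (z w : Cplx X) : (z + w).re = z.re + w.re := rfl
@[simp] theorem add_im (z w : Cplx X) : (z + w).im = z.im + w.im := rfl
@[simp] theorem neg_re (z : Cplx X) : (-z).re = -z.re := rfl
@[simp] theorem neg_im (z : Cplx X) : (-z).im = -z.im := rfl
@[simp] theorem sub_re (z w : Cplx X) : (z - w).re = z.re - w.re := rfl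
@[simp] theorem sub_im (z w : Cplx X) : (z - w).im = z.im - w.im := rfl
@[simp] theorem smul_re (c : ℂ) (z : Cplx X) : (c • z).re = c.re • z.re - c.im • z.im := rfl
@[simp] theorem smul_im (c : ℂ) (z : Cplx X) : (c • z).im = c.re • z.im + c.im • z.re := rfl

instance : AddCommGroup (Cplx X) where
  add_assoc _ _ _ := by ext <;> simp [add_assoc]
  zero_add _ := by ext <;> simp
  add_zero _ := by ext <;> simp
  add_comm _ _ := by ext <;> simp [add_comm]
  neg_add_cancel _ := by ext <;> simp
  sub_eq_add_neg _ _ := by ext <;> simp [sub_eq_add_neg]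
  nsmul := nsmulRec
  zsmul := zsmulRec

instance : Module ℂ (Cplx X) where
  one_smul _ := by ext <;> simp
  mul_smul _ _ _ := by ext <;> simp <;> module
  smul_zero _ := by ext <;> simp
  smul_add _ _ _ := by ext <;> simp <;> module
  add_smul _ _ _ := by ext <;> simp <;> module
  zero_smul _ := by ext <;> simp

/-- The inclusion `X → X + iX`. -/
def ofReal (x : X) : Cplx X := ⟨x, 0⟩

theorem ofReal_injective : Function.Injective (ofReal : X → Cplx X) :=
  fun _ _ h => congrArg Cplx.re h

theorem ofReal_add (x y : X) : ofReal (x + y) = ofReal x + ofReal y := by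
  ext <;> simp [ofReal]

theorem ofReal_sub (x y : X) : ofReal (x - y) = ofReal x - ofReal y := by
  ext <;> simp [ofReal]

theorem ofReal_smul (r : ℝ) (x : X) : ofReal (r • x) = (r : ℂ) • ofReal x := by
  ext
  · rw [smul_re]
    simp [ofReal]
  · rw [smul_im]
    simp [ofReal]

end

variable {X Y Z : MISpace.{u}}

/-- The real parts `cos θ • x + sin θ • y` of the rotations of `z = x + iy`. -/
def rotations (z : Cplx X) : Set X :=
  {w | ∃ θ : ℝ, w = Real.cos θ • z.re + Real.sin θ • z.im}

theorem rotations_nonempty (z : Cplx X) : z.rotations.Nonempty := ⟨_, 0, rfl⟩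

theorem isCompact_rotations (z : Cplx X) : IsCompact z.rotations := by
  have hc : Continuous fun θ : ℝ => Real.cos θ • z.re + Real.sin θ • z.im := by fun_prop
  have h : z.rotations = (fun θ : ℝ => Real.cos θ • z.re + Real.sin θ • z.im) ''
      Set.Icc 0 (2 * Real.pi) := by
    refine Set.Subset.antisymm ?_ ?_
    · rintro _ ⟨θ, rfl⟩
      have hp : Function.Periodic (fun θ : ℝ => Real.cos θ • z.re + Real.sin θ • z.im)
          (2 * Real.pi) := fun t => by
        simp only [Real.cos_add_two_pi, Real.sin_add_two_pi]
      obtain ⟨t, ht, h⟩ := hp.exists_mem_Ico₀ Real.two_pi_pos θ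
      exact ⟨t, Set.Ico_subset_Icc_self ht, h.symm⟩
    · rintro _ ⟨θ, -, rfl⟩
      exact ⟨θ, rfl⟩
  rw [h]
  exact isCompact_Icc.image hc

/-- The modulus `|z| = sup_θ Re (e^{iθ} z)`. -/
def modulus (z : Cplx X) : X :=
  (exists_isLUB_of_isCompact z.isCompact_rotations z.rotations_nonempty).choose

theorem isLUB_modulus (z : Cplx X) : IsLUB z.rotations z.modulus :=
  (exists_isLUB_of_isCompact z.isCompact_rotations z.rotations_nonempty).choose_spec.1

theorem modulus_ofReal (x : X) : (ofReal x).modulus = |x| := by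
  refine (isLUB_modulus (ofReal x)).unique ⟨?_, fun b hb => ?_⟩
  · rintro _ ⟨θ, rfl⟩
    show Real.cos θ • x + Real.sin θ • (0 : X) ≤ |x|
    rw [smul_zero, add_zero]
    have h1 : Real.cos θ • x ≤ |Real.cos θ| • |x| := by
      rcases le_total 0 (Real.cos θ) with h | h
      · rw [abs_of_nonneg h]
        exact smul_le_smul_of_nonneg_left (le_abs_self x) h
      · rw [abs_of_nonpos h, ← neg_smul_neg]
        exact smul_le_smul_of_nonneg_left (neg_le_abs x) (neg_nonneg.2 h)
    refine h1.trans ?_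
    calc |Real.cos θ| • |x| ≤ (1 : ℝ) • |x| :=
          smul_le_smul_of_nonneg_right (Real.abs_cos_le_one θ) (abs_nonneg x)
      _ = |x| := one_smul _ _
  · refine abs_le'.2 ⟨hb ⟨0, ?_⟩, hb ⟨Real.pi, ?_⟩⟩
    · simp [ofReal]
    · simp [ofReal]

theorem abs_re_le_modulus (z : Cplx X) : |z.re| ≤ z.modulus := by
  refine abs_le'.2 ⟨z.isLUB_modulus.1 ⟨0, ?_⟩, z.isLUB_modulus.1 ⟨Real.pi, ?_⟩⟩ <;> simp

theorem abs_im_le_modulus (z : Cplx X) : |z.im| ≤ z.modulus := by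
  refine abs_le'.2 ⟨z.isLUB_modulus.1 ⟨Real.pi / 2, ?_⟩, z.isLUB_modulus.1 ⟨-(Real.pi / 2), ?_⟩⟩ <;>
    simp

theorem modulus_nonneg (z : Cplx X) : 0 ≤ z.modulus := (abs_nonneg _).trans z.abs_re_le_modulus

theorem modulus_le (z : Cplx X) : z.modulus ≤ |z.re| + |z.im| := by
  refine z.isLUB_modulus.2 ?_
  rintro _ ⟨θ, rfl⟩
  have key : ∀ (r : ℝ) (x : X), |r| ≤ 1 → r • x ≤ |x| := fun r x hr => by
    have h1 : r • x ≤ |r| • |x| := by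
      rcases le_total 0 r with h | h
      · rw [abs_of_nonneg h]
        exact smul_le_smul_of_nonneg_left (le_abs_self x) h
      · rw [abs_of_nonpos h, ← neg_smul_neg]
        exact smul_le_smul_of_nonneg_left (neg_le_abs x) (neg_nonneg.2 h)
    refine h1.trans ?_
    calc |r| • |x| ≤ (1 : ℝ) • |x| := smul_le_smul_of_nonneg_right hr (abs_nonneg x)
      _ = |x| := one_smul _ _
  exact add_le_add (key _ _ (Real.abs_cos_le_one θ)) (key _ _ (Real.abs_sin_le_one θ))

/-- The disjoint complement `{z | |z| ∧ |w| = 0 for all w ∈ Z}` in `X + iX`. -/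
def disjCompl (Z : Set (Cplx X)) : Set (Cplx X) := {z | ∀ w ∈ Z, z.modulus ⊓ w.modulus = 0}

/-- The subset `P + iP` of `X + iX`. -/
def ofSet (P : Set X) : Set (Cplx X) := {z | z.re ∈ P ∧ z.im ∈ P}

theorem disjCompl_eq_ofSet (Z : Set (Cplx X)) :
    disjCompl Z = ofSet (RieszBool.disjCompl (modulus '' Z)) := by
  ext z
  have hm : |z.modulus| = z.modulus := abs_of_nonneg z.modulus_nonneg
  constructor
  · intro hz
    constructor
    · rintro _ ⟨w, hw, rfl⟩
      refine disj_of_le (x' := z.modulus) (by rw [hm]; exact z.abs_re_le_modulus) ?_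
      rw [hm, abs_of_nonneg w.modulus_nonneg]
      exact hz w hw
    · rintro _ ⟨w, hw, rfl⟩
      refine disj_of_le (x' := z.modulus) (by rw [hm]; exact z.abs_im_le_modulus) ?_
      rw [hm, abs_of_nonneg w.modulus_nonneg]
      exact hz w hw
  · rintro ⟨h1, h2⟩ w hw
    have h3 := h1 _ ⟨w, hw, rfl⟩
    have h4 := h2 _ ⟨w, hw, rfl⟩
    rw [abs_of_nonneg w.modulus_nonneg] at h3 h4
    refine le_antisymm ?_ (le_inf z.modulus_nonneg w.modulus_nonneg)
    calc z.modulus ⊓ w.modulus ≤ (|z.re| + |z.im|) ⊓ w.modulus := inf_le_inf_right _ z.modulus_le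
      _ ≤ |z.re| ⊓ w.modulus + |z.im| ⊓ w.modulus :=
        add_inf_le (abs_nonneg _) (abs_nonneg _) w.modulus_nonneg
      _ = 0 := by rw [h3, h4, add_zero]

theorem disjCompl_ofSet {P : Set X} (hP : IsProjectionBand P) :
    disjCompl (ofSet P) = ofSet (RieszBool.disjCompl P) := by
  rw [disjCompl_eq_ofSet]
  congr 1
  refine Set.Subset.antisymm (fun x hx p hp => ?_) (fun x hx => ?_)
  · have := hx _ ⟨ofReal p, ⟨hp, hP.zero_mem⟩, rfl⟩
    rwa [modulus_ofReal, abs_abs] at this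
  · rintro _ ⟨w, ⟨h1, h2⟩, rfl⟩
    have h3 : |w.re| + |w.im| ∈ P := by
      rw [← hP.disjCompl_disjCompl] at h1 h2 ⊢
      exact disjCompl_add (disjCompl_solid (by rw [abs_abs]) h1)
        (disjCompl_solid (by rw [abs_abs]) h2)
    refine hx _ (hP.solid ?_ h3)
    rw [abs_of_nonneg w.modulus_nonneg, abs_of_nonneg (add_nonneg (abs_nonneg _) (abs_nonneg _))]
    exact w.modulus_le

/-- The projection bands of `X + iX`, which are the subsets `Z` with `Z + Zᵈ = X + iX`, are exactly
the subsets `P + iP` for the projection bands `P` of `X`. -/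
theorem add_disjCompl_eq_univ_iff (Z : Set (Cplx X)) :
    Z + disjCompl Z = Set.univ ↔ ∃ P : Set X, IsProjectionBand P ∧ Z = ofSet P := by
  constructor
  · intro h
    let N : Set X := RieszBool.disjCompl (modulus '' Z)
    have hN : disjCompl Z = ofSet N := disjCompl_eq_ofSet Z
    have hsub : ∀ z ∈ Z, z.re ∈ RieszBool.disjCompl N ∧ z.im ∈ RieszBool.disjCompl N := by
      intro z hz
      have hm : z.modulus ∈ RieszBool.disjCompl N :=
        subset_disjCompl_disjCompl _ ⟨z, hz, rfl⟩
      have hm' : |z.modulus| = z.modulus := abs_of_nonneg z.modulus_nonneg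
      exact ⟨disjCompl_solid (by rw [hm']; exact z.abs_re_le_modulus) hm,
        disjCompl_solid (by rw [hm']; exact z.abs_im_le_modulus) hm⟩
    have hdec : ∀ v : Cplx X, ∃ z ∈ Z, ∃ w ∈ ofSet N, z + w = v := fun v => by
      have : v ∈ Z + disjCompl Z := h ▸ Set.mem_univ v
      rw [hN] at this
      exact Set.mem_add.1 this
    refine ⟨RieszBool.disjCompl N, ?_, Set.Subset.antisymm hsub ?_⟩
    · rw [isProjectionBand_iff]
      intro x
      obtain ⟨z, hz, w, hw, hzw⟩ := hdec (ofReal x)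
      exact ⟨z.re, (hsub z hz).1, w.re, subset_disjCompl_disjCompl _ hw.1, congrArg Cplx.re hzw⟩
    · rintro v ⟨h1, h2⟩
      obtain ⟨z, hz, w, hw, rfl⟩ := hdec v
      have e1 : w.re = 0 := by
        refine eq_zero_of_mem_disjCompl hw.1 ?_
        have := disjCompl_add h1 (disjCompl_neg (hsub z hz).1)
        simpa using this
      have e2 : w.im = 0 := by
        refine eq_zero_of_mem_disjCompl hw.2 ?_
        have := disjCompl_add h2 (disjCompl_neg (hsub z hz).2)
        simpa using this
      rw [show w = 0 from Cplx.ext e1 e2, add_zero]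
      exact hz
  · rintro ⟨P, hP, rfl⟩
    rw [disjCompl_ofSet hP]
    refine Set.eq_univ_of_forall fun v => ?_
    obtain ⟨y, hy, z, hz, h1⟩ := isProjectionBand_iff.1 hP v.re
    obtain ⟨y', hy', z', hz', h2⟩ := isProjectionBand_iff.1 hP v.im
    exact ⟨⟨y, y'⟩, ⟨hy, hy'⟩, ⟨z, z'⟩, ⟨hz, hz'⟩, Cplx.ext h1 h2⟩

/-- The complexification of a homomorphism. -/
def mapHom (f : X ⟶ Y) : Cplx X →ₗ[ℂ] Cplx Y where
  toFun z := ⟨f z.re, f z.im⟩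
  map_add' z w := by ext <;> simp [MISpace.map_add]
  map_smul' c z := by ext <;> simp [sub_eq_add_neg, MISpace.map_add, MISpace.map_neg]

theorem modulus_mapHom (f : X ⟶ Y) (z : Cplx X) : (mapHom f z).modulus = f z.modulus := by
  refine (isLUB_modulus _).unique ?_
  have h := map_isLUB_of_isCompact f z.isCompact_rotations z.rotations_nonempty (isLUB_modulus z)
  convert h using 1
  refine Set.Subset.antisymm ?_ ?_
  · rintro _ ⟨θ, rfl⟩
    exact ⟨_, ⟨θ, rfl⟩, by simp only [MISpace.map_add, MISpace.map_smul]; rfl⟩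
  · rintro _ ⟨_, ⟨θ, rfl⟩, rfl⟩
    exact ⟨θ, by simp only [MISpace.map_add, MISpace.map_smul]; rfl⟩

end Cplx

/-- A complex MI-space: the complexification `X + iX` of a real MI-space `X`, with modulus
`Cplx.modulus`, norm `‖z‖ = ‖|z|‖` and the order unit of `X`. -/
structure CMISpace : Type (u + 1) where
  re : MISpace.{u}

namespace CMISpace

/-- Complex unit preserving Riesz homomorphisms: complex linear maps `f` with `f |z| = |f z|`. -/
@[ext]
structure Hom (X Y : CMISpace.{u}) where
  toLinearMap : Cplx X.re →ₗ[ℂ] Cplx Y.re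
  map_modulus' : ∀ z, toLinearMap (Cplx.ofReal z.modulus) =
    Cplx.ofReal (toLinearMap z).modulus
  map_unit' : toLinearMap (Cplx.ofReal X.re.unit) = Cplx.ofReal Y.re.unit

/-- The category of complex MI-spaces and unit preserving Riesz homomorphisms. -/
instance : Category CMISpace.{u} where
  Hom := Hom
  id X := ⟨LinearMap.id, fun _ => rfl, rfl⟩
  comp f g := ⟨g.toLinearMap.comp f.toLinearMap,
    fun z => by simp [f.map_modulus', g.map_modulus'], by simp [f.map_unit', g.map_unit']⟩

instance {X Y : CMISpace.{u}} : CoeFun (X ⟶ Y) (fun _ => Cplx X.re → Cplx Y.re) :=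
  ⟨fun f => f.toLinearMap⟩

@[ext] theorem hom_ext {X Y : CMISpace.{u}} {f g : X ⟶ Y} (h : ∀ z, f z = g z) : f = g :=
  Hom.ext (LinearMap.ext h)

theorem map_modulus {X Y : CMISpace.{u}} (f : X ⟶ Y) (z : Cplx X.re) :
    f (Cplx.ofReal z.modulus) = Cplx.ofReal (f z).modulus := f.map_modulus' z

/-- A complex Riesz homomorphism maps real elements to real elements. -/
theorem map_ofReal {X Y : CMISpace.{u}} (f : X ⟶ Y) (x : X.re) :
    f (Cplx.ofReal x) = Cplx.ofReal (f (Cplx.ofReal x)).re := by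
  have hpos : ∀ y : X.re, 0 ≤ y → (f (Cplx.ofReal y)).im = 0 := fun y hy => by
    have h := map_modulus f (Cplx.ofReal y)
    rw [Cplx.modulus_ofReal, abs_of_nonneg hy] at h
    rw [h]
    rfl
  have him : (f (Cplx.ofReal x)).im = 0 := by
    rw [← posPart_sub_negPart x, Cplx.ofReal_sub, _root_.map_sub, Cplx.sub_im,
      hpos _ (posPart_nonneg x), hpos _ (negPart_nonneg x), sub_zero]
  exact Cplx.ext rfl him

end CMISpace

/-- The complexification functor. -/
def complexify : MISpace.{u} ⥤ CMISpace.{u} where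
  obj X := ⟨X⟩
  map f := ⟨Cplx.mapHom f, fun z => by
    rw [Cplx.modulus_mapHom]
    exact Cplx.ext rfl (MISpace.map_zero f),
    Cplx.ext (MISpace.map_unit f) (MISpace.map_zero f)⟩
  map_id _ := rfl
  map_comp _ _ := rfl

/-- The functor that sends a complex MI-space to its real part, and a Riesz homomorphism to its
restriction to the real parts. -/
def realPart : CMISpace.{u} ⥤ MISpace.{u} where
  obj X := X.re
  map {X Y} f :=
    { toLinearMap :=
        { toFun := fun x => (f (Cplx.ofReal x)).re
          map_add' := fun x y => by rw [Cplx.ofReal_add, _root_.map_add, Cplx.add_re]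
          map_smul' := fun r x => by
            rw [Cplx.ofReal_smul, _root_.map_smul, Cplx.smul_re]
            simp }
      map_sup' := fun x y => by
        have habs : ∀ x : X.re, (f (Cplx.ofReal |x|)).re = |(f (Cplx.ofReal x)).re| := fun x => by
          rw [← Cplx.modulus_ofReal x, CMISpace.map_modulus, CMISpace.map_ofReal f x,
            Cplx.modulus_ofReal]
          rfl
        have hsup : ∀ {W : MISpace.{u}} (a b : W), a ⊔ b = (2⁻¹ : ℝ) • (a + b + |b - a|) :=
          fun a b => sup_eq_half_smul_add_add_abs_sub' ℝ a b
        show (f (Cplx.ofReal (x ⊔ y))).re = (f (Cplx.ofReal x)).re ⊔ (f (Cplx.ofReal y)).re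
        rw [hsup, hsup, Cplx.ofReal_smul, _root_.map_smul, Cplx.smul_re, Cplx.ofReal_add,
          Cplx.ofReal_add, _root_.map_add, _root_.map_add, Cplx.add_re, Cplx.add_re, habs,
          Cplx.ofReal_sub, _root_.map_sub, Cplx.sub_re]
        simp
      map_unit' := congrArg Cplx.re f.map_unit' }
  map_id _ := rfl
  map_comp {X Y Z} f g := MISpace.hom_ext fun x => by
    show (g (f (Cplx.ofReal x))).re = (g (Cplx.ofReal (f (Cplx.ofReal x)).re)).re
    rw [← CMISpace.map_ofReal]

/-- The complex space `L∞(B)`, as a functor. -/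
def LinfC : BoolAlg.{u} ⥤ CMISpace.{u} := Linf ⋙ complexify

/-- The functor `PrjB` on complex MI-spaces. The projection bands of `X + iX` are the sets
`P + iP` for the projection bands `P` of its real part `X` (see
`Cplx.add_disjCompl_eq_univ_iff`), and `P` is used here in place of `P + iP`. -/
def PrjBC : CMISpace.{u} ⥤ BoolAlg.{u} := realPart ⋙ PrjB

end

end Complexification

/-! ### Subcategories and restrictions of functors -/

section Subcategories

variable {C : Type u} [Category.{v} C] {D : Type*} [Category* D]

/-- A (not necessarily full) subcategory of `C`. -/
structure Subcat (C : Type u) [Category.{v} C] where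
  obj : C → Prop
  hom : ∀ ⦃X Y : C⦄, (X ⟶ Y) → Prop
  id_mem : ∀ X, obj X → hom (𝟙 X)
  comp_mem : ∀ ⦃X Y Z : C⦄ (f : X ⟶ Y) (g : Y ⟶ Z), hom f → hom g → hom (f ≫ g)

/-- Containment of subcategories. -/
instance : LE (Subcat C) :=
  ⟨fun S T => (∀ X, S.obj X → T.obj X) ∧
    ∀ ⦃X Y : C⦄ (f : X ⟶ Y), S.obj X → S.obj Y → S.hom f → T.hom f⟩

/-- The objects of a subcategory. -/
structure Subcat.Obj (S : Subcat C) where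
  val : C
  property : S.obj val

instance (S : Subcat C) : Category S.Obj where
  Hom X Y := {f : X.val ⟶ Y.val // S.hom f}
  id X := ⟨𝟙 X.val, S.id_mem _ X.property⟩
  comp f g := ⟨f.1 ≫ g.1, S.comp_mem _ _ f.2 g.2⟩
  id_comp _ := Subtype.ext (Category.id_comp _)
  comp_id _ := Subtype.ext (Category.comp_id _)
  assoc _ _ _ := Subtype.ext (Category.assoc _ _ _)

/-- The functor `F` maps the subcategory `S` into the subcategory `T`. -/
def Restricts (F : C ⥤ D) (S : Subcat C) (T : Subcat D) : Prop :=
  (∀ X, S.obj X → T.obj (F.obj X)) ∧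
    ∀ ⦃X Y : C⦄ (f : X ⟶ Y), S.obj X → S.obj Y → S.hom f → T.hom (F.map f)

/-- The restriction of a functor to subcategories. -/
def Restricts.functor {F : C ⥤ D} {S : Subcat C} {T : Subcat D} (h : Restricts F S T) :
    S.Obj ⥤ T.Obj where
  obj X := ⟨F.obj X.val, h.1 _ X.property⟩
  map {X Y} f := ⟨F.map f.1, h.2 _ X.property Y.property f.2⟩
  map_id _ := Subtype.ext (F.map_id _)
  map_comp _ _ := Subtype.ext (F.map_comp _ _)

/-- The functors `F` and `G` restrict to the subcategories `S` and `T`, and the restrictions are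
mutually inverse up to natural isomorphisms of functors on `S` and on `T`. -/
def RestrictToEquivalence (F : C ⥤ D) (G : D ⥤ C) (S : Subcat C) (T : Subcat D) : Prop :=
  ∃ (hF : Restricts F S T) (hG : Restricts G T S),
    Nonempty (hG.functor ⋙ hF.functor ≅ 𝟭 T.Obj) ∧ Nonempty (hF.functor ⋙ hG.functor ≅ 𝟭 S.Obj)

end Subcategories

/-! ### Categories of boolean algebras -/

/-- `B` carries a semi-finite strictly positive countably additive measure and is Dedekind
complete. -/
def IsMcb (B : Type u) [BooleanAlgebra B] : Prop :=
  DedekindComplete B ∧ ∃ μ : B → ENNReal,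
    μ ⊥ = 0 ∧
    (∀ (x : ℕ → B) (s : B), (∀ i j, i ≠ j → x i ⊓ x j = ⊥) → IsLUB (Set.range x) s →
      μ s = ∑' i, μ (x i)) ∧
    (∀ x, x ≠ ⊥ → 0 < μ x) ∧
    (∀ x, μ x = ⊤ → ∃ y, y ≤ x ∧ 0 < μ y ∧ μ y < ⊤)

/-- Boolean algebras and boolean homomorphisms. -/
def catB : Subcat BoolAlg.{u} where
  obj _ := True
  hom _ _ _ := True
  id_mem _ _ := trivial
  comp_mem _ _ _ _ _ _ _ := trivial

/-- Countably complete boolean algebras and boolean homomorphisms. -/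
def catccB : Subcat BoolAlg.{u} where
  obj B := CountablyComplete B
  hom _ _ _ := True
  id_mem _ _ := trivial
  comp_mem _ _ _ _ _ _ _ := trivial

/-- Dedekind complete boolean algebras and order continuous boolean homomorphisms. -/
def catDcBc : Subcat BoolAlg.{u} where
  obj B := DedekindComplete B
  hom _ _ f := OrderContinuous fun x => f x
  id_mem _ _ := OrderContinuous.id
  comp_mem _ _ _ _ _ hf hg := hg.comp hf

/-- mcb-algebras and order continuous boolean homomorphisms. -/
def catmcBc : Subcat BoolAlg.{u} where
  obj B := IsMcb B
  hom _ _ f := OrderContinuous fun x => f x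
  id_mem _ _ := OrderContinuous.id
  comp_mem _ _ _ _ _ hf hg := hg.comp hf

/-- mcb-algebras and boolean isomorphisms. -/
def catmcBIso : Subcat BoolAlg.{u} where
  obj B := IsMcb B
  hom _ _ f := Function.Bijective fun x => f x
  id_mem _ _ := Function.bijective_id
  comp_mem _ _ _ _ _ hf hg := hg.comp hf

/-- Countably complete boolean algebras and boolean isomorphisms. -/
def catccBIso : Subcat BoolAlg.{u} where
  obj B := CountablyComplete B
  hom _ _ f := Function.Bijective fun x => f x
  id_mem _ _ := Function.bijective_id
  comp_mem _ _ _ _ _ hf hg := hg.comp hf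

/-- Countably complete boolean algebras and injective boolean homomorphisms. -/
def catccBi : Subcat BoolAlg.{u} where
  obj B := CountablyComplete B
  hom _ _ f := Function.Injective fun x => f x
  id_mem _ _ := Function.injective_id
  comp_mem _ _ _ _ _ hf hg := hg.comp hf

/-! ### Categories of abstract `L∞` spaces -/

/-- `X` is isometrically isomorphic to the Banach dual of some (real) Banach space. -/
def IsBanachDual (X : MISpace.{u}) : Prop :=
  ∃ (E : Type u) (_ : NormedAddCommGroup E) (_ : NormedSpace ℝ E) (_ : CompleteSpace E),
    Nonempty (X ≃ₗᵢ[ℝ] StrongDual ℝ E)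

/-- A proper abstract `L∞` space: a countably complete MI-space that is a Banach dual. -/
def IsProperAbstractLinf (X : MISpace.{u}) : Prop := CountablyComplete X ∧ IsBanachDual X

/-- Bijective norm preserving maps. -/
def IsIsometricIso {X Y : MISpace.{u}} (f : X ⟶ Y) : Prop :=
  Function.Bijective (fun x => f x) ∧ ∀ x, ‖f x‖ = ‖x‖

theorem IsIsometricIso.id (X : MISpace.{u}) : IsIsometricIso (𝟙 X) :=
  ⟨Function.bijective_id, fun _ => rfl⟩

theorem IsIsometricIso.comp {X Y Z : MISpace.{u}} {f : X ⟶ Y} {g : Y ⟶ Z}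
    (hf : IsIsometricIso f) (hg : IsIsometricIso g) : IsIsometricIso (f ≫ g) :=
  ⟨hg.1.comp hf.1, fun x => (hg.2 _).trans (hf.2 x)⟩

/-- The MI-spaces isomorphic to `L∞(B)` for some boolean algebra `B`, with unit preserving Riesz
homomorphisms. -/
def catbLinf : Subcat MISpace.{u} where
  obj X := ∃ B : BoolAlg.{u}, ∃ f : Linf.obj B ⟶ X, IsIsometricIso f
  hom _ _ _ := True
  id_mem _ _ := trivial
  comp_mem _ _ _ _ _ _ _ := trivial

/-- Abstract `L∞` spaces and unit preserving Riesz homomorphisms. -/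
def cataLinf : Subcat MISpace.{u} where
  obj X := CountablyComplete X
  hom _ _ _ := True
  id_mem _ _ := trivial
  comp_mem _ _ _ _ _ _ _ := trivial

/-- Dedekind complete abstract `L∞` spaces and order continuous unit preserving Riesz
homomorphisms. -/
def catDcaLinfc : Subcat MISpace.{u} where
  obj X := CountablyComplete X ∧ DedekindComplete X
  hom _ _ f := OrderContinuous fun x => f x
  id_mem _ _ := OrderContinuous.id
  comp_mem _ _ _ _ _ hf hg := hg.comp hf

/-- Proper abstract `L∞` spaces and order continuous unit preserving Riesz homomorphisms. -/
def catLinfc : Subcat MISpace.{u} where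
  obj X := IsProperAbstractLinf X
  hom _ _ f := OrderContinuous fun x => f x
  id_mem _ _ := OrderContinuous.id
  comp_mem _ _ _ _ _ hf hg := hg.comp hf

/-- Proper abstract `L∞` spaces and unit preserving isometric Riesz isomorphisms. -/
def catLinfIso : Subcat MISpace.{u} where
  obj X := IsProperAbstractLinf X
  hom _ _ f := IsIsometricIso f
  id_mem X _ := IsIsometricIso.id X
  comp_mem _ _ _ _ _ hf hg := hf.comp hg

/-- Abstract `L∞` spaces and unit preserving isometric Riesz isomorphisms. -/
def cataLinfIso : Subcat MISpace.{u} where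
  obj X := CountablyComplete X
  hom _ _ f := IsIsometricIso f
  id_mem X _ := IsIsometricIso.id X
  comp_mem _ _ _ _ _ hf hg := hf.comp hg

/-- Abstract `L∞` spaces and injective unit preserving Riesz homomorphisms. -/
def cataLinfi : Subcat MISpace.{u} where
  obj X := CountablyComplete X
  hom _ _ f := Function.Injective fun x => f x
  id_mem _ _ := Function.injective_id
  comp_mem _ _ _ _ _ hf hg := hg.comp hf

/-! ### Categories of complex abstract `L∞` spaces -/

/-- `X` is isometrically isomorphic to the Banach dual of some complex Banach space. -/
def IsBanachDualC (X : CMISpace.{u}) : Prop :=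
  ∃ (E : Type u) (_ : NormedAddCommGroup E) (_ : NormedSpace ℂ E) (_ : CompleteSpace E)
    (φ : Cplx X.re ≃ₗ[ℂ] StrongDual ℂ E), ∀ z, ‖φ z‖ = ‖z.modulus‖

/-- A complex proper abstract `L∞` space. -/
def IsProperAbstractLinfC (X : CMISpace.{u}) : Prop := CountablyComplete X.re ∧ IsBanachDualC X

/-- Bijective norm preserving maps, for the norm `‖z‖ = ‖|z|‖`. -/
def IsIsometricIsoC {X Y : CMISpace.{u}} (f : X ⟶ Y) : Prop :=
  Function.Bijective (fun z => f z) ∧ ∀ z, ‖(f z).modulus‖ = ‖z.modulus‖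

theorem IsIsometricIsoC.id (X : CMISpace.{u}) : IsIsometricIsoC (𝟙 X) :=
  ⟨Function.bijective_id, fun _ => rfl⟩

theorem IsIsometricIsoC.comp {X Y Z : CMISpace.{u}} {f : X ⟶ Y} {g : Y ⟶ Z}
    (hf : IsIsometricIsoC f) (hg : IsIsometricIsoC g) : IsIsometricIsoC (f ≫ g) :=
  ⟨hg.1.comp hf.1, fun z => (hg.2 _).trans (hf.2 z)⟩

/-- Order continuity of the restriction to the real parts. -/
def OrderContinuousC {X Y : CMISpace.{u}} (f : X ⟶ Y) : Prop :=
  OrderContinuous fun x : X.re => (realPart.map f).toLinearMap x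

theorem OrderContinuousC.id (X : CMISpace.{u}) : OrderContinuousC (𝟙 X) :=
  OrderContinuous.id

theorem OrderContinuousC.comp {X Y Z : CMISpace.{u}} {f : X ⟶ Y} {g : Y ⟶ Z}
    (hf : OrderContinuousC f) (hg : OrderContinuousC g) : OrderContinuousC (f ≫ g) := by
  show OrderContinuous fun x : X.re => (realPart.map (f ≫ g)).toLinearMap x
  rw [realPart.map_comp]
  exact OrderContinuous.comp (g := fun y : Y.re => (realPart.map g).toLinearMap y)
    (f := fun x : X.re => (realPart.map f).toLinearMap x) hg hf

/-- The complex MI-spaces isomorphic to the complex `L∞(B)` for some boolean algebra `B`. -/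
def catbLinfC : Subcat CMISpace.{u} where
  obj X := ∃ B : BoolAlg.{u}, ∃ f : LinfC.obj B ⟶ X, IsIsometricIsoC f
  hom _ _ _ := True
  id_mem _ _ := trivial
  comp_mem _ _ _ _ _ _ _ := trivial

/-- The complex version of `cataLinf`. -/
def cataLinfC : Subcat CMISpace.{u} where
  obj X := CountablyComplete X.re
  hom _ _ _ := True
  id_mem _ _ := trivial
  comp_mem _ _ _ _ _ _ _ := trivial

/-- The complex version of `catDcaLinfc`. -/
def catDcaLinfcC : Subcat CMISpace.{u} where
  obj X := CountablyComplete X.re ∧ DedekindComplete X.re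
  hom _ _ f := OrderContinuousC f
  id_mem X _ := OrderContinuousC.id X
  comp_mem _ _ _ _ _ hf hg := hf.comp hg

/-- The complex version of `catLinfc`. -/
def catLinfcC : Subcat CMISpace.{u} where
  obj X := IsProperAbstractLinfC X
  hom _ _ f := OrderContinuousC f
  id_mem X _ := OrderContinuousC.id X
  comp_mem _ _ _ _ _ hf hg := hf.comp hg

/-- The complex version of `catLinfIso`. -/
def catLinfIsoC : Subcat CMISpace.{u} where
  obj X := IsProperAbstractLinfC X
  hom _ _ f := IsIsometricIsoC f
  id_mem X _ := IsIsometricIsoC.id X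
  comp_mem _ _ _ _ _ hf hg := hf.comp hg

/-- The complex version of `cataLinfIso`. -/
def cataLinfIsoC : Subcat CMISpace.{u} where
  obj X := CountablyComplete X.re
  hom _ _ f := IsIsometricIsoC f
  id_mem X _ := IsIsometricIsoC.id X
  comp_mem _ _ _ _ _ hf hg := hf.comp hg

/-- The complex version of `cataLinfi`. -/
def cataLinfiC : Subcat CMISpace.{u} where
  obj X := CountablyComplete X.re
  hom _ _ f := Function.Injective fun z => f z
  id_mem _ _ := Function.injective_id
  comp_mem _ _ _ _ _ hf hg := hg.comp hf

end RieszBool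

open RieszBool

-- An element of `L∞(B)` is a function on the Stone space of `B`: a point is a homomorphism `B →
-- Prop`, and evaluation there extends continuously from simple functions to the completion. Norm,
-- order and lattice operations become pointwise (`norm_le_iff_pt`, `le_iff_pt`). The working tool
-- is `exists_cut`: for `t < s` some element of `B` separates the places where `x < t` from those
-- where `x > s`.
--
-- Projection bands of an MI-space correspond to components of the unit. In `L∞(B)` a component
-- takes only the values 0 and 1, so cutting it between 1/3 and 2/3 shows that it is some `χ(b)`;
-- hence `B ≅ PrjB(L∞(B))` for every boolean algebra. Conversely, sending `χ(P)` to the component of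
-- the unit in `P` gives a natural isometric Riesz homomorphism `L∞(PrjB(X)) → X` with closed range.
-- It is onto as soon as the components span a dense subspace. This is clear for `L∞(B)`, and for
-- countably complete `X` it is Freudenthal's spectral theorem, proved here by binary expansion
-- (`exists_component_half`).
--
-- What remains is to match the conditions defining the subcategories; `restrictToEquivalence` does
-- the formal part. Completeness passes between `B` and `L∞(B)` by a layer decomposition
-- (`exists_isLUB_linf`). Order continuity passes by `exists_squeeze`, which trades an increasing
-- set in `L∞(B)` for a set decreasing to zero in `B`. Injectivity passes because a nonzero kernel
-- would contain a nonzero `χ(b)`.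
--
-- Proper spaces need measure theory. If `L∞(B)` is a dual, its order intervals are intersections of
-- two balls and hence weak-* compact, so increasing families converge weak-* to their suprema. The
-- functionals from the predual are therefore order continuous, the positive parts of these
-- functionals and their negatives are enough normal measures to detect every nonzero element, and a
-- maximal disjoint family of supports assembles them into one semi-finite measure
-- (`isMcb_of_normalMeasures`). If instead `B` carries such a measure, the predual is the closed
-- span of the integrals over elements of finite measure: these are norming, and a bounded
-- functional on the span is a set function dominated by the measure, whose Radon-Nikodym density
-- (`exists_density`) is the required element.
--
-- A complex Riesz homomorphism is the complexification of its restriction to real parts, so the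
-- complex case reduces to the real one except for duality, where the same arguments are run with
-- complex values.

namespace RieszBool

/-! ### Evaluation of elements of `L∞(B)` at the points of the dual space of `B` -/

noncomputable section

open UniformSpace

variable {B : Type u} [BooleanAlgebra B]

/-- The points of the dual space of a boolean algebra. -/
abbrev Point (B : Type u) [BooleanAlgebra B] := BoundedLatticeHom B Prop

namespace Point

theorem sup_iff (P : Point B) (a b : B) : P (a ⊔ b) ↔ P a ∨ P b := by
  rw [SupHomClass.map_sup]; rfl

theorem inf_iff (P : Point B) (a b : B) : P (a ⊓ b) ↔ P a ∧ P b := by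
  rw [InfHomClass.map_inf]; rfl

theorem top (P : Point B) : P ⊤ := by
  rw [TopHomClass.map_top]; trivial

theorem not_bot (P : Point B) : ¬ P ⊥ := by
  rw [BotHomClass.map_bot]; exact id

theorem compl_iff (P : Point B) (a : B) : P aᶜ ↔ ¬ P a := by
  constructor
  · intro h h'
    have := (P.inf_iff a aᶜ).2 ⟨h', h⟩
    rw [inf_compl_eq_bot] at this
    exact P.not_bot this
  · intro h
    have := P.top
    rw [← sup_compl_eq_top (x := a), P.sup_iff] at this
    exact this.resolve_left h

theorem mono (P : Point B) {a b : B} (h : a ≤ b) (ha : P a) : P b := by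
  rw [← sup_eq_right.2 h, P.sup_iff]; exact Or.inl ha

end Point

/-- Stone's separation theorem: if `a ≤ b` fails, then `a ⊓ bᶜ` is nonzero and some point contains
it. -/
theorem le_iff_point {a b : B} : a ≤ b ↔ ∀ P : Point B, P a → P b := by
  refine ⟨fun h P => P.mono h, fun h => ?_⟩
  by_contra hab
  have h1 : a ⊓ bᶜ ≠ ⊥ := fun h' => hab (disjoint_compl_right_iff.1 (disjoint_iff.2 h'))
  obtain ⟨(P : Point B), hP⟩ := Simple.exists_point h1
  rw [P.inf_iff, P.compl_iff] at hP
  exact hP.2 (h P hP.1)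

theorem eq_bot_of_point {a : B} (h : ∀ P : Point B, ¬ P a) : a = ⊥ :=
  le_bot_iff.1 (le_iff_point.2 fun P ha => (h P ha).elim)

/-- The inclusion of the simple functions. -/
def incl : Simple B →L[ℝ] LinfObj B := (Completion.toComplL : Simple B →L[ℝ] _)

theorem denseRange_incl : DenseRange (incl (B := B)) :=
  Completion.denseRange_coe (α := Simple B)

theorem isUniformInducing_incl : IsUniformInducing (incl (B := B)) :=
  Completion.isUniformInducing_coe (Simple B)

theorem norm_incl (v : Simple B) : ‖incl v‖ = ‖v‖ := Completion.norm_coe v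

theorem incl_sup (v w : Simple B) : incl (v ⊔ w) = incl v ⊔ incl w := completion_coe_sup v w

theorem incl_abs (v : Simple B) : incl |v| = |incl v| := completion_coe_abs v

/-- The class of `b ∈ B` in `L∞(B)`. -/
def chiL (b : B) : LinfObj B := incl (Simple.chi b)

theorem unit_eq : (LinfObj B).unit = chiL ⊤ := rfl

theorem continuous_sup' {X : MISpace.{u}} {α : Type*} [TopologicalSpace α] {f g : α → X}
    (hf : Continuous f) (hg : Continuous g) : Continuous fun a => f a ⊔ g a :=
  (uniformContinuous₂_sup (E := X)).continuous.comp (hf.prodMk hg)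

/-- The continuous extension of a continuous linear map on the simple functions. -/
def extendL {F : Type*} [NormedAddCommGroup F] [NormedSpace ℝ F] [CompleteSpace F]
    (T : Simple B →L[ℝ] F) : LinfObj B →L[ℝ] F := T.extend incl

theorem extendL_incl {F : Type*} [NormedAddCommGroup F] [NormedSpace ℝ F] [CompleteSpace F]
    (T : Simple B →L[ℝ] F) (v : Simple B) : extendL T (incl v) = T v :=
  T.extend_eq denseRange_incl isUniformInducing_incl v

/-- Evaluation at a point of the dual space of `B`. -/
def pt (P : Point B) : LinfObj B →L[ℝ] ℝ :=
  extendL ((Simple.ev P).mkContinuous 1 fun v => by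
    rw [one_mul]; exact Simple.abs_ev_le P v)

theorem pt_incl (P : Point B) (v : Simple B) : pt P (incl v) = Simple.ev P v := extendL_incl _ v

theorem pt_chiL (P : Point B) (b : B) [Decidable (P b)] : pt P (chiL b) = if P b then 1 else 0 := by
  classical
  rw [chiL, pt_incl, Simple.ev_chi]
  split_ifs <;> rfl

theorem pt_chiL_of (P : Point B) {b : B} (h : P b) : pt P (chiL b) = 1 := by
  classical
  rw [pt_chiL, if_pos h]

theorem pt_chiL_of_not (P : Point B) {b : B} (h : ¬ P b) : pt P (chiL b) = 0 := by
  classical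
  rw [pt_chiL, if_neg h]

theorem pt_unit (P : Point B) : pt P (LinfObj B).unit = 1 := pt_chiL_of P P.top

/-- Both sides are continuous and agree on the dense set of simple functions. -/
theorem pt_sup (P : Point B) (x y : LinfObj B) : pt P (x ⊔ y) = max (pt P x) (pt P y) := by
  refine denseRange_incl.induction_on₂ (p := fun x y => pt P (x ⊔ y) = max (pt P x) (pt P y))
    (isClosed_eq ?_ ?_) (fun v w => ?_) x y
  · exact (pt P).continuous.comp (continuous_sup' continuous_fst continuous_snd)
  · fun_prop
  · rw [← incl_sup, pt_incl, pt_incl, pt_incl, Simple.ev_sup]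

theorem pt_inf (P : Point B) (x y : LinfObj B) : pt P (x ⊓ y) = min (pt P x) (pt P y) := by
  have : x ⊓ y = -(-x ⊔ -y) := by rw [neg_sup, neg_neg, neg_neg]
  rw [this, map_neg, pt_sup, map_neg, map_neg, max_neg_neg, neg_neg]

theorem pt_abs (P : Point B) (x : LinfObj B) : pt P |x| = |pt P x| := by
  show pt P (x ⊔ -x) = _
  rw [pt_sup, map_neg]; rfl

theorem pt_finset_sup' (P : Point B) {ι : Type*} {s : Finset ι} (hs : s.Nonempty)
    (f : ι → LinfObj B) : pt P (s.sup' hs f) = s.sup' hs fun i => pt P (f i) :=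
  Finset.apply_sup'_eq_sup'_comp hs (pt P) (pt_sup P)

theorem abs_pt_le (P : Point B) (x : LinfObj B) : |pt P x| ≤ ‖x‖ := by
  refine denseRange_incl.induction_on (p := fun x => |pt P x| ≤ ‖x‖) x
    (isClosed_le (by fun_prop) (by fun_prop)) fun v => ?_
  rw [pt_incl, norm_incl]
  exact Simple.abs_ev_le P v

/-- On simple functions the norm is the supremum norm. Evaluations are contractions, so replacing
`x` by a simple function within `ε / 2` costs `ε / 2` in the pointwise bound and `ε / 2` in the
norm. -/
theorem norm_le_iff_pt {x : LinfObj B} {r : ℝ} (hr : 0 ≤ r) :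
    ‖x‖ ≤ r ↔ ∀ P, |pt P x| ≤ r := by
  refine ⟨fun h P => (abs_pt_le P x).trans h, fun h => le_of_forall_pos_le_add fun ε hε => ?_⟩
  obtain ⟨v, hv⟩ := denseRange_incl.exists_dist_lt x (half_pos hε)
  rw [dist_eq_norm] at hv
  have h1 : ‖v‖ ≤ r + ε / 2 := (Simple.norm_le_iff (by positivity)).2 fun P => by
    have h2 := (abs_pt_le P (x - incl v)).trans hv.le
    rw [map_sub, pt_incl] at h2
    have h3 := abs_le.1 h2
    have h4 := abs_le.1 (h P)
    exact abs_le.2 ⟨by linarith, by linarith⟩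
  calc ‖x‖ = ‖x - incl v + incl v‖ := by rw [sub_add_cancel]
    _ ≤ ‖x - incl v‖ + ‖incl v‖ := norm_add_le _ _
    _ ≤ ε / 2 + (r + ε / 2) := add_le_add hv.le (by rw [norm_incl]; exact h1)
    _ = r + ε := by ring

theorem eq_zero_of_pt {x : LinfObj B} (h : ∀ P, pt P x = 0) : x = 0 :=
  norm_le_zero_iff.1 ((norm_le_iff_pt le_rfl).2 fun P => by rw [h, abs_zero])

theorem ext_pt {x y : LinfObj B} (h : ∀ P, pt P x = pt P y) : x = y :=
  sub_eq_zero.1 (eq_zero_of_pt fun P => by rw [map_sub, h, sub_self])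

/-- The order of the completion is `x ⊔ y = y`, an equation, and equations can be tested at points.
-/
theorem le_iff_pt {x y : LinfObj B} : x ≤ y ↔ ∀ P, pt P x ≤ pt P y := by
  rw [← sup_eq_right]
  refine ⟨fun h P => by rw [← h, pt_sup]; exact le_max_left _ _, fun h => ext_pt fun P => ?_⟩
  rw [pt_sup, max_eq_right (h P)]

theorem pt_mono (P : Point B) {x y : LinfObj B} (h : x ≤ y) : pt P x ≤ pt P y := le_iff_pt.1 h P

theorem chiL_le_iff {a b : B} : chiL a ≤ chiL b ↔ a ≤ b := by
  classical
  rw [le_iff_pt, le_iff_point]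
  refine forall_congr' fun P => ?_
  rw [pt_chiL, pt_chiL]
  split_ifs <;> simp_all

theorem chiL_injective : Function.Injective (chiL : B → LinfObj B) := fun _ _ h =>
  le_antisymm (chiL_le_iff.1 h.le) (chiL_le_iff.1 h.ge)

theorem chiL_nonneg (b : B) : 0 ≤ chiL b := le_iff_pt.2 fun P => by
  classical
  rw [pt_chiL, map_zero]; split_ifs <;> norm_num

theorem chiL_bot : chiL (⊥ : B) = 0 := ext_pt fun P => by
  rw [pt_chiL_of_not P P.not_bot, map_zero]

theorem chiL_sup {a b : B} (h : a ⊓ b = ⊥) : chiL (a ⊔ b) = chiL a + chiL b := by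
  rw [chiL, Simple.chi_sup h, map_add]; rfl

theorem chiL_inf_eq (a b : B) : chiL (a ⊓ b) = chiL a ⊓ chiL b := ext_pt fun P => by
  classical
  simp only [pt_inf, pt_chiL, P.inf_iff]
  split_ifs <;> simp_all

/-- A simple function takes values above `t` on an element of `B`. -/
theorem Simple.exists_cut (v : Simple B) (t : ℝ) : ∃ b : B, ∀ P : Point B, P b ↔ t ≤ Simple.ev P v := by
  classical
  induction v using Simple.induction generalizing t with
  | zero =>
    by_cases ht : t ≤ 0
    · exact ⟨⊤, fun (P : Point B) => by simp [P.top, ht]⟩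
    · exact ⟨⊥, fun (P : Point B) => by simp [P.not_bot, ht]⟩
  | add v r x ih =>
    obtain ⟨b, hb⟩ := ih (t - r)
    obtain ⟨c, hc⟩ := ih t
    -- On `x` the new summand adds `r`, so the old function must reach `t - r`; off `x` it adds
    -- nothing. Both thresholds are needed, hence the induction over all `t`.
    refine ⟨x ⊓ b ⊔ xᶜ ⊓ c, fun (P : Point B) => ?_⟩
    rw [P.sup_iff, P.inf_iff, P.inf_iff, P.compl_iff, hb, hc, map_add, map_smul, Simple.ev_chi]
    by_cases hx : P x
    · simp only [hx, true_and, not_true_eq_false, false_and, or_false, if_true, smul_eq_mul, mul_one]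
      exact sub_le_iff_le_add
    · simp [hx]

theorem exists_incl_close (x : LinfObj B) {ε : ℝ} (hε : 0 < ε) :
    ∃ v : Simple B, ∀ P, |pt P x - Simple.ev P v| ≤ ε := by
  obtain ⟨v, hv⟩ := denseRange_incl.exists_dist_lt x hε
  rw [dist_eq_norm] at hv
  refine ⟨v, fun P => ?_⟩
  have := (abs_pt_le P (x - incl v)).trans hv.le
  rwa [map_sub, pt_incl] at this

/-- The sets `{x ≥ t}` and `{x ≤ s}` are separated by an element of `B` if `t < s`. -/
theorem exists_cut (x : LinfObj B) {t s : ℝ} (h : t < s) :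
    ∃ b : B, ∀ P, (P b → t ≤ pt P x) ∧ (¬ P b → pt P x ≤ s) := by
  -- A simple function within `(s - t) / 2` of `x` can be cut exactly at the midpoint.
  obtain ⟨v, hv⟩ := exists_incl_close x (half_pos (sub_pos.2 h))
  obtain ⟨b, hb⟩ := Simple.exists_cut v ((t + s) / 2)
  refine ⟨b, fun P => ⟨fun hP => ?_, fun hP => ?_⟩⟩
  · have := (hb P).1 hP
    linarith [abs_le.1 (hv P)]
  · rw [hb P, not_le] at hP
    linarith [abs_le.1 (hv P)]

/-- The map `χ` preserves existing suprema. -/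
theorem smul_chiL_le_of_isLUB {S : Set B} {s : B} (hs : IsLUB S s) {w : LinfObj B} (hw : 0 ≤ w)
    {c : ℝ} (h : ∀ b ∈ S, c • chiL b ≤ w) : c • chiL s ≤ w := by
  refine le_iff_pt.2 fun P => ?_
  rw [map_smul, smul_eq_mul]
  by_cases hP : P s
  swap
  · rw [pt_chiL_of_not P hP, mul_zero]
    simpa using pt_mono P hw
  rw [pt_chiL_of P hP, mul_one]
  by_contra hlt
  rw [not_le] at hlt
  -- Two levels `m < m'` strictly between `w(P)` and `c` leave room for a cut `b` of `w`. It
  -- contains every member of `S`, since `w ≥ c` there, hence it contains `s` and the point `P`,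
  -- although `w(P) < m`.
  obtain ⟨m, hm1, hm2⟩ := exists_between hlt
  obtain ⟨m', hm3, hm4⟩ := exists_between hm2
  obtain ⟨b, hb⟩ := exists_cut w hm3
  have hPb : P b := by
    refine le_iff_point.1 (hs.2 fun a ha => le_iff_point.2 fun Q hQ => ?_) P hP
    by_contra hQb
    have := pt_mono Q (h a ha)
    rw [map_smul, pt_chiL_of Q hQ, smul_eq_mul, mul_one] at this
    linarith [(hb Q).2 hQb]
  linarith [(hb P).1 hPb]

theorem isLUB_chiL {S : Set B} {s : B} (hne : S.Nonempty) (hs : IsLUB S s) :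
    IsLUB (chiL '' S) (chiL s) := by
  refine ⟨?_, fun w hw => ?_⟩
  · rintro _ ⟨b, hb, rfl⟩
    exact chiL_le_iff.2 (hs.1 hb)
  · obtain ⟨b, hb⟩ := hne
    have := smul_chiL_le_of_isLUB hs (c := 1) ((chiL_nonneg b).trans (hw ⟨b, hb, rfl⟩))
      fun b hb => by rw [one_smul]; exact hw ⟨b, hb, rfl⟩
    rwa [one_smul] at this

/-- The elements of `B` below which a nonzero positive element is bounded away from zero. -/
theorem exists_smul_chiL_le {x : LinfObj B} (hx : 0 ≤ x) {P : Point B} {r : ℝ}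
    (hr : r < pt P x) : ∃ b : B, P b ∧ r • chiL b ≤ x := by
  obtain ⟨m, hm1, hm2⟩ := exists_between hr
  obtain ⟨b, hb⟩ := exists_cut x hm1
  refine ⟨b, ?_, le_iff_pt.2 fun Q => ?_⟩
  · by_contra hP
    linarith [(hb P).2 hP]
  · rw [map_smul, smul_eq_mul]
    by_cases hQ : Q b
    · rw [pt_chiL_of Q hQ, mul_one]
      exact (hb Q).1 hQ
    · rw [pt_chiL_of_not Q hQ, mul_zero]
      simpa using pt_mono Q hx

end

end RieszBool

namespace RieszBool

/-! ### Order completeness of `L∞(B)` -/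

noncomputable section

variable {A B : Type u} [BooleanAlgebra A] [BooleanAlgebra B]

theorem MISpace.norm_le_of_abs_le {X : MISpace.{u}} {x : X} {r : ℝ} (hr : 0 ≤ r)
    (h : |x| ≤ r • X.unit) : ‖x‖ ≤ r := (X.isLeast_norm x).2 ⟨hr, h⟩

theorem MISpace.abs_le_norm_smul {X : MISpace.{u}} (x : X) : |x| ≤ ‖x‖ • X.unit :=
  (X.isLeast_norm x).1.2

theorem MISpace.le_norm_smul {X : MISpace.{u}} (x : X) : x ≤ ‖x‖ • X.unit :=
  (le_abs_self x).trans (abs_le_norm_smul x)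

/-- A set has a supremum if it has approximate suprema. -/
theorem exists_isLUB_of_approx {X : MISpace.{u}} {S : Set X}
    (h : ∀ ε : ℝ, 0 < ε → ∃ v : X, (∀ a ∈ S, a ≤ v + ε • X.unit) ∧
      ∀ w ∈ upperBounds S, v ≤ w + ε • X.unit) : ∃ x, IsLUB S x := by
  have hpos : ∀ n : ℕ, (0 : ℝ) < 1 / ((n : ℝ) + 1) := fun n => by positivity
  choose v hv hv' using fun n : ℕ => h _ (hpos n)
  -- Raised by its error, `v m` is an upper bound of `S`, so it dominates `v n` up to the error of
  -- `v n`. This makes `v` a Cauchy sequence.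
  have hle : ∀ n m, v n - v m ≤ (1 / ((n : ℝ) + 1) + 1 / ((m : ℝ) + 1)) • X.unit := fun n m => by
    have := hv' n _ (fun a ha => hv m a ha)
    rw [sub_le_iff_le_add, add_smul]
    refine this.trans (le_of_eq ?_)
    abel
  have hmono : ∀ {N n : ℕ}, N ≤ n → 1 / ((n : ℝ) + 1) ≤ 1 / ((N : ℝ) + 1) := fun {N n} h => by
    apply one_div_le_one_div_of_le (by positivity)
    have : (N : ℝ) ≤ n := by exact_mod_cast h
    linarith
  have hlim := tendsto_one_div_add_atTop_nhds_zero_nat (𝕜 := ℝ)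
  have hcauchy : CauchySeq v := by
    refine cauchySeq_of_le_tendsto_0 (fun N : ℕ => 1 / ((N : ℝ) + 1) + 1 / ((N : ℝ) + 1))
      (fun n m N hn hm => ?_) (by simpa using hlim.add hlim)
    rw [dist_eq_norm]
    refine MISpace.norm_le_of_abs_le (by have := hpos N; positivity) (abs_le'.2 ⟨?_, ?_⟩)
    · exact (hle n m).trans (smul_le_smul_of_nonneg_right (add_le_add (hmono hn) (hmono hm))
        X.unit_nonneg)
    · rw [neg_sub]
      exact (hle m n).trans (smul_le_smul_of_nonneg_right (add_le_add (hmono hm) (hmono hn))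
        X.unit_nonneg)
  obtain ⟨x, hx⟩ := cauchySeq_tendsto_of_complete hcauchy
  have hε : Filter.Tendsto (fun n : ℕ => (1 / ((n : ℝ) + 1)) • X.unit) Filter.atTop (nhds 0) := by
    simpa using hlim.smul_const X.unit
  refine ⟨x, fun a ha => ?_, fun w hw => ?_⟩
  · have := hx.add hε
    rw [add_zero] at this
    exact ge_of_tendsto' this fun n => hv n a ha
  · have := hε.const_add w
    rw [add_zero] at this
    exact le_of_tendsto_of_tendsto' hx this fun n => hv' n w hw

/-- Suprema of bounded families in `L∞(B)` exist if the families of elements of `B` with the same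
index set have suprema. -/
theorem exists_isLUB_linf {S : Set (LinfObj B)} (hne : S.Nonempty) (hbdd : BddAbove S)
    (hB : ∀ f : S → B, ∃ s, IsLUB (Set.range f) s) : ∃ x, IsLUB S x := by
  refine exists_isLUB_of_approx fun ε hε => ?_
  obtain ⟨a₀, ha₀⟩ := hne
  obtain ⟨u, hu⟩ := hbdd
  obtain ⟨δ, rfl⟩ : ∃ δ, ε = 2 * δ := ⟨ε / 2, by ring⟩
  have hδ : 0 < δ := by linarith
  -- Values below `-c` are irrelevant: `a₀ ≥ -c` lies in `S`, so every upper bound of `S` is at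
  -- least `-c`.
  set c := ‖a₀‖
  -- The element `b k a` is the part where `a` reaches roughly the level `-c + k * δ`, and `s k`
  -- joins these parts over all `a`. Steps of height `-c + k * δ` on `s k` give the approximate
  -- supremum. Cutting between `δ` and `2 * δ` below the level ensures that a point where `a`
  -- reaches the level is caught, and that the step exceeds `a` by at most `2 * δ` on `b k a`.
  have hcut : ∀ (k : ℕ) (a : S), ∃ b : B, ∀ P, (P b → -c + k * δ - 2 * δ ≤ pt P a.1) ∧
      (¬ P b → pt P a.1 ≤ -c + k * δ - δ) := fun k a => exists_cut a.1 (by linarith)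
  choose b hb using hcut
  choose s hs using fun k => hB (b k)
  -- No member of `S` exceeds `‖u‖`, so finitely many levels suffice.
  obtain ⟨N, hN⟩ := exists_nat_ge ((‖u‖ + c) / δ)
  have hne' : (Finset.range (N + 1)).Nonempty := ⟨0, by simp⟩
  let f : ℕ → LinfObj B := fun k => (-c) • (LinfObj B).unit + (k * δ) • chiL (s k)
  have hf : ∀ (P : Point B) k, P (s k) → pt P (f k) = -c + k * δ := fun P k h => by
    simp only [f, map_add, map_smul, pt_unit, pt_chiL_of P h, smul_eq_mul, mul_one]
  refine ⟨(Finset.range (N + 1)).sup' hne' f, fun a ha => le_iff_pt.2 fun P => ?_,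
    fun w hw => ?_⟩
  · rw [map_add, pt_finset_sup', map_smul, pt_unit, smul_eq_mul, mul_one]
    by_cases hlt : pt P a ≤ -c
    · have h1 := Finset.le_sup' (fun i => pt P (f i)) (show 0 ∈ Finset.range (N + 1) by simp)
      simp only [f, map_add, map_smul, pt_unit, Nat.cast_zero, zero_mul, zero_smul, smul_eq_mul,
        mul_one, add_zero] at h1 ⊢
      linarith
    · rw [not_le] at hlt
      have h0 : 0 ≤ (pt P a + c) / δ := div_nonneg (by linarith) hδ.le
      set k := ⌊(pt P a + c) / δ⌋₊
      have hk1 : (k : ℝ) * δ ≤ pt P a + c := (le_div_iff₀ hδ).1 (Nat.floor_le h0)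
      have hk2 : pt P a + c < ((k : ℝ) + 1) * δ := (div_lt_iff₀ hδ).1 (Nat.lt_floor_add_one _)
      have hPb : P (b k ⟨a, ha⟩) := by
        by_contra hP
        have := (hb k ⟨a, ha⟩ P).2 hP
        simp only at this
        linarith
      have hPs : P (s k) := P.mono ((hs k).1 ⟨_, rfl⟩) hPb
      have hkN : k ∈ Finset.range (N + 1) := by
        rw [Finset.mem_range, Nat.lt_succ_iff]
        refine Nat.floor_le_of_le (le_trans ?_ hN)
        have : pt P a ≤ ‖u‖ := (pt_mono P (hu ha)).trans ((le_abs_self _).trans (abs_pt_le P u))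
        gcongr
      have h1 := Finset.le_sup' (fun i => pt P (f i)) hkN
      simp only [hf P k hPs] at h1
      linarith
  · refine Finset.sup'_le _ _ fun k _ => ?_
    -- Since `w ≥ a₀ ≥ -c`, the shifted right hand side is nonnegative, as `smul_chiL_le_of_isLUB`
    -- requires.
    have h1 : (k * δ) • chiL (s k) ≤ w + (2 * δ + c) • (LinfObj B).unit := by
      refine smul_chiL_le_of_isLUB (hs k) (le_iff_pt.2 fun P => ?_) ?_
      · have h2 := pt_mono P (hw ha₀)
        have h3 := abs_le.1 (abs_pt_le P a₀)
        rw [map_add, map_smul, pt_unit, map_zero, smul_eq_mul, mul_one]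
        linarith [h3.1]
      · rintro _ ⟨a, rfl⟩
        refine le_iff_pt.2 fun P => ?_
        have h2 := pt_mono P (hw a.2)
        have h3 := pt_mono P (hw ha₀)
        have h4 := abs_le.1 (abs_pt_le P a₀)
        rw [map_add, map_smul, map_smul, pt_unit, smul_eq_mul, smul_eq_mul, mul_one]
        by_cases hP : P (b k a)
        · rw [pt_chiL_of P hP]
          linarith [(hb k a P).1 hP]
        · rw [pt_chiL_of_not P hP]
          linarith [h4.1]
    show (-c) • (LinfObj B).unit + _ ≤ _
    calc _ ≤ (-c) • (LinfObj B).unit + (w + (2 * δ + c) • (LinfObj B).unit) :=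
          add_le_add le_rfl h1
      _ = _ := by module

/-- At points of members of `S` the value of `x` is at least 1, and outside an upper bound `c` it is
at most 0; a cut of `x` at intermediate levels is therefore a supremum of `S`. The element `x` is
not assumed to be a supremum in `L∞(B)`, which allows it to be a weak-* limit later. -/
theorem exists_isLUB_of_forall_chiL {S : Set B} {x : LinfObj B} (h₁ : ∀ a ∈ S, chiL a ≤ x)
    (h₂ : ∀ c ∈ upperBounds S, x ≤ chiL c) : ∃ s, IsLUB S s := by
  obtain ⟨b, hb⟩ := exists_cut x (show (1 / 3 : ℝ) < 2 / 3 by norm_num)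
  refine ⟨b, fun a ha => le_iff_point.2 fun P hP => ?_, fun c hc => le_iff_point.2 fun P hP => ?_⟩
  · by_contra h
    have h1 := pt_mono P (h₁ a ha)
    rw [pt_chiL_of P hP] at h1
    linarith [(hb P).2 h]
  · by_contra h
    have h2 := pt_mono P (h₂ c hc)
    rw [pt_chiL_of_not P h] at h2
    linarith [(hb P).1 hP]

theorem exists_isLUB_of_chiL {S : Set B} {x : LinfObj B} (hx : IsLUB (chiL '' S) x) :
    ∃ s, IsLUB S s :=
  exists_isLUB_of_forall_chiL (fun a ha => hx.1 ⟨a, ha, rfl⟩) fun c hc => hx.2 (by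
    rintro _ ⟨a, ha, rfl⟩
    exact chiL_le_iff.2 (hc ha))

-- Reduction of infima to suprema; completeness of `L∞(B)`

theorem isGLB_neg_iff {X : Type*} [AddCommGroup X] [Lattice X] [IsOrderedAddMonoid X] {S : Set X}
    {a : X} : IsGLB S a ↔ IsLUB ((fun x => -x) '' S) (-a) := by
  rw [Set.image_neg_eq_neg, isLUB_neg, neg_neg]

theorem isGLB_compl_iff {S : Set B} {a : B} : IsGLB S a ↔ IsLUB (compl '' S) aᶜ := by
  constructor
  · refine fun h => ⟨?_, fun c hc => ?_⟩
    · rintro _ ⟨b, hb, rfl⟩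
      exact compl_le_compl (h.1 hb)
    · exact compl_le_of_compl_le (h.2 fun b hb => compl_le_of_compl_le (hc ⟨b, hb, rfl⟩))
  · refine fun h => ⟨fun b hb => ?_, fun c hc => ?_⟩
    · exact compl_le_compl_iff_le.1 (h.1 ⟨b, hb, rfl⟩)
    · refine compl_le_compl_iff_le.1 (h.2 ?_)
      rintro _ ⟨b, hb, rfl⟩
      exact compl_le_compl (hc hb)

theorem countablyComplete_iff : CountablyComplete B ↔
    ∀ S : Set B, S.Nonempty → S.Countable → ∃ a, IsLUB S a := by
  refine ⟨fun h S hne hS => h.1 S hne hS (OrderTop.bddAbove S), fun h =>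
    ⟨fun S hne hS _ => h S hne hS, fun S hne hS _ => ?_⟩⟩
  obtain ⟨a, ha⟩ := h (compl '' S) (hne.image _) (hS.image _)
  exact ⟨aᶜ, isGLB_compl_iff.2 (by rwa [compl_compl])⟩

theorem DedekindComplete.countablyComplete (h : DedekindComplete B) : CountablyComplete B :=
  countablyComplete_iff.2 fun S hne _ => h S hne (OrderTop.bddAbove S)

theorem countablyComplete_iff_neg {X : Type*} [AddCommGroup X] [Lattice X]
    [IsOrderedAddMonoid X] : CountablyComplete X ↔
    ∀ S : Set X, S.Nonempty → S.Countable → BddAbove S → ∃ a, IsLUB S a := by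
  refine ⟨fun h => h.1, fun h => ⟨h, fun S hne hS hb => ?_⟩⟩
  obtain ⟨a, ha⟩ := h ((fun x => -x) '' S) (hne.image _) (hS.image _) (by
    obtain ⟨b, hb⟩ := hb
    refine ⟨-b, ?_⟩
    rintro _ ⟨x, hx, rfl⟩
    exact neg_le_neg (hb hx))
  exact ⟨-a, isGLB_neg_iff.2 (by rwa [neg_neg])⟩

theorem DedekindComplete.countablyComplete' {X : Type*} [AddCommGroup X] [Lattice X]
    [IsOrderedAddMonoid X] (h : DedekindComplete X) : CountablyComplete X :=
  countablyComplete_iff_neg.2 fun S hne _ => h S hne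

theorem bddAbove_chiL (S : Set B) : BddAbove (chiL '' S) := by
  refine ⟨chiL ⊤, ?_⟩
  rintro _ ⟨b, -, rfl⟩
  exact chiL_le_iff.2 le_top

theorem countablyComplete_linf_iff : CountablyComplete (LinfObj B) ↔ CountablyComplete B := by
  rw [countablyComplete_iff_neg, countablyComplete_iff]
  constructor
  · intro h S hne hS
    obtain ⟨x, hx⟩ := h (chiL '' S) (hne.image _) (hS.image _) (bddAbove_chiL S)
    exact exists_isLUB_of_chiL hx
  · intro h S hne hS hb
    have := hne.to_subtype
    have := hS.to_subtype
    exact exists_isLUB_linf hne hb fun f => h _ (Set.range_nonempty f) (Set.countable_range f)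

theorem dedekindComplete_linf_iff : DedekindComplete (LinfObj B) ↔ DedekindComplete B := by
  constructor
  · intro h S hne _
    obtain ⟨x, hx⟩ := h (chiL '' S) (hne.image _) (bddAbove_chiL S)
    exact exists_isLUB_of_chiL hx
  · intro h S hne hb
    have := hne.to_subtype
    exact exists_isLUB_linf hne hb fun f => h _ (Set.range_nonempty f) (OrderTop.bddAbove _)

/-! ### Properties of homomorphisms -/

/-- Negation turns infima of downwards directed sets into suprema of upwards directed ones, and
monotonicity shows that `f a` is an upper bound. Only its minimality has to be checked. -/
theorem orderContinuous_of_map_isLUB {X Y : MISpace.{u}} (f : X ⟶ Y)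
    (h : ∀ (S : Set X) (a : X), S.Nonempty → DirectedOn (· ≤ ·) S → IsLUB S a →
      f a ∈ lowerBounds (upperBounds ((fun x => f x) '' S))) : OrderContinuous fun x => f x := by
  have h' : ∀ (S : Set X) (a : X), S.Nonempty → DirectedOn (· ≤ ·) S → IsLUB S a →
      IsLUB ((fun x => f x) '' S) (f a) := fun S a hne hd hl => ⟨by
    rintro _ ⟨x, hx, rfl⟩
    exact MISpace.monotone f (hl.1 hx), h S a hne hd hl⟩
  refine ⟨MISpace.monotone f, h', fun S a hne hd hg => ?_⟩
  have := h' ((fun x => -x) '' S) (-a) (hne.image _) (by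
    rintro _ ⟨x, hx, rfl⟩ _ ⟨y, hy, rfl⟩
    obtain ⟨z, hz, h1, h2⟩ := hd x hx y hy
    exact ⟨-z, ⟨z, hz, rfl⟩, neg_le_neg h1, neg_le_neg h2⟩) (isGLB_neg_iff.1 hg)
  rw [isGLB_neg_iff]
  simpa only [Set.image_image, MISpace.map_neg] using this

theorem orderContinuous_of_map_isLUB' (g : BoundedLatticeHom A B)
    (h : ∀ (S : Set A) (a : A), S.Nonempty → DirectedOn (· ≤ ·) S → IsLUB S a →
      IsLUB (g '' S) (g a)) : OrderContinuous g := by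
  refine ⟨OrderHomClass.mono g, h, fun S a hne hd hg => ?_⟩
  have := h (compl '' S) aᶜ (hne.image _) (by
    rintro _ ⟨x, hx, rfl⟩ _ ⟨y, hy, rfl⟩
    obtain ⟨z, hz, h1, h2⟩ := hd x hx y hy
    exact ⟨zᶜ, ⟨z, hz, rfl⟩, compl_le_compl h1, compl_le_compl h2⟩) (isGLB_compl_iff.1 hg)
  rw [isGLB_compl_iff]
  simpa only [Set.image_image, map_compl'] using this

/-- An upwards directed set with supremum `x` approaches `x` uniformly, up to elements of `B` that
decrease to zero. -/
theorem exists_squeeze {S : Set (LinfObj B)} {x : LinfObj B} (hne : S.Nonempty)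
    (hd : DirectedOn (· ≤ ·) S) (hx : IsLUB S x) {ε : ℝ} (hε : 0 < ε) :
    ∃ (K : ℝ) (C : Set B), 0 ≤ K ∧ C.Nonempty ∧ DirectedOn (· ≥ ·) C ∧ IsGLB C ⊥ ∧
      ∀ c ∈ C, ∃ y ∈ S, x - y ≤ K • chiL c + ε • (LinfObj B).unit := by
  obtain ⟨a₀, ha₀⟩ := hne
  have hK := norm_nonneg (x - a₀)
  have hpt : ∀ (P : Point B) (K : ℝ) (z : LinfObj B),
      pt P (K • z + ε • (LinfObj B).unit) = K * pt P z + ε := fun P K z => by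
    rw [map_add, map_smul, map_smul, pt_unit, smul_eq_mul, smul_eq_mul, mul_one]
  -- The constant bounds `x - y` for every `y ∈ S` above `a₀`, and `C` contains every admissible
  -- `c`. Directedness of `C` comes from directedness of `S`: an element of `S` above those chosen
  -- for `c` and `d` serves for `c ⊓ d`.
  refine ⟨‖x - a₀‖, {c | ∃ y ∈ S, x - y ≤ ‖x - a₀‖ • chiL c + ε • (LinfObj B).unit}, hK,
    ⟨⊤, a₀, ha₀, le_iff_pt.2 fun P => ?_⟩, ?_, ⟨fun _ _ => bot_le, fun b hb => ?_⟩,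
    fun c hc => hc⟩
  · rw [hpt, pt_chiL_of P P.top]
    linarith [le_abs_self (pt P (x - a₀)), abs_pt_le P (x - a₀)]
  · rintro c ⟨y, hy, hcy⟩ d ⟨z, hz, hdz⟩
    obtain ⟨w, hw, hyw, hzw⟩ := hd y hy z hz
    refine ⟨c ⊓ d, ⟨w, hw, le_iff_pt.2 fun P => ?_⟩, inf_le_left, inf_le_right⟩
    have h1 := pt_mono P hcy
    have h2 := pt_mono P hdz
    have h3 := pt_mono P hyw
    have h4 := pt_mono P hzw
    rw [hpt, map_sub] at h1 h2 ⊢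
    rw [chiL_inf_eq, pt_inf]
    rcases min_choice (pt P (chiL c)) (pt P (chiL d)) with h | h <;> rw [h] <;> linarith
  · have hle : x ≤ x - (ε / 2) • chiL b := hx.2 fun y hy => by
      obtain ⟨z, hz, hyz, haz⟩ := hd y hy a₀ ha₀
      obtain ⟨c, hc⟩ := exists_cut (x - z) (show ε / 2 < ε by linarith)
      have hbc : b ≤ c := hb ⟨z, hz, le_iff_pt.2 fun P => by
        rw [hpt]
        by_cases hP : P c
        · have h1 := pt_mono P haz
          have h2 := (le_abs_self _).trans (abs_pt_le P (x - a₀))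
          rw [pt_chiL_of P hP]
          rw [map_sub] at h2 ⊢
          linarith
        · rw [pt_chiL_of_not P hP]
          linarith [(hc P).2 hP]⟩
      refine le_iff_pt.2 fun P => ?_
      have h1 := pt_mono P hyz
      have h2 := pt_mono P (hx.1 hz)
      rw [map_sub, map_smul, smul_eq_mul]
      by_cases hP : P b
      · have := (hc P).1 (P.mono hbc hP)
        rw [map_sub] at this
        rw [pt_chiL_of P hP]
        linarith
      · rw [pt_chiL_of_not P hP]
        linarith
    refine (eq_bot_of_point fun P hP => ?_).le
    have := pt_mono P hle
    rw [map_sub, map_smul, pt_chiL_of P hP, smul_eq_mul] at this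
    linarith

/-- If `z` were positive at a point, it would exceed some `r > 0` on an element `b` containing that
point. Outside any `c ∈ C` one has `z ≤ 0`, so `b` lies below all of `C` and is zero. Passing to `z
⊔ 0` provides the positivity that `exists_smul_chiL_le` needs. -/
theorem nonpos_of_le_smul_chiL {C : Set B} (hC : IsGLB C ⊥) {K : ℝ}
    (hK : 0 ≤ K) {z : LinfObj B} (h : ∀ c ∈ C, z ≤ K • chiL c) : z ≤ 0 := by
  refine le_iff_pt.2 fun P => ?_
  rw [map_zero]
  by_contra hP
  rw [not_le] at hP
  obtain ⟨r, hr, hrz⟩ := exists_between hP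
  obtain ⟨b, hPb, hb⟩ := exists_smul_chiL_le (x := z ⊔ 0) (P := P) le_sup_right
    (r := r) (by rw [pt_sup]; exact lt_max_of_lt_left hrz)
  have : b ≤ ⊥ := hC.2 fun c hc => le_iff_point.2 fun Q hQ => by
    by_contra hQc
    have h1 := pt_mono Q (hb.trans (sup_le (h c hc) (smul_nonneg hK (chiL_nonneg c))))
    rw [map_smul, map_smul, pt_chiL_of Q hQ, pt_chiL_of_not Q hQc, smul_eq_mul, smul_eq_mul] at h1
    linarith
  exact P.not_bot (P.mono this hPb)

theorem linfMap_chiL (g : BoundedLatticeHom A B) (a : A) :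
    LinfMap g (chiL a) = chiL (g a) := by
  refine (Simple.completionMap_coe g (Simple.chi a)).trans ?_
  rw [Simple.map_chi]
  rfl

/-- Since `χ` preserves and reflects the relevant suprema, order continuity of `L∞(g)` restricts to
`g`. For the converse, `exists_squeeze` moves the convergence into a set decreasing to zero in `A`;
`g` preserves this infimum, and the bound `K • χ(g c)` then forces the gap below the arbitrary error
`ε`. -/
theorem orderContinuous_linfMap_iff (g : BoundedLatticeHom A B) :
    (OrderContinuous fun x => LinfMap g x) ↔ OrderContinuous g := by
  constructor
  · refine fun h => orderContinuous_of_map_isLUB' g fun S a hne hd hl => ?_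
    have h1 := h.map_isLUB _ _ (hne.image _) (by
      rintro _ ⟨x, hx, rfl⟩ _ ⟨y, hy, rfl⟩
      obtain ⟨z, hz, h1, h2⟩ := hd x hx y hy
      exact ⟨chiL z, ⟨z, hz, rfl⟩, chiL_le_iff.2 h1, chiL_le_iff.2 h2⟩) (isLUB_chiL hne hl)
    simp only [Set.image_image, linfMap_chiL] at h1
    refine ⟨?_, fun c hc => chiL_le_iff.1 (h1.2 ?_)⟩
    · rintro _ ⟨x, hx, rfl⟩
      exact chiL_le_iff.1 (h1.1 ⟨x, hx, rfl⟩)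
    · rintro _ ⟨x, hx, rfl⟩
      exact chiL_le_iff.2 (hc ⟨x, hx, rfl⟩)
  · refine fun h => orderContinuous_of_map_isLUB _ fun S x hne hd hl w hw =>
      le_of_forall_le_add_smul_unit fun ε hε => ?_
    obtain ⟨K, C, hK, hCne, hCd, hCg, hC⟩ := exists_squeeze hne hd hl hε
    have hg := h.map_isGLB C ⊥ hCne hCd hCg
    rw [BotHomClass.map_bot] at hg
    have := nonpos_of_le_smul_chiL hg hK
      (z := LinfMap g x - w - ε • (LinfObj B).unit) (by
        rintro _ ⟨c, hc, rfl⟩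
        obtain ⟨y, hy, hxy⟩ := hC c hc
        have h1 := MISpace.monotone (LinfMap g) hxy
        rw [sub_eq_add_neg, MISpace.map_add, MISpace.map_neg, MISpace.map_add, MISpace.map_smul,
          MISpace.map_smul, MISpace.map_unit, linfMap_chiL, ← sub_eq_add_neg] at h1
        rw [sub_le_iff_le_add]
        exact (sub_le_sub_left (hw ⟨y, hy, rfl⟩) _).trans h1)
    rw [sub_sub, sub_nonpos] at this
    exact this

/-- If `x ≠ 0` is in the kernel, then `r • χ(b) ≤ |x|` for some `r > 0` and nonzero `b`. Applying
the homomorphism gives `χ(g b) = 0`, so `g` is not injective. -/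
theorem injective_linfMap_iff (g : BoundedLatticeHom A B) :
    (Function.Injective fun x => LinfMap g x) ↔ Function.Injective g := by
  constructor
  · intro h a b hab
    exact chiL_injective (h (by simp only [linfMap_chiL, hab]))
  · intro h
    refine (injective_iff_map_eq_zero (LinfMap g).toLinearMap).2 fun x hx => ?_
    by_contra hne
    obtain ⟨P, hP⟩ : ∃ P, pt P x ≠ 0 := by
      by_contra h0
      push Not at h0
      exact hne (eq_zero_of_pt h0)
    have h1 : 0 < pt P |x| := by rw [pt_abs]; exact abs_pos.2 hP
    obtain ⟨r, hr, hrx⟩ := exists_between h1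
    obtain ⟨b, hPb, hb⟩ := exists_smul_chiL_le (abs_nonneg x) hrx
    have h2 := MISpace.monotone (LinfMap g) hb
    have h3 : LinfMap g x = 0 := hx
    rw [MISpace.map_abs, h3, abs_zero, MISpace.map_smul, linfMap_chiL] at h2
    have h4 : g b = ⊥ := eq_bot_of_point fun Q hQ => by
      have := pt_mono Q h2
      rw [map_smul, pt_chiL_of Q hQ, map_zero, smul_eq_mul] at this
      linarith
    rw [← BotHomClass.map_bot g] at h4
    exact P.not_bot (h h4 ▸ hPb)

end

end RieszBool

namespace RieszBool

/-! ### Homomorphisms of MI-spaces -/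

namespace MISpace

variable {X Y : MISpace.{u}}

theorem map_sub (f : X ⟶ Y) (x y : X) : f (x - y) = f x - f y := f.toLinearMap.map_sub x y

theorem norm_map_le (f : X ⟶ Y) (x : X) : ‖f x‖ ≤ ‖x‖ :=
  norm_le_of_abs_le (norm_nonneg x) (by
    rw [← map_abs, ← map_unit f, ← map_smul]
    exact monotone f (abs_le_norm_smul x))

theorem continuous (f : X ⟶ Y) : Continuous fun x => f x :=
  AddMonoidHomClass.continuous_of_bound f.toLinearMap 1 fun x => by
    rw [one_mul]; exact norm_map_le f x

theorem map_le_map_iff {f : X ⟶ Y} (hf : Function.Injective fun x => f x) {x y : X} :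
    f x ≤ f y ↔ x ≤ y := by
  refine ⟨fun h => ?_, fun h => monotone f h⟩
  rw [← sup_eq_right] at h ⊢
  exact hf ((map_sup f x y).trans h)

/-- The norm is determined by the order and the unit, and an injective Riesz homomorphism reflects
the order. Isometric isomorphisms are therefore just the bijective homomorphisms. -/
theorem norm_map {f : X ⟶ Y} (hf : Function.Injective fun x => f x) (x : X) : ‖f x‖ = ‖x‖ := by
  refine le_antisymm (norm_map_le f x) (norm_le_of_abs_le (norm_nonneg _) ?_)
  rw [← map_le_map_iff hf, map_abs, map_smul, map_unit]
  exact abs_le_norm_smul _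

theorem isIsometricIso_iff {f : X ⟶ Y} :
    IsIsometricIso f ↔ Function.Bijective fun x => f x :=
  ⟨fun h => h.1, fun h => ⟨h, norm_map h.1⟩⟩

/-- The inverse of a bijective unit preserving Riesz homomorphism. -/
noncomputable def isoOfBijective (f : X ⟶ Y) (hf : Function.Bijective fun x => f x) : X ≅ Y where
  hom := f
  inv :=
    { toLinearMap := (LinearEquiv.ofBijective f.toLinearMap hf).symm.toLinearMap
      map_sup' := fun x y => by
        have h : ∀ z : Y, f ((LinearEquiv.ofBijective f.toLinearMap hf).symm z) = z :=
          fun z => (LinearEquiv.ofBijective f.toLinearMap hf).apply_symm_apply z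
        apply hf.1
        show f ((LinearEquiv.ofBijective f.toLinearMap hf).symm _) = f (_ ⊔ _)
        rw [h, map_sup]
        exact congrArg₂ _ (h x).symm (h y).symm
      map_unit' := by
        refine (LinearEquiv.symm_apply_eq _).2 ?_
        exact (map_unit f).symm }
  hom_inv_id := hom_ext fun x => (LinearEquiv.ofBijective f.toLinearMap hf).symm_apply_apply x
  inv_hom_id := hom_ext fun x => (LinearEquiv.ofBijective f.toLinearMap hf).apply_symm_apply x

theorem isIso_iff_bijective (f : X ⟶ Y) : IsIso f ↔ Function.Bijective fun x => f x := by
  constructor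
  · intro h
    refine Function.bijective_iff_has_inverse.2 ⟨fun y => (inv f) y, fun x => ?_, fun y => ?_⟩
    · show (f ≫ inv f) x = x
      rw [IsIso.hom_inv_id]; rfl
    · show (inv f ≫ f) y = y
      rw [IsIso.inv_hom_id]; rfl
  · intro h
    exact (isoOfBijective f h).isIso_hom

/-- Isomorphisms of MI-spaces are order isomorphisms. -/
noncomputable def orderIso (f : X ⟶ Y) (hf : Function.Bijective fun x => f x) : X ≃o Y where
  toEquiv := Equiv.ofBijective _ hf
  map_rel_iff' := map_le_map_iff hf.1

end MISpace

-- Transport of order properties along isomorphisms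

theorem OrderContinuous.of_orderIso {α β : Type*} [Preorder α] [Preorder β] (e : α ≃o β) :
    OrderContinuous fun x => e x :=
  ⟨e.monotone, fun _ _ _ _ h => e.isLUB_image'.2 h, fun _ _ _ _ h => e.isGLB_image'.2 h⟩

theorem orderContinuous_of_bijective {X Y : MISpace.{u}} {f : X ⟶ Y}
    (hf : Function.Bijective fun x => f x) : OrderContinuous fun x => f x :=
  OrderContinuous.of_orderIso (MISpace.orderIso f hf)

theorem DedekindComplete.of_orderIso {α β : Type*} [Preorder α] [Preorder β] (e : α ≃o β)
    (h : DedekindComplete α) : DedekindComplete β := fun S hne hb => by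
  obtain ⟨a, ha⟩ := h (e.symm '' S) (hne.image _) (e.symm.bddAbove_image.2 hb)
  exact ⟨e a, by simpa [Set.image_image] using e.isLUB_image'.2 ha⟩

theorem CountablyComplete.of_orderIso {α β : Type*} [Preorder α] [Preorder β] (e : α ≃o β)
    (h : CountablyComplete α) : CountablyComplete β := by
  refine ⟨fun S hne hS hb => ?_, fun S hne hS hb => ?_⟩
  · obtain ⟨a, ha⟩ := h.1 (e.symm '' S) (hne.image _) (hS.image _) (e.symm.bddAbove_image.2 hb)
    exact ⟨e a, by simpa [Set.image_image] using e.isLUB_image'.2 ha⟩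
  · obtain ⟨a, ha⟩ := h.2 (e.symm '' S) (hne.image _) (hS.image _) (e.symm.bddBelow_image.2 hb)
    exact ⟨e a, by simpa [Set.image_image] using e.isGLB_image'.2 ha⟩

/-! ### Components of the order unit -/

section Components

variable {X Y : MISpace.{u}}

theorem IsSplit.eq_sub {p q : X} (h : IsSplit p q) : q = X.unit - p :=
  eq_sub_of_add_eq (by rw [add_comm, h.add_eq])

theorem IsSplit.le_unit {p q : X} (h : IsSplit p q) : p ≤ X.unit := by
  rw [← h.add_eq]; exact le_add_of_nonneg_right h.nonneg_right

/-- The band generated by `p'` is the disjoint complement of `q'`. Thus `p` belongs to it iff `p` is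
disjoint from `q'`, and together with `p ≤ p' + q'` this gives `p ≤ p'`. -/
theorem IsSplit.band_le_iff {p q p' q' : X} (h : IsSplit p q) (h' : IsSplit p' q') :
    h.band ≤ h'.band ↔ p ≤ p' := by
  show disjCompl (disjCompl {p}) ⊆ disjCompl (disjCompl {p'}) ↔ _
  constructor
  · intro hle
    have h1 : p ∈ disjCompl {q'} := by
      rw [← h'.disjCompl_eq]
      exact hle (subset_disjCompl_disjCompl _ (Set.mem_singleton p))
    rw [h'.symm.mem_disjCompl_singleton, abs_of_nonneg h.nonneg_left] at h1
    refine le_of_le_add_of_inf_eq_zero h'.nonneg_left h'.nonneg_right h.nonneg_left ?_ h1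
    rw [h'.add_eq]
    exact h.le_unit
  · intro hle
    refine disjCompl_anti fun x hx => ?_
    rw [h'.mem_disjCompl_singleton] at hx
    rw [h.mem_disjCompl_singleton]
    exact le_antisymm ((inf_le_inf_left _ hle).trans hx.le) (le_inf (abs_nonneg _) h.nonneg_left)

/-- The component of the order unit in a projection band. -/
noncomputable def unitComponent (P : ProjBand X) : X := P.exists_eq_band.choose

theorem isSplit_unitComponent (P : ProjBand X) :
    IsSplit (unitComponent P) (X.unit - unitComponent P) := by
  obtain ⟨q, h, -⟩ := P.exists_eq_band.choose_spec
  have := h.eq_sub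
  subst this
  exact h

theorem band_unitComponent (P : ProjBand X) : (isSplit_unitComponent P).band = P := by
  obtain ⟨q, h, hP⟩ := P.exists_eq_band.choose_spec
  exact hP.symm

theorem unitComponent_le_iff {P Q : ProjBand X} :
    unitComponent P ≤ unitComponent Q ↔ P ≤ Q := by
  rw [← (isSplit_unitComponent P).band_le_iff (isSplit_unitComponent Q), band_unitComponent,
    band_unitComponent]

theorem unitComponent_band {p q : X} (h : IsSplit p q) : unitComponent h.band = p := by
  refine le_antisymm ?_ ?_
  · rw [← (isSplit_unitComponent _).band_le_iff h, band_unitComponent]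
  · rw [← h.band_le_iff (isSplit_unitComponent _), band_unitComponent]

/-- Naturality of both the unit and the counit of the equivalence comes down to this identity. -/
theorem unitComponent_map (f : X ⟶ Y) (P : ProjBand X) :
    unitComponent (ProjBand.map f P) = f (unitComponent P) := by
  conv_lhs => rw [← band_unitComponent P, IsSplit.band_map, unitComponent_band]

theorem unitComponent_nonneg (P : ProjBand X) : 0 ≤ unitComponent P :=
  (isSplit_unitComponent P).nonneg_left

theorem unitComponent_compl (P : ProjBand X) :
    unitComponent Pᶜ = X.unit - unitComponent P := by
  conv_lhs => rw [← band_unitComponent P, IsSplit.band_compl, unitComponent_band]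

theorem unitComponent_inf_eq_zero {P Q : ProjBand X} (h : P ⊓ Q = ⊥) :
    unitComponent P ⊓ unitComponent Q = 0 := by
  have h1 : unitComponent Q ≤ X.unit - unitComponent P := by
    rw [← unitComponent_compl, unitComponent_le_iff]
    exact le_compl_iff_disjoint_left.2 (disjoint_iff.2 h)
  exact le_antisymm ((inf_le_inf_left _ h1).trans (isSplit_unitComponent P).inf_eq.le)
    (le_inf (unitComponent_nonneg P) (unitComponent_nonneg Q))

theorem add_eq_sup_of_inf_eq_zero {x y : X} (h : x ⊓ y = 0) : x + y = x ⊔ y := by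
  rw [← inf_add_sup, h, zero_add]

/-- This is the relation imposed in `Simple (ProjBand X)`, so it makes the map `χ(P) ↦ unitComponent
P` well defined. The sum of the two components equals their supremum, is again a component of the
unit, and is the least one above both. -/
theorem unitComponent_sup {P Q : ProjBand X} (h : P ⊓ Q = ⊥) :
    unitComponent (P ⊔ Q) = unitComponent P + unitComponent Q := by
  set p := unitComponent P
  set q := unitComponent Q
  have hp := isSplit_unitComponent P
  have hq := isSplit_unitComponent Q
  have hpq : p + q = p ⊔ q := add_eq_sup_of_inf_eq_zero (unitComponent_inf_eq_zero h)
  have hsplit : IsSplit (p + q) (X.unit - (p + q)) := by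
    have h0 : 0 ≤ X.unit - (p + q) := by
      rw [hpq, sub_nonneg]
      exact sup_le hp.le_unit hq.le_unit
    refine ⟨add_nonneg hp.1 hq.1, h0, le_antisymm ?_ (le_inf (add_nonneg hp.1 hq.1) h0),
      add_sub_cancel _ _⟩
    calc (p + q) ⊓ (X.unit - (p + q))
        ≤ p ⊓ (X.unit - (p + q)) + q ⊓ (X.unit - (p + q)) := add_inf_le hp.1 hq.1 h0
      _ ≤ p ⊓ (X.unit - p) + q ⊓ (X.unit - q) := by
          refine add_le_add (inf_le_inf_left _ (sub_le_sub_left ?_ _))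
            (inf_le_inf_left _ (sub_le_sub_left ?_ _))
          · exact le_add_of_nonneg_right hq.1
          · exact le_add_of_nonneg_left hp.1
      _ = 0 := by rw [hp.inf_eq, hq.inf_eq, add_zero]
  refine le_antisymm ?_ ?_
  · rw [← unitComponent_band hsplit, unitComponent_le_iff]
    refine sup_le ?_ ?_
    · rw [← unitComponent_le_iff, unitComponent_band hsplit]
      exact le_add_of_nonneg_right hq.1
    · rw [← unitComponent_le_iff, unitComponent_band hsplit]
      exact le_add_of_nonneg_left hp.1
  · rw [hpq]
    exact sup_le (unitComponent_le_iff.2 le_sup_left) (unitComponent_le_iff.2 le_sup_right)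

theorem unitComponent_bot : unitComponent (⊥ : ProjBand X) = 0 := by
  have := unitComponent_sup (X := X) (P := ⊥) (Q := ⊥) (by simp)
  simpa using this

theorem unitComponent_top : unitComponent (⊤ : ProjBand X) = X.unit := by
  rw [← compl_bot, unitComponent_compl, unitComponent_bot, sub_zero]

theorem unitComponent_injective : Function.Injective (unitComponent (X := X)) := fun _ _ h =>
  le_antisymm (unitComponent_le_iff.1 h.le) (unitComponent_le_iff.1 h.ge)

theorem abs_smul_of_nonneg {p : X} (hp : 0 ≤ p) (r : ℝ) : |r • p| = |r| • p := by
  rcases le_total 0 r with h | h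
  · rw [abs_of_nonneg h, abs_of_nonneg (smul_nonneg h hp)]
  · rw [abs_of_nonpos h, ← abs_neg, ← neg_smul, abs_of_nonneg (smul_nonneg (neg_nonneg.2 h) hp)]

theorem abs_sum_of_disjoint {ι : Type*} [DecidableEq ι] (s : Finset ι) (a : ι → ℝ) {p : ι → X}
    (hp : ∀ i, 0 ≤ p i) (hd : ∀ i j, i ≠ j → p i ⊓ p j = 0) :
    |∑ i ∈ s, a i • p i| = ∑ i ∈ s, |a i| • p i := by
  -- Disjoint complements are closed under addition, so each term is disjoint from the sum of the
  -- others and `abs_add_of_disj` applies.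
  have hmem : ∀ (j : ι) (t : Finset ι), j ∉ t → ∑ i ∈ t, a i • p i ∈ disjCompl {a j • p j} := by
    intro j t
    induction t using Finset.induction_on with
    | empty => exact fun _ => zero_mem_disjCompl _
    | insert i t hi ih =>
      intro hj
      rw [Finset.mem_insert, not_or] at hj
      rw [Finset.sum_insert hi]
      refine disjCompl_add ?_ (ih hj.2)
      rintro _ rfl
      rw [abs_smul_of_nonneg (hp _), abs_smul_of_nonneg (hp _)]
      exact disj_smul_nonneg (hp _) (hp _) (hd _ _ (Ne.symm hj.1)) (abs_nonneg _) (abs_nonneg _)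
  induction s using Finset.induction_on with
  | empty => simp
  | insert i t hi ih =>
    rw [Finset.sum_insert hi, Finset.sum_insert hi, abs_add_of_disj, ih,
      abs_smul_of_nonneg (hp i)]
    rw [inf_comm]
    exact hmem i t hi _ rfl

end Components

/-! ### The map from `L∞(PrjB(X))` to `X` -/

noncomputable section

variable {X Y : MISpace.{u}} {B : Type u} [BooleanAlgebra B]

/-- The linear map that sends `χ(P)` to the component of the order unit in `P`. -/
def simpleToSpace (X : MISpace.{u}) : Simple (ProjBand X) →ₗ[ℝ] X :=
  (addRel (ProjBand X)).liftQ (Finsupp.linearCombination ℝ unitComponent) (by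
    rw [addRel, Submodule.span_le]
    rintro _ ⟨P, Q, h, rfl⟩
    simp only [SetLike.mem_coe, LinearMap.mem_ker, map_sub, Finsupp.linearCombination_single,
      one_smul, unitComponent_sup h]
    abel)

theorem simpleToSpace_chi (P : ProjBand X) :
    simpleToSpace X (Simple.chi P) = unitComponent P := by
  refine (Submodule.liftQ_apply _ _ _).trans ?_
  rw [Finsupp.linearCombination_single, one_smul]

theorem simple_abs_sum {n : ℕ} {x : Fin n → B} (a : Fin n → ℝ)
    (hx : ∀ i j, i ≠ j → x i ⊓ x j = ⊥) :
    |∑ i, a i • Simple.chi (x i)| = ∑ i, |a i| • Simple.chi (x i) :=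
  Simple.ext_ev fun P => by
    rw [Simple.ev_abs, Simple.ev_sum_disjoint a hx P (fun t => |t|) abs_zero]

theorem simpleToSpace_sum {n : ℕ} (x : Fin n → ProjBand X) (a : Fin n → ℝ) :
    simpleToSpace X (∑ i, a i • Simple.chi (x i)) = ∑ i, a i • unitComponent (x i) := by
  simp only [map_sum, map_smul, simpleToSpace_chi]

/-- For a combination of disjoint elements the modulus is computed coefficientwise, in `Simple
(ProjBand X)` as well as in `X`. -/
theorem simpleToSpace_abs (v : Simple (ProjBand X)) :
    simpleToSpace X |v| = |simpleToSpace X v| := by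
  obtain ⟨n, x, a, hx, rfl⟩ := Simple.exists_disjoint v
  rw [simple_abs_sum a hx, simpleToSpace_sum, simpleToSpace_sum,
    abs_sum_of_disjoint _ _ (fun i => unitComponent_nonneg _)
      fun i j hij => unitComponent_inf_eq_zero (hx i j hij)]

theorem simpleToSpace_sup (v w : Simple (ProjBand X)) :
    simpleToSpace X (v ⊔ w) = simpleToSpace X v ⊔ simpleToSpace X w := by
  rw [sup_eq_half_smul_add_add_abs_sub' ℝ, sup_eq_half_smul_add_add_abs_sub' ℝ]
  simp only [map_smul, map_add, map_sub, simpleToSpace_abs]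

/-- In disjoint form the modulus of the image is a sum of nonnegative terms. Each must vanish, so
either its coefficient or its band is zero. -/
theorem simpleToSpace_eq_zero {v : Simple (ProjBand X)} (h : simpleToSpace X v = 0) : v = 0 := by
  obtain ⟨n, x, a, hx, rfl⟩ := Simple.exists_disjoint v
  have h1 := congrArg (fun y => |y|) h
  simp only [abs_zero] at h1
  rw [simpleToSpace_sum, abs_sum_of_disjoint _ _ (fun i => unitComponent_nonneg _)
      (fun i j hij => unitComponent_inf_eq_zero (hx i j hij)),
    Finset.sum_eq_zero_iff_of_nonneg
      fun i _ => smul_nonneg (abs_nonneg _) (unitComponent_nonneg _)] at h1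
  refine Finset.sum_eq_zero fun i hi => ?_
  rcases smul_eq_zero.1 (h1 i hi) with h2 | h2
  · rw [abs_eq_zero.1 h2, zero_smul]
  · rw [← unitComponent_bot] at h2
    rw [unitComponent_injective h2, Simple.chi_bot, smul_zero]

theorem simpleToSpace_le_iff {v w : Simple (ProjBand X)} :
    simpleToSpace X v ≤ simpleToSpace X w ↔ v ≤ w := by
  rw [← sup_eq_right, ← simpleToSpace_sup, ← sub_eq_zero, ← map_sub, ← sup_eq_right (a := v),
    ← sub_eq_zero (a := v ⊔ w)]
  exact ⟨simpleToSpace_eq_zero, fun h => by rw [h, map_zero]⟩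

/-- Both norms are the least `r` with modulus at most `r` times the unit, and the map preserves and
reflects this inequality. -/
theorem norm_simpleToSpace (v : Simple (ProjBand X)) : ‖simpleToSpace X v‖ = ‖v‖ := by
  have h : ∀ r : ℝ, |simpleToSpace X v| ≤ r • X.unit ↔ |v| ≤ r • Simple.chi ⊤ := fun r => by
    rw [← unitComponent_top, ← simpleToSpace_chi, ← simpleToSpace_abs, ← map_smul,
      simpleToSpace_le_iff]
  have h1 := X.isLeast_norm (simpleToSpace X v)
  simp only [h] at h1
  exact h1.unique (Simple.isLeast_norm v)

/-- The map of `L∞(PrjB(X))` to `X` as a continuous linear map. -/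
def counitL (X : MISpace.{u}) : LinfObj (ProjBand X) →L[ℝ] X :=
  extendL ((simpleToSpace X).mkContinuous 1 fun v => by rw [one_mul, norm_simpleToSpace])

theorem counitL_incl (v : Simple (ProjBand X)) : counitL X (incl v) = simpleToSpace X v :=
  extendL_incl _ v

/-- The unit preserving Riesz homomorphism from `L∞(PrjB(X))` to `X`. -/
def counitHom (X : MISpace.{u}) : LinfObj (ProjBand X) ⟶ X where
  toLinearMap := (counitL X).toLinearMap
  map_sup' x y := by
    refine denseRange_incl.induction_on₂
      (p := fun x y => counitL X (x ⊔ y) = counitL X x ⊔ counitL X y)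
      (isClosed_eq ?_ ?_) (fun v w => ?_) x y
    · exact (counitL X).continuous.comp (continuous_sup' continuous_fst continuous_snd)
    · exact continuous_sup' (by fun_prop) (by fun_prop)
    · rw [← incl_sup, counitL_incl, counitL_incl, counitL_incl, simpleToSpace_sup]
  map_unit' := by
    rw [unit_eq]
    refine (counitL_incl _).trans ?_
    rw [simpleToSpace_chi, unitComponent_top]

theorem counitHom_chiL (P : ProjBand X) : counitHom X (chiL P) = unitComponent P :=
  (counitL_incl _).trans (simpleToSpace_chi P)

theorem norm_counitHom (x : LinfObj (ProjBand X)) : ‖counitHom X x‖ = ‖x‖ := by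
  refine denseRange_incl.induction_on (p := fun x => ‖counitL X x‖ = ‖x‖) x
    (isClosed_eq (by fun_prop) (by fun_prop)) fun v => ?_
  rw [counitL_incl, norm_simpleToSpace, norm_incl]

theorem isometry_counitHom (X : MISpace.{u}) : Isometry fun x => counitHom X x :=
  AddMonoidHomClass.isometry_of_norm (counitHom X).toLinearMap norm_counitHom

theorem linf_hom_ext {f g : LinfObj B ⟶ X} (h : ∀ b, f (chiL b) = g (chiL b)) : f = g := by
  refine MISpace.hom_ext fun x => ?_
  refine denseRange_incl.induction_on (p := fun x => f x = g x) x
    (isClosed_eq (MISpace.continuous f) (MISpace.continuous g)) fun v => ?_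
  induction v using Simple.induction with
  | zero => rw [map_zero, MISpace.map_zero, MISpace.map_zero]
  | add v r b ih =>
    rw [map_add, map_smul, MISpace.map_add, MISpace.map_add, MISpace.map_smul, MISpace.map_smul,
      ih]
    exact congrArg (fun y => g (incl v) + r • y) (h b)

/-- An isometry defined on a complete space is injective with closed range, so surjectivity is only
a matter of density. -/
theorem bijective_counitHom_of_dense
    (h : ∀ (x : X) (ε : ℝ), 0 < ε → ∃ y, ‖x - counitHom X y‖ < ε) :
    Function.Bijective fun x => counitHom X x := by
  refine ⟨(isometry_counitHom X).injective, fun x => ?_⟩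
  have hc := (isometry_counitHom X).isClosedEmbedding.isClosed_range
  have : x ∈ closure (Set.range fun x => counitHom X x) :=
    Metric.mem_closure_range_iff.2 fun ε hε => by
      obtain ⟨y, hy⟩ := h x ε hε
      exact ⟨y, by rwa [dist_eq_norm]⟩
  rwa [hc.closure_eq] at this

/-! ### The map from `B` to `PrjB(L∞(B))` -/

theorem isSplit_chiL (b : B) : IsSplit (chiL b) (chiL bᶜ) where
  nonneg_left := chiL_nonneg b
  nonneg_right := chiL_nonneg _
  inf_eq := by rw [← chiL_inf_eq, inf_compl_eq_bot, chiL_bot]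
  add_eq := by rw [← chiL_sup inf_compl_eq_bot, sup_compl_eq_top, unit_eq]

/-- From `p ⊓ (e - p) = 0` each value of `p` is 0 or 1, so a cut at intermediate levels is exactly
the set where `p = 1`. -/
theorem IsSplit.exists_eq_chiL {p q : LinfObj B} (h : IsSplit p q) : ∃ b : B, chiL b = p := by
  obtain ⟨b, hb⟩ := exists_cut p (show (1 / 3 : ℝ) < 2 / 3 by norm_num)
  refine ⟨b, ext_pt fun P => ?_⟩
  have h1 : min (pt P p) (1 - pt P p) = 0 := by
    rw [← pt_unit P, ← map_sub, ← h.eq_sub, ← pt_inf, h.inf_eq, map_zero]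
  have h2 : pt P p = 0 ∨ pt P p = 1 := by
    rcases min_choice (pt P p) (1 - pt P p) with h' | h' <;> rw [h'] at h1
    · exact Or.inl h1
    · exact Or.inr (by linarith)
  by_cases hP : P b
  · have := (hb P).1 hP
    rw [pt_chiL_of P hP]
    rcases h2 with h2 | h2 <;> linarith
  · have := (hb P).2 hP
    rw [pt_chiL_of_not P hP]
    rcases h2 with h2 | h2 <;> linarith

/-- Every boolean algebra is isomorphic to the boolean algebra of projection bands of
its `L∞` space. -/
def unitOrderIso (B : Type u) [BooleanAlgebra B] : B ≃o ProjBand (LinfObj B) where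
  toEquiv := Equiv.ofBijective (fun b => (isSplit_chiL b).band) ⟨fun a b h => by
      refine chiL_injective ?_
      rw [← unitComponent_band (isSplit_chiL a), ← unitComponent_band (isSplit_chiL b)]
      exact congrArg unitComponent h, fun P => by
      obtain ⟨p, q, h, rfl⟩ := P.exists_eq_band
      obtain ⟨b, rfl⟩ := h.exists_eq_chiL
      exact ⟨b, rfl⟩⟩
  map_rel_iff' {a b} := ((isSplit_chiL a).band_le_iff (isSplit_chiL b)).trans chiL_le_iff

/-- No completeness of `B` is needed: each `χ(b)` is the component of the unit in the band it
generates, so the closed range contains all simple functions. -/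
theorem bijective_counitHom_linf (B : Type u) [BooleanAlgebra B] :
    Function.Bijective fun x => counitHom (LinfObj B) x := by
  refine ⟨(isometry_counitHom _).injective, fun x => ?_⟩
  have hc := (isometry_counitHom (LinfObj B)).isClosedEmbedding.isClosed_range
  refine denseRange_incl.induction_on
    (p := fun x => x ∈ Set.range fun x => counitHom (LinfObj B) x) x hc fun v => ?_
  induction v using Simple.induction with
  | zero => exact ⟨0, by rw [map_zero]; exact MISpace.map_zero _⟩
  | add v r b ih =>
    obtain ⟨y, hy⟩ := ih
    refine ⟨y + r • chiL ((isSplit_chiL b).band), ?_⟩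
    simp only at hy ⊢
    rw [MISpace.map_add, MISpace.map_smul, counitHom_chiL, unitComponent_band, hy, map_add,
      map_smul]
    rfl

/-! ### Countably complete MI-spaces have sufficiently many components -/

/-- Binary infima distribute over arbitrary existing suprema in a lattice ordered group: `s ⊓ v + s
⊔ v = s + v` turns the infimum into a translation. -/
theorem inf_le_of_isLUB {S : Set X} {p v w : X} (hp : IsLUB S p) (h : ∀ s ∈ S, s ⊓ v ≤ w) :
    p ⊓ v ≤ w := by
  have h1 : p ≤ w + p ⊔ v - v := hp.2 fun s hs => by
    rw [le_sub_iff_add_le, ← inf_add_sup]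
    exact add_le_add (h s hs) (sup_le_sup_right (hp.1 hs) v)
  rwa [le_sub_iff_add_le, ← inf_add_sup, add_le_add_iff_right] at h1

/-- For `u ≥ 0`, the component of the order unit in the band generated by `u`. -/
theorem exists_component (hX : CountablyComplete X) {u : X} (hu : 0 ≤ u) :
    ∃ p q : X, IsSplit p q ∧ u ⊓ q = 0 ∧ ∀ v : X, 0 ≤ v → u ⊓ v = 0 → p ⊓ v = 0 := by
  -- The component is `sup (n u ∧ e)`. Countable completeness enters here.
  obtain ⟨p, hp⟩ := hX.1 (Set.range fun n : ℕ => ((n : ℝ) • u) ⊓ X.unit) (Set.range_nonempty _)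
    (Set.countable_range _) ⟨X.unit, by rintro _ ⟨n, rfl⟩; exact inf_le_right⟩
  have hs : ∀ n : ℕ, ((n : ℝ) • u) ⊓ X.unit ≤ p := fun n => hp.1 ⟨n, rfl⟩
  have hp0 : 0 ≤ p := (le_inf (smul_nonneg (Nat.cast_nonneg 0) hu) X.unit_nonneg).trans (hs 0)
  have hpe : p ≤ X.unit := hp.2 (by rintro _ ⟨n, rfl⟩; exact inf_le_right)
  have hq0 : 0 ≤ X.unit - p := sub_nonneg.2 hpe
  -- Twice the truncation of `n u ∧ e` at `e / 2` is at most `2 n u ∧ e ≤ p`. The resulting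
  -- inequality `2 (p ∧ e / 2) ≤ p` excludes values strictly between 0 and 1; since `p + p ∧ (e - p)
  -- = 2 p ∧ e = 2 (p ∧ e / 2)`, it yields `p ∧ (e - p) = 0`.
  have hhalf : p ⊓ ((1 / 2 : ℝ) • X.unit) ≤ (1 / 2 : ℝ) • p := by
    refine inf_le_of_isLUB hp ?_
    rintro _ ⟨n, rfl⟩
    have h2 : (2 : ℝ) • ((((n : ℝ) • u) ⊓ X.unit) ⊓ ((1 / 2 : ℝ) • X.unit)) ≤ p := by
      refine le_trans (le_inf ?_ ?_) (hs (2 * n))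
      · push_cast
        rw [← smul_smul]
        exact smul_le_smul_of_nonneg_left (inf_le_left.trans inf_le_left) (by norm_num)
      · calc _ ≤ (2 : ℝ) • ((1 / 2 : ℝ) • X.unit) :=
              smul_le_smul_of_nonneg_left inf_le_right (by norm_num)
          _ = X.unit := by rw [smul_smul]; norm_num
    calc _ = (1 / 2 : ℝ) • ((2 : ℝ) • ((((n : ℝ) • u) ⊓ X.unit) ⊓ ((1 / 2 : ℝ) • X.unit))) := by
          rw [smul_smul]; norm_num
      _ ≤ _ := smul_le_smul_of_nonneg_left h2 (by norm_num)
  have hsplit : IsSplit p (X.unit - p) := by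
    refine ⟨hp0, hq0, le_antisymm ?_ (le_inf hp0 hq0), add_sub_cancel _ _⟩
    have h1 : p + p ⊓ (X.unit - p) ≤ p := by
      rw [add_inf, add_sub_cancel]
      calc (p + p) ⊓ X.unit = (2 : ℝ) • ((1 / 2 : ℝ) • ((p + p) ⊓ X.unit)) := by
            rw [smul_smul]; norm_num
        _ ≤ (2 : ℝ) • (p ⊓ ((1 / 2 : ℝ) • X.unit)) := by
            refine smul_le_smul_of_nonneg_left (le_inf ?_ ?_) (by norm_num)
            · calc _ ≤ (1 / 2 : ℝ) • (p + p) :=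
                    smul_le_smul_of_nonneg_left inf_le_left (by norm_num)
                _ = p := by module
            · exact smul_le_smul_of_nonneg_left inf_le_right (by norm_num)
        _ ≤ (2 : ℝ) • ((1 / 2 : ℝ) • p) := smul_le_smul_of_nonneg_left hhalf (by norm_num)
        _ = p := by rw [smul_smul]; norm_num
    simpa using h1
  refine ⟨p, X.unit - p, hsplit, le_antisymm ?_ (le_inf hu hq0), fun v hv huv =>
    le_antisymm ?_ (le_inf hp0 hv)⟩
  · rw [← hsplit.inf_eq]
    refine le_inf (le_trans (le_inf ?_ ?_) (hs 1)) inf_le_right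
    · rw [Nat.cast_one, one_smul]; exact inf_le_left
    · exact inf_le_right.trans (sub_le_self _ hp0)
  · refine inf_le_of_isLUB hp ?_
    rintro _ ⟨n, rfl⟩
    have := disj_smul_nonneg hu hv huv (Nat.cast_nonneg n) zero_le_one
    rw [one_smul] at this
    rw [← this]
    exact inf_le_inf_right _ inf_le_left

/-- This extracts the first binary digit of `x`. Take the component `p` of the band generated by
`(2x - e)⁺`: it is disjoint from `(2x - e)⁻`, so `2x ≥ e` on `p`, while its complement is disjoint
from `(2x - e)⁺`, so `2x ≤ e` off `p`. Hence the remainder `2x - p` stays between 0 and `e`. -/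
theorem exists_component_half (hX : CountablyComplete X) {x : X} (hx : 0 ≤ x)
    (hxe : x ≤ X.unit) : ∃ P : ProjBand X,
      0 ≤ (2 : ℝ) • x - unitComponent P ∧ (2 : ℝ) • x - unitComponent P ≤ X.unit := by
  set z := (2 : ℝ) • x - X.unit
  obtain ⟨p, q, h, hq, hp⟩ := exists_component hX (posPart_nonneg z)
  have hpv := hp _ (negPart_nonneg z) (posPart_inf_negPart_eq_zero z)
  refine ⟨h.band, ?_⟩
  rw [unitComponent_band h]
  constructor
  · have h1 : (p - (2 : ℝ) • x) ⊔ 0 ≤ p ⊓ z⁻ := by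
      refine sup_le (le_inf (sub_le_self _ (smul_nonneg zero_le_two hx)) ?_)
        (le_inf h.nonneg_left (negPart_nonneg z))
      refine le_trans ?_ (neg_le_negPart z)
      rw [neg_sub]
      exact sub_le_sub_right h.le_unit _
    rw [hpv] at h1
    have h2 := le_sup_left.trans h1
    rw [sub_nonpos] at h2
    exact sub_nonneg.2 h2
  · have h1 : ((2 : ℝ) • x - p - X.unit) ⊔ 0 ≤ z⁺ ⊓ q := by
      refine sup_le (le_inf ?_ ?_) (le_inf (posPart_nonneg z) h.nonneg_right)
      · refine le_trans ?_ (le_posPart z)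
        exact sub_le_sub_right (sub_le_self _ h.nonneg_left) _
      · rw [h.eq_sub, sub_le_iff_le_add, sub_le_iff_le_add]
        calc (2 : ℝ) • x ≤ (2 : ℝ) • X.unit := smul_le_smul_of_nonneg_left hxe zero_le_two
          _ = _ := by rw [two_smul]; abel
    rw [hq] at h1
    exact sub_nonpos.1 (le_sup_left.trans h1)

/-- Repeating the extraction on the remainder `2x - p` gives the binary expansion of `x` in
components of the unit, and each digit halves the error. -/
theorem exists_counitHom_approx (hX : CountablyComplete X) (n : ℕ) {x : X} (hx : 0 ≤ x)
    (hxe : x ≤ X.unit) :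
    ∃ y, 0 ≤ x - counitHom X y ∧ x - counitHom X y ≤ ((1 / 2 : ℝ) ^ n) • X.unit := by
  induction n generalizing x with
  | zero => exact ⟨0, by simpa [MISpace.map_zero] using ⟨hx, hxe⟩⟩
  | succ n ih =>
    obtain ⟨P, h0, h1⟩ := exists_component_half hX hx hxe
    obtain ⟨y, hy0, hy1⟩ := ih h0 h1
    have h2 : x - counitHom X ((1 / 2 : ℝ) • (chiL P + y)) =
        (1 / 2 : ℝ) • ((2 : ℝ) • x - unitComponent P - counitHom X y) := by
      rw [MISpace.map_smul, MISpace.map_add, counitHom_chiL]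
      module
    refine ⟨(1 / 2 : ℝ) • (chiL P + y), ?_, ?_⟩
    · rw [h2]
      exact smul_nonneg (by norm_num) hy0
    · rw [h2, pow_succ', ← smul_smul]
      exact smul_le_smul_of_nonneg_left hy1 (by norm_num)

/-- A countably complete MI-space is isomorphic to the `L∞` space of its projection bands. -/
theorem bijective_counitHom_of_countablyComplete (hX : CountablyComplete X) :
    Function.Bijective fun x => counitHom X x := by
  refine bijective_counitHom_of_dense fun x ε hε => ?_
  set M := ‖x‖ + 1
  have hM : 0 < M := by positivity
  have hxM : |x| ≤ M • X.unit := (MISpace.abs_le_norm_smul x).trans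
    (smul_le_smul_of_nonneg_right (by simp [M]) X.unit_nonneg)
  obtain ⟨n, hn⟩ := exists_pow_lt_of_lt_one (show 0 < ε / (2 * M) by positivity)
    (show (1 / 2 : ℝ) < 1 by norm_num)
  have h2 := abs_le'.1 hxM
  -- The affine change `(x + M e) / (2M)` brings `x` between 0 and `e`; it is undone by `2M y - M
  -- e`, which multiplies the error by `2M`.
  obtain ⟨y, hy0, hy1⟩ := exists_counitHom_approx hX n
    (x := (1 / (2 * M)) • (x + M • X.unit))
    (smul_nonneg (by positivity) (by have := h2.2; rwa [neg_le_iff_add_nonneg, add_comm] at this))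
    (by
      calc (1 / (2 * M)) • (x + M • X.unit) ≤ (1 / (2 * M)) • (M • X.unit + M • X.unit) :=
            smul_le_smul_of_nonneg_left (add_le_add h2.1 le_rfl) (by positivity)
        _ = (1 / (2 * M) * (2 * M)) • X.unit := by module
        _ = X.unit := by rw [one_div_mul_cancel (by positivity), one_smul])
  refine ⟨(2 * M) • y - M • (LinfObj (ProjBand X)).unit, ?_⟩
  have h3 : x - counitHom X ((2 * M) • y - M • (LinfObj (ProjBand X)).unit) =
      (2 * M) • ((1 / (2 * M)) • (x + M • X.unit) - counitHom X y) := by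
    rw [MISpace.map_sub, MISpace.map_smul, MISpace.map_smul, MISpace.map_unit, smul_sub,
      smul_smul, mul_one_div_cancel (by positivity), one_smul]
    abel
  rw [h3, norm_smul, Real.norm_of_nonneg (by positivity)]
  have h4 := MISpace.norm_le_of_abs_le (by positivity) ((abs_of_nonneg hy0).le.trans hy1)
  calc 2 * M * _ ≤ 2 * M * (1 / 2) ^ n := mul_le_mul_of_nonneg_left h4 (by positivity)
    _ < 2 * M * (ε / (2 * M)) := mul_lt_mul_of_pos_left hn (by positivity)
    _ = ε := by field_simp

end

end RieszBool

namespace RieszBool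

/-! ### Normal measures on boolean algebras -/

noncomputable section

open Filter Topology

variable {B : Type u} [BooleanAlgebra B]

/-- A finite, additive and nonnegative function that is continuous along upwards directed sets. -/
structure IsNormalMeasure (m : B → ℝ) : Prop where
  nonneg : ∀ b, 0 ≤ m b
  map_sup : ∀ a b, a ⊓ b = ⊥ → m (a ⊔ b) = m a + m b
  normal : ∀ (D : Set B) (s : B), D.Nonempty → DirectedOn (· ≤ ·) D → IsLUB D s →
    ∀ ε : ℝ, 0 < ε → ∃ d ∈ D, m s < m d + ε

namespace IsNormalMeasure

variable {m : B → ℝ}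

theorem map_bot (hm : IsNormalMeasure m) : m ⊥ = 0 := by
  have := hm.map_sup ⊥ ⊥ (by simp)
  simpa using this

theorem map_eq_add (hm : IsNormalMeasure m) (a b : B) : m a = m (a ⊓ b) + m (a ⊓ bᶜ) := by
  rw [← hm.map_sup, ← inf_sup_left, sup_compl_eq_top, inf_top_eq]
  rw [inf_inf_inf_comm, inf_compl_eq_bot, inf_bot_eq]

theorem mono (hm : IsNormalMeasure m) {a b : B} (h : a ≤ b) : m a ≤ m b := by
  rw [hm.map_eq_add b a, inf_eq_right.2 h]
  exact le_add_of_nonneg_right (hm.nonneg _)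

theorem exists_lt_of_isGLB (hm : IsNormalMeasure m) {C : Set B} (hne : C.Nonempty)
    (hd : DirectedOn (· ≥ ·) C) (hC : IsGLB C ⊥) {ε : ℝ} (hε : 0 < ε) : ∃ c ∈ C, m c < ε := by
  obtain ⟨_, ⟨c, hc, rfl⟩, h⟩ := hm.normal (compl '' C) ⊥ᶜ (hne.image _) (by
    rintro _ ⟨x, hx, rfl⟩ _ ⟨y, hy, rfl⟩
    obtain ⟨z, hz, h1, h2⟩ := hd x hx y hy
    exact ⟨zᶜ, ⟨z, hz, rfl⟩, compl_le_compl h1, compl_le_compl h2⟩) (isGLB_compl_iff.1 hC) ε hε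
  refine ⟨c, hc, ?_⟩
  have := hm.map_eq_add ⊥ᶜ c
  rw [compl_bot, top_inf_eq, top_inf_eq] at this
  rw [compl_bot] at h
  linarith

theorem map_finset_sup (hm : IsNormalMeasure m) {ι : Type*} {x : ι → B}
    (hx : ∀ i j, i ≠ j → x i ⊓ x j = ⊥) (F : Finset ι) : m (F.sup x) = ∑ i ∈ F, m (x i) := by
  classical
  induction F using Finset.induction_on with
  | empty => simp [hm.map_bot]
  | insert i F hi ih =>
    rw [Finset.sup_insert, Finset.sum_insert hi, hm.map_sup, ih]
    rw [Finset.sup_inf_distrib_left, Finset.sup_eq_bot_iff]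
    exact fun j hj => hx i j (by rintro rfl; exact hi hj)

end IsNormalMeasure

/-- The set of suprema of finite subsets. -/
def finiteSups (S : Set B) : Set B := {d | ∃ F : Finset B, ↑F ⊆ S ∧ F.sup id = d}

theorem finiteSups_nonempty (S : Set B) : (finiteSups S).Nonempty := ⟨_, ∅, by simp, rfl⟩

theorem directedOn_finiteSups (S : Set B) : DirectedOn (· ≤ ·) (finiteSups S) := by
  classical
  rintro _ ⟨F, hF, rfl⟩ _ ⟨G, hG, rfl⟩
  exact ⟨_, ⟨F ∪ G, by simp [hF, hG], rfl⟩, Finset.sup_mono Finset.subset_union_left,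
    Finset.sup_mono Finset.subset_union_right⟩

theorem upperBounds_finiteSups (S : Set B) : upperBounds (finiteSups S) = upperBounds S := by
  refine Set.Subset.antisymm (fun c hc b hb => hc ⟨{b}, by simpa using hb, by simp⟩) ?_
  rintro c hc _ ⟨F, hF, rfl⟩
  exact Finset.sup_le fun b hb => hc (hF hb)

theorem isLUB_finiteSups {S : Set B} {s : B} : IsLUB (finiteSups S) s ↔ IsLUB S s := by
  rw [IsLUB, IsLUB, upperBounds_finiteSups]

theorem isLUB_inf {S : Set B} {s : B} (h : IsLUB S s) (p : B) :
    IsLUB ((fun b => b ⊓ p) '' S) (s ⊓ p) := by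
  refine ⟨?_, fun u hu => ?_⟩
  · rintro _ ⟨b, hb, rfl⟩
    exact inf_le_inf_right p (h.1 hb)
  · rw [← le_himp_iff]
    exact h.2 fun b hb => le_himp_iff.2 (hu ⟨b, hb, rfl⟩)

theorem directedOn_inf {D : Set B} (hd : DirectedOn (· ≤ ·) D) (p : B) :
    DirectedOn (· ≤ ·) ((fun b => b ⊓ p) '' D) := by
  rintro _ ⟨a, ha, rfl⟩ _ ⟨b, hb, rfl⟩
  obtain ⟨c, hc, h1, h2⟩ := hd a ha b hb
  exact ⟨_, ⟨c, hc, rfl⟩, inf_le_inf_right p h1, inf_le_inf_right p h2⟩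

/-- Finite suprema of the `x i` form a directed set with supremum `s`, so normality upgrades finite
additivity to countable additivity. -/
theorem IsNormalMeasure.ofReal_eq_tsum {m : B → ℝ} (hm : IsNormalMeasure m) {x : ℕ → B} {s : B}
    (hx : ∀ i j, i ≠ j → x i ⊓ x j = ⊥) (hs : IsLUB (Set.range x) s) :
    ENNReal.ofReal (m s) = ∑' i, ENNReal.ofReal (m (x i)) := by
  classical
  have hsum : ∀ F : Finset ℕ, ∑ i ∈ F, ENNReal.ofReal (m (x i)) = ENNReal.ofReal (m (F.sup x)) :=
    fun F => by rw [hm.map_finset_sup hx, ENNReal.ofReal_sum_of_nonneg fun i _ => hm.nonneg _]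
  refine le_antisymm ?_ ?_
  · refine ENNReal.le_of_forall_pos_le_add fun ε hε _ => ?_
    obtain ⟨_, ⟨F, hF, rfl⟩, h⟩ := hm.normal _ s (finiteSups_nonempty _)
      (directedOn_finiteSups _) (isLUB_finiteSups.2 hs) ε hε
    obtain ⟨G, rfl⟩ : ∃ G : Finset ℕ, G.image x = F := by
      obtain ⟨G, -, hG⟩ := Finset.subset_set_image_iff.1
        (show (F : Set B) ⊆ x '' Set.univ by rwa [Set.image_univ])
      exact ⟨G, hG⟩
    rw [Finset.sup_image, Function.id_comp] at h
    calc ENNReal.ofReal (m s) ≤ ENNReal.ofReal (m (G.sup x) + ε) := ENNReal.ofReal_le_ofReal h.le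
      _ ≤ ENNReal.ofReal (m (G.sup x)) + ENNReal.ofReal ε := ENNReal.ofReal_add_le
      _ ≤ _ := by
        rw [← hsum, ENNReal.ofReal_coe_nnreal]
        exact add_le_add (ENNReal.sum_le_tsum G) le_rfl
  · rw [ENNReal.tsum_eq_iSup_sum]
    refine iSup_le fun F => ?_
    rw [hsum]
    exact ENNReal.ofReal_le_ofReal (hm.mono (Finset.sup_le fun i _ => hs.1 ⟨i, rfl⟩))

/-- A Dedekind complete boolean algebra with sufficiently many normal measures is
an mcb-algebra. -/
theorem isMcb_of_normalMeasures (hB : DedekindComplete B)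
    (h : ∀ b : B, b ≠ ⊥ → ∃ m : B → ℝ, IsNormalMeasure m ∧ 0 < m b) : IsMcb B := by
  classical
  let good : B → Prop := fun p =>
    p ≠ ⊥ ∧ ∃ m : B → ℝ, IsNormalMeasure m ∧ ∀ q, q ≤ p → q ≠ ⊥ → 0 < m q
  have hgood : ∀ b : B, b ≠ ⊥ → ∃ p, p ≤ b ∧ good p := by
    intro b hb
    obtain ⟨m, hm, hmb⟩ := h b hb
    -- The null elements below `b` are directed, and by normality their supremum `n` is null too. On
    -- `b ⊓ nᶜ` the measure is strictly positive.
    let N : Set B := {q | q ≤ b ∧ m q = 0}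
    have hNne : N.Nonempty := ⟨⊥, bot_le, hm.map_bot⟩
    have hNd : DirectedOn (· ≤ ·) N := by
      rintro x ⟨hxb, hx⟩ y ⟨hyb, hy⟩
      refine ⟨x ⊔ y, ⟨sup_le hxb hyb, le_antisymm ?_ (hm.nonneg _)⟩, le_sup_left, le_sup_right⟩
      rw [hm.map_eq_add _ x, inf_eq_right.2 le_sup_left, hx, zero_add, ← hy]
      refine hm.mono ?_
      rw [inf_sup_right, inf_compl_eq_bot, bot_sup_eq]
      exact inf_le_left
    obtain ⟨n, hn⟩ := hB N hNne (OrderTop.bddAbove N)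
    have hmn : m n = 0 := le_antisymm (le_of_forall_pos_le_add fun ε hε => by
      obtain ⟨d, hd, hlt⟩ := hm.normal N n hNne hNd hn ε hε
      rw [hd.2] at hlt
      exact hlt.le) (hm.nonneg _)
    have hpos : 0 < m (b ⊓ nᶜ) := by
      have h1 := hm.map_eq_add b n
      have h2 := hm.mono (inf_le_right : b ⊓ n ≤ n)
      linarith
    refine ⟨b ⊓ nᶜ, inf_le_left, fun h0 => ?_, m, hm, fun q hq hq0 =>
      lt_of_le_of_ne (hm.nonneg q) fun hmq => hq0 ?_⟩
    · rw [h0, hm.map_bot] at hpos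
      exact lt_irrefl _ hpos
    · have h1 : q ≤ n := hn.1 ⟨hq.trans inf_le_left, hmq.symm⟩
      have h2 : q ≤ nᶜ := hq.trans inf_le_right
      exact le_bot_iff.1 ((le_inf h1 h2).trans inf_compl_eq_bot.le)
  -- Take a maximal disjoint family of elements carrying strictly positive normal measures. By
  -- `hgood` and maximality, every nonzero element meets a member of the family.
  obtain ⟨T, hT⟩ := zorn_subset {T : Set B | T.PairwiseDisjoint id ∧ ∀ p ∈ T, good p} (by
    intro c hc hchain
    refine ⟨⋃₀ c, ⟨(Set.pairwiseDisjoint_sUnion hchain.directedOn).2 fun t ht => (hc ht).1, ?_⟩,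
      fun t ht => Set.subset_sUnion_of_mem ht⟩
    rintro p ⟨t, ht, hp⟩
    exact (hc ht).2 p hp)
  have hdisj : ∀ p ∈ T, ∀ q ∈ T, p ≠ q → p ⊓ q = ⊥ := fun p hp q hq hpq =>
    disjoint_iff.1 (hT.prop.1 hp hq hpq)
  have hcover : ∀ b : B, b ≠ ⊥ → ∃ p ∈ T, b ⊓ p ≠ ⊥ := by
    intro b hb
    by_contra hcon
    push Not at hcon
    obtain ⟨p, hpb, hp⟩ := hgood b hb
    have hpT : ∀ q ∈ T, p ⊓ q = ⊥ := fun q hq =>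
      le_bot_iff.1 ((inf_le_inf_right q hpb).trans (hcon q hq).le)
    have hins : insert p T ⊆ T := hT.le_of_ge (y := insert p T)
      ⟨hT.prop.1.insert fun q hq _ => disjoint_iff.2 (hpT q hq), by
        rintro q (rfl | hq)
        · exact hp
        · exact hT.prop.2 q hq⟩ (Set.subset_insert p T)
    have := hpT p (hins (Set.mem_insert p T))
    rw [inf_idem] at this
    exact hp.1 this
  choose! m hm hmpos using fun p hp => (hT.prop.2 p hp).2
  have hsingle : ∀ (b : B) (p : T), ∑' q : T, ENNReal.ofReal (m q (b ⊓ p ⊓ q)) =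
      ENNReal.ofReal (m p (b ⊓ p)) := fun b p => by
    rw [tsum_eq_single p fun q hq => ?_, inf_assoc, inf_idem]
    rw [inf_assoc, hdisj p p.2 q q.2 fun h => hq (Subtype.ext h.symm), inf_bot_eq,
      (hm q q.2).map_bot, ENNReal.ofReal_zero]
  -- The pieces are summed over `T`. Semi-finiteness holds because only one summand survives on `x ⊓
  -- p`, and it is finite.
  refine ⟨hB, fun b => ∑' p : T, ENNReal.ofReal (m p (b ⊓ p)), ?_, ?_, ?_, ?_⟩
  · simp only [bot_inf_eq, ENNReal.tsum_eq_zero]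
    intro p
    rw [(hm p p.2).map_bot, ENNReal.ofReal_zero]
  · intro x s hx hs
    rw [ENNReal.tsum_comm]
    refine tsum_congr fun p => ?_
    refine (hm p p.2).ofReal_eq_tsum (fun i j hij => ?_) ?_
    · rw [inf_inf_inf_comm, hx i j hij, bot_inf_eq]
    · have := isLUB_inf hs p.1
      rwa [← Set.range_comp] at this
  · intro x hx
    obtain ⟨p, hp, hxp⟩ := hcover x hx
    exact (ENNReal.ofReal_pos.2 (hmpos p hp _ inf_le_right hxp)).trans_le
      (ENNReal.le_tsum (⟨p, hp⟩ : T))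
  · intro x hx
    obtain ⟨p, hp, hxp⟩ := hcover x (by
      rintro rfl
      refine ENNReal.zero_ne_top ((Eq.symm ?_).trans hx)
      rw [ENNReal.tsum_eq_zero]
      intro p
      rw [bot_inf_eq, (hm p p.2).map_bot, ENNReal.ofReal_zero])
    refine ⟨x ⊓ p, inf_le_left, ?_⟩
    have h1 := hsingle x ⟨p, hp⟩
    simp only at h1 ⊢
    rw [h1]
    exact ⟨ENNReal.ofReal_pos.2 (hmpos p hp _ inf_le_right hxp), ENNReal.ofReal_lt_top⟩

/-- The positive part of a bounded additive function that is continuous along upwards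
directed sets. -/
theorem exists_normalMeasure {ν : B → ℝ} {C : ℝ} (hC : ∀ b, ν b ≤ C)
    (hadd : ∀ a b, a ⊓ b = ⊥ → ν (a ⊔ b) = ν a + ν b)
    (hnormal : ∀ (D : Set B) (s : B), D.Nonempty → DirectedOn (· ≤ ·) D → IsLUB D s →
      ∀ ε : ℝ, 0 < ε → ∃ d ∈ D, ν s < ν d + ε) :
    ∃ m : B → ℝ, IsNormalMeasure m ∧ ∀ b, ν b ≤ m b := by
  have h0 : ν ⊥ = 0 := by
    have := hadd ⊥ ⊥ (by simp)
    simpa using this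
  have hbdd : ∀ b, BddAbove (ν '' Set.Iic b) := fun b => ⟨C, by rintro _ ⟨q, -, rfl⟩; exact hC q⟩
  have hne : ∀ b, (ν '' Set.Iic b).Nonempty := fun b => ⟨_, ⊥, Set.mem_Iic.2 bot_le, rfl⟩
  have hle : ∀ b q, q ≤ b → ν q ≤ sSup (ν '' Set.Iic b) := fun b q hq =>
    le_csSup (hbdd b) ⟨q, hq, rfl⟩
  -- As for signed measures, the positive part at `b` is the supremum of `ν` over the elements below
  -- `b`.
  refine ⟨fun b => sSup (ν '' Set.Iic b), ⟨fun b => ?_, fun a b hab => le_antisymm ?_ ?_, ?_⟩,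
    fun b => hle b b le_rfl⟩
  · rw [← h0]
    exact hle b ⊥ bot_le
  · refine csSup_le (hne _) ?_
    rintro _ ⟨q, hq, rfl⟩
    have h1 : q = q ⊓ a ⊔ q ⊓ b := by rw [← inf_sup_left, inf_eq_left.2 hq]
    rw [h1, hadd _ _ (by rw [inf_inf_inf_comm, hab, inf_bot_eq])]
    exact add_le_add (hle a _ inf_le_right) (hle b _ inf_le_right)
  · rw [← le_sub_iff_add_le]
    refine csSup_le (hne _) ?_
    rintro _ ⟨q, hq, rfl⟩
    rw [le_sub_comm]
    refine csSup_le (hne _) ?_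
    rintro _ ⟨r, hr, rfl⟩
    rw [le_sub_iff_add_le, add_comm, ← hadd]
    · exact hle _ _ (sup_le_sup hq hr)
    · exact le_bot_iff.1 ((inf_le_inf hq hr).trans hab.le)
  · intro D s hDne hd hs ε hε
    -- Let `q ≤ s` nearly attain the supremum at `s`. The elements `d ⊓ q` increase to `q`, so `ν (d
    -- ⊓ q)` comes close to `ν q`, and it is at most the positive part at `d`.
    obtain ⟨_, ⟨q, hq, rfl⟩, hlt⟩ := exists_lt_of_lt_csSup (hne s)
      (show sSup (ν '' Set.Iic s) - ε / 2 < _ by linarith)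
    obtain ⟨_, ⟨d, hd', rfl⟩, h1⟩ := hnormal _ _ (hDne.image _) (directedOn_inf hd q)
      (isLUB_inf hs q) (ε / 2) (half_pos hε)
    refine ⟨d, hd', ?_⟩
    have h2 := hle d (d ⊓ q) inf_le_left
    rw [inf_eq_right.2 (Set.mem_Iic.1 hq)] at h1
    simp only at h1 ⊢
    linarith

/-! ### Dual spaces have sufficiently many normal functionals -/

/-- Order intervals are compact for the weak topology of a separating set of functionals. -/
def HasNormalFunctionals (B : Type u) [BooleanAlgebra B] : Prop :=
  ∃ Φ : Set (LinfObj B →ₗ[ℝ] ℝ), (∀ x, (∀ φ ∈ Φ, φ x = 0) → x = 0) ∧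
    (∀ φ ∈ Φ, ∃ C, ∀ b, |φ (chiL b)| ≤ C) ∧
    ∀ U : Ultrafilter (LinfObj B), Set.Icc 0 (LinfObj B).unit ∈ U →
      ∃ x, (∀ φ ∈ Φ, Tendsto φ U (𝓝 (φ x))) ∧ ∀ a b, Set.Icc a b ∈ U → x ∈ Set.Icc a b

/-- A directed set `D` in `B` has a weak limit `x` lying above `χ(D)` and below `χ` of every upper
bound of `D`. Such an `x` produces a supremum of `D`, so `B` is Dedekind complete; and `φ` comes
arbitrarily close to its value at the limit along `D`, so `φ` is normal. The positive parts of `±φ`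
are then normal measures, and separation by `Φ` provides enough of them. -/
theorem HasNormalFunctionals.isMcb (h : HasNormalFunctionals B) : IsMcb B := by
  obtain ⟨Φ, hsep, hbdd, hcomp⟩ := h
  have key : ∀ D : Set B, D.Nonempty → DirectedOn (· ≤ ·) D → ∃ x : LinfObj B,
      (∀ d ∈ D, chiL d ≤ x) ∧ (∀ c ∈ upperBounds D, x ≤ chiL c) ∧
      ∀ φ ∈ Φ, ∀ ε : ℝ, 0 < ε → ∃ d ∈ D, |φ (chiL d) - φ x| < ε := by
    intro D hne hd
    have := hne.to_subtype
    have : IsDirectedOrder D := ⟨fun a b => by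
      obtain ⟨c, hc, h1, h2⟩ := hd a a.2 b b.2
      exact ⟨⟨c, hc⟩, h1, h2⟩⟩
    let f : D → LinfObj B := fun d => chiL d.1
    -- This ultrafilter refines the filter of tails of `D`, so it contains every interval from
    -- `χ(d)` to `χ` of an upper bound.
    let U : Ultrafilter (LinfObj B) := (Ultrafilter.of (atTop : Filter D)).map f
    have hU : ∀ d ∈ D, ∀ c ∈ upperBounds D, Set.Icc (chiL d) (chiL c) ∈ U := by
      intro d hd c hc
      refine Ultrafilter.mem_map.2 (Ultrafilter.of_le _ ?_)
      filter_upwards [eventually_ge_atTop (⟨d, hd⟩ : D)] with e he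
      exact ⟨chiL_le_iff.2 he, chiL_le_iff.2 (hc e.2)⟩
    have htop : (⊤ : B) ∈ upperBounds D := fun _ _ => le_top
    obtain ⟨d₀, hd₀⟩ := hne
    obtain ⟨x, hx, hIcc⟩ := hcomp U (mem_of_superset (hU d₀ hd₀ ⊤ htop)
      (Set.Icc_subset_Icc_left (chiL_nonneg d₀)))
    refine ⟨x, fun d hd => (hIcc _ _ (hU d hd ⊤ htop)).1,
      fun c hc => (hIcc _ _ (hU d₀ hd₀ c hc)).2, fun φ hφ ε hε => ?_⟩
    have h1 := Metric.tendsto_nhds.1 (hx φ hφ) ε hε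
    have h2 : ∀ᶠ y in (U : Filter (LinfObj B)), y ∈ Set.range f :=
      Ultrafilter.mem_map.2 (univ_mem' fun d => ⟨d, rfl⟩)
    obtain ⟨_, h3, ⟨d, rfl⟩⟩ := (h1.and h2).exists
    exact ⟨d, d.2, h3⟩
  have hlub : ∀ (D : Set B) (s : B), D.Nonempty → DirectedOn (· ≤ ·) D → IsLUB D s →
      ∀ φ ∈ Φ, ∀ ε : ℝ, 0 < ε → ∃ d ∈ D, |φ (chiL d) - φ (chiL s)| < ε := by
    intro D s hne hd hs
    obtain ⟨x, h1, h2, h3⟩ := key D hne hd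
    -- The map `χ` preserves suprema, which identifies the weak limit when a supremum is already
    -- given.
    have : x = chiL s := le_antisymm (h2 s hs.1) ((isLUB_chiL hne hs).2 (by
      rintro _ ⟨d, hd, rfl⟩
      exact h1 d hd))
    rwa [this] at h3
  refine isMcb_of_normalMeasures (fun S _ _ => ?_) fun b hb => ?_
  · obtain ⟨x, h1, h2, -⟩ := key _ (finiteSups_nonempty S) (directedOn_finiteSups S)
    obtain ⟨s, hs⟩ := exists_isLUB_of_forall_chiL h1 h2
    exact ⟨s, isLUB_finiteSups.1 hs⟩
  · obtain ⟨φ, hφ, h0⟩ : ∃ φ ∈ Φ, φ (chiL b) ≠ 0 := by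
      by_contra hcon
      push Not at hcon
      refine hb (chiL_injective ?_)
      rw [hsep _ hcon, chiL_bot]
    obtain ⟨C, hC⟩ := hbdd φ hφ
    have hadd : ∀ a b : B, a ⊓ b = ⊥ → φ (chiL (a ⊔ b)) = φ (chiL a) + φ (chiL b) :=
      fun a b h => by rw [chiL_sup h, map_add]
    -- The sign of `φ (χ(b))` decides whether `-φ` or `φ` is used.
    rcases lt_or_gt_of_ne h0 with hlt | hgt
    · obtain ⟨m, hm, hle⟩ := exists_normalMeasure (ν := fun b => -φ (chiL b)) (C := C)
        (fun b => (neg_le_abs _).trans (hC b))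
        (fun a b h => by rw [hadd a b h, neg_add]) fun D s h1 h2 h3 ε hε => by
          obtain ⟨d, hd, h4⟩ := hlub D s h1 h2 h3 φ hφ ε hε
          exact ⟨d, hd, by linarith [(abs_lt.1 h4).2]⟩
      exact ⟨m, hm, (neg_pos.2 hlt).trans_le (hle b)⟩
    · obtain ⟨m, hm, hle⟩ := exists_normalMeasure (ν := fun b => φ (chiL b)) (C := C)
        (fun b => (le_abs_self _).trans (hC b)) hadd fun D s h1 h2 h3 ε hε => by
          obtain ⟨d, hd, h4⟩ := hlub D s h1 h2 h3 φ hφ ε hε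
          exact ⟨d, hd, by linarith [(abs_lt.1 h4).1]⟩
      exact ⟨m, hm, hgt.trans_le (hle b)⟩

end

end RieszBool

namespace RieszBool

/-! ### Weak-* limits in dual spaces -/

noncomputable section

open Filter Topology

variable {B : Type u} [BooleanAlgebra B]

/-- Bounded ultrafilters in a dual space converge for the weak-* topology, and the limit lies in
all the closed balls that belong to the ultrafilter. -/
theorem exists_weakStar_limit {𝕜 : Type*} [RCLike 𝕜] {V E : Type*} [AddCommGroup V] [Module 𝕜 V]
    [NormedAddCommGroup E] [NormedSpace 𝕜 E] (ψ : V ≃ₗ[𝕜] StrongDual 𝕜 E) (U : Ultrafilter V)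
    {R : ℝ} (hR : {v | ‖ψ v‖ ≤ R} ∈ U) :
    ∃ z, (∀ e, Tendsto (fun v => ψ v e) U (𝓝 (ψ z e))) ∧
      ∀ c r, {v | ‖ψ (v - c)‖ ≤ r} ∈ U → ‖ψ (z - c)‖ ≤ r := by
  -- Banach-Alaoglu.
  obtain ⟨w, -, hw⟩ := (WeakDual.isCompact_closedBall (𝕜 := 𝕜) (E := E) 0 R).ultrafilter_le_nhds
    (U.map fun v => StrongDual.toWeakDual (ψ v)) (by
      rw [le_principal_iff]
      refine Ultrafilter.mem_map.2 (mem_of_superset hR fun v hv => ?_)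
      simpa using hv)
  have hlim : ∀ e, Tendsto (fun v => ψ v e) U (𝓝 (ψ (ψ.symm (WeakDual.toStrongDual w)) e)) :=
    fun e => by
      rw [ψ.apply_symm_apply]
      exact ((WeakDual.eval_continuous (𝕜 := 𝕜) e).tendsto w).comp (tendsto_iff_comap.2
        (map_le_iff_le_comap.1 hw))
  refine ⟨_, hlim, fun c r hr => ?_⟩
  -- A set in the ultrafilter is inhabited, which forces `0 ≤ r`. The ball is then weak-* closed,
  -- being defined by the conditions `‖ψ (v - c) e‖ ≤ r * ‖e‖`.
  obtain ⟨v₀, hv₀⟩ := U.nonempty_of_mem hr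
  have hr0 : 0 ≤ r := (norm_nonneg _).trans hv₀
  refine ContinuousLinearMap.opNorm_le_bound _ hr0 fun e => ?_
  have h1 : Tendsto (fun v => ‖ψ (v - c) e‖) U
      (𝓝 ‖ψ (ψ.symm (WeakDual.toStrongDual w) - c) e‖) := by
    simp only [map_sub, _root_.sub_apply]
    exact ((hlim e).sub_const _).norm
  refine le_of_tendsto h1 (mem_of_superset hr fun v hv => ?_)
  exact (ContinuousLinearMap.le_opNorm _ _).trans
    (mul_le_mul_of_nonneg_right hv (norm_nonneg e))

/-- The values of the elements of the complexification of `L∞(B)`. -/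
def cpt (P : Point B) (z : Cplx (LinfObj B)) : ℂ := ⟨pt P z.re, pt P z.im⟩

theorem cpt_add (P : Point B) (z w : Cplx (LinfObj B)) : cpt P (z + w) = cpt P z + cpt P w :=
  Complex.ext (by simp [cpt]) (by simp [cpt])

theorem cpt_sub (P : Point B) (z w : Cplx (LinfObj B)) : cpt P (z - w) = cpt P z - cpt P w :=
  Complex.ext (by simp [cpt]) (by simp [cpt])

theorem cpt_smul (P : Point B) (c : ℂ) (z : Cplx (LinfObj B)) :
    cpt P (c • z) = c * cpt P z :=
  Complex.ext (by simp [cpt]) (by simp [cpt])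

theorem norm_eq_rotation (w : ℂ) : ∃ θ : ℝ, ‖w‖ = Real.cos θ * w.re + Real.sin θ * w.im := by
  refine ⟨w.arg, ?_⟩
  have h1 := Complex.norm_mul_cos_arg w
  have h2 := Complex.norm_mul_sin_arg w
  have h3 := Real.cos_sq_add_sin_sq w.arg
  rw [← h1, ← h2]
  calc ‖w‖ = ‖w‖ * (Real.cos w.arg ^ 2 + Real.sin w.arg ^ 2) := by rw [h3, mul_one]
    _ = _ := by
      rw [h1, h2]
      have h4 : w.re = ‖w‖ * Real.cos w.arg := h1.symm
      have h5 : w.im = ‖w‖ * Real.sin w.arg := h2.symm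
      rw [h4, h5]
      ring

theorem rotation_le_norm (w : ℂ) (θ : ℝ) : Real.cos θ * w.re + Real.sin θ * w.im ≤ ‖w‖ := by
  have h1 : Real.cos θ * w.re + Real.sin θ * w.im =
      (Complex.exp (-θ * Complex.I) * w).re := by
    rw [Complex.mul_re, ← Complex.ofReal_neg, Complex.exp_ofReal_mul_I_re,
      Complex.exp_ofReal_mul_I_im, Real.cos_neg, Real.sin_neg]
    ring
  rw [h1]
  refine (Complex.re_le_norm _).trans ?_
  rw [norm_mul, ← Complex.ofReal_neg, Complex.norm_exp_ofReal_mul_I, one_mul]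

/-- Evaluation at a point does not preserve arbitrary suprema, but the supremum over rotations runs
over a compact set and is within `ε` of a finite one. -/
theorem pt_modulus (P : Point B) (z : Cplx (LinfObj B)) : pt P z.modulus = ‖cpt P z‖ := by
  refine le_antisymm (le_of_forall_pos_le_add fun ε hε => ?_) ?_
  · obtain ⟨v, hv, happ⟩ := exists_isLUB_of_isCompact z.isCompact_rotations z.rotations_nonempty
    obtain rfl := z.isLUB_modulus.unique hv
    obtain ⟨F, hF, hFS, hle⟩ := happ ε hε
    refine (pt_mono P hle).trans ?_
    rw [map_add, map_smul, pt_unit, smul_eq_mul, mul_one, pt_finset_sup']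
    refine add_le_add (Finset.sup'_le _ _ fun x hx => ?_) le_rfl
    obtain ⟨θ, rfl⟩ := hFS hx
    simp only [id, map_add, map_smul, smul_eq_mul]
    exact rotation_le_norm (cpt P z) θ
  · obtain ⟨θ, hθ⟩ := norm_eq_rotation (cpt P z)
    rw [hθ]
    have := pt_mono P (z.isLUB_modulus.1 ⟨θ, rfl⟩)
    rw [map_add, map_smul, map_smul] at this
    exact this

theorem norm_modulus_le_iff {z : Cplx (LinfObj B)} {r : ℝ} (hr : 0 ≤ r) :
    ‖z.modulus‖ ≤ r ↔ ∀ P, ‖cpt P z‖ ≤ r := by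
  rw [norm_le_iff_pt hr]
  refine forall_congr' fun P => ?_
  rw [pt_modulus, abs_of_nonneg (norm_nonneg _)]

/-- An order interval is contained in balls that determine it. -/
theorem abs_sub_le_of_mem_Icc {a b t l : ℝ} (hl : b - a ≤ l) (ht : t ∈ Set.Icc a b) :
    |t - (a + l)| ≤ l ∧ |t - (b - l)| ≤ l :=
  ⟨abs_le.2 ⟨by linarith [ht.1], by linarith [ht.1, ht.2]⟩,
    abs_le.2 ⟨by linarith [ht.1, ht.2], by linarith [ht.2]⟩⟩

/-- The functionals are the evaluations at elements of the predual. Weak-* limits stay in closed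
balls, and for an order unit norm an order interval is an intersection of two balls. -/
theorem hasNormalFunctionals_of_isBanachDual (h : IsBanachDual (LinfObj B)) :
    HasNormalFunctionals B := by
  obtain ⟨E, _, _, _, ⟨ψ⟩⟩ := h
  refine ⟨Set.range fun e : E => (ContinuousLinearMap.apply ℝ ℝ e).toLinearMap ∘ₗ
    ψ.toLinearEquiv.toLinearMap, fun x hx => ?_, ?_, fun U hU => ?_⟩
  · have : ψ x = 0 := ContinuousLinearMap.ext fun e => hx _ ⟨e, rfl⟩
    rwa [map_eq_zero_iff ψ ψ.injective] at this
  · rintro _ ⟨e, rfl⟩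
    refine ⟨1 * ‖e‖, fun b => ?_⟩
    refine (ContinuousLinearMap.le_opNorm (ψ (chiL b)) e).trans
      (mul_le_mul_of_nonneg_right ?_ (norm_nonneg e))
    rw [ψ.norm_map, norm_le_iff_pt zero_le_one]
    intro P
    classical
    rw [pt_chiL]
    split_ifs <;> simp
  · have hball : ∀ (x c : LinfObj B) (r : ℝ), 0 ≤ r →
        (‖ψ.toLinearEquiv (x - c)‖ ≤ r ↔ ∀ P, |pt P x - pt P c| ≤ r) := fun x c r hr => by
      show ‖ψ (x - c)‖ ≤ r ↔ _
      rw [ψ.norm_map, norm_le_iff_pt hr]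
      simp only [map_sub]
    obtain ⟨z, hz, hzb⟩ := exists_weakStar_limit ψ.toLinearEquiv U (R := 1)
      (mem_of_superset hU fun x hx => by
        have := (hball x 0 1 zero_le_one).2 fun P => by
          have h1 := pt_mono P hx.1
          have h2 := pt_mono P hx.2
          rw [pt_unit] at h2
          rw [map_zero] at h1 ⊢
          rw [sub_zero, abs_of_nonneg h1]
          exact h2
        rwa [sub_zero] at this)
    refine ⟨z, ?_, fun a b hab => ?_⟩
    · rintro _ ⟨e, rfl⟩
      exact hz e
    -- The balls have radius `‖b - a‖` and centres `a + ‖b - a‖ e` and `b - ‖b - a‖ e`. Membership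
    -- in the first forces `a ≤ x`, in the second `x ≤ b`.
    · have hl := norm_nonneg (b - a)
      have hmem : ∀ x ∈ Set.Icc a b, ∀ P,
          |pt P x - (pt P a + ‖b - a‖)| ≤ ‖b - a‖ ∧ |pt P x - (pt P b - ‖b - a‖)| ≤ ‖b - a‖ :=
        fun x hx P => abs_sub_le_of_mem_Icc (by
          rw [← map_sub]
          exact (le_abs_self _).trans (abs_pt_le P _)) ⟨pt_mono P hx.1, pt_mono P hx.2⟩
      have h1 := hzb (a + ‖b - a‖ • (LinfObj B).unit) ‖b - a‖
        (mem_of_superset hab fun x hx => (hball _ _ _ hl).2 fun P => by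
          rw [map_add, map_smul, pt_unit, smul_eq_mul, mul_one]
          exact (hmem x hx P).1)
      have h2 := hzb (b - ‖b - a‖ • (LinfObj B).unit) ‖b - a‖
        (mem_of_superset hab fun x hx => (hball _ _ _ hl).2 fun P => by
          rw [map_sub, map_smul, pt_unit, smul_eq_mul, mul_one]
          exact (hmem x hx P).2)
      rw [hball _ _ _ hl] at h1 h2
      refine ⟨le_iff_pt.2 fun P => ?_, le_iff_pt.2 fun P => ?_⟩
      · have := h1 P
        rw [map_add, map_smul, pt_unit, smul_eq_mul, mul_one] at this
        linarith [(abs_le.1 this).1]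
      · have := h2 P
        rw [map_sub, map_smul, pt_unit, smul_eq_mul, mul_one] at this
        linarith [(abs_le.1 this).2]

/-- Expanding gives `y² + 2 y l ≤ 1`, which fails at `l = 1 / y`. This is used to show that a weak-*
limit of real elements is real. -/
theorem eq_zero_of_forall_sq_le {y : ℝ} (h : ∀ l : ℝ, (y + l) ^ 2 ≤ 1 + l ^ 2) : y = 0 := by
  by_contra hy
  have h1 := h (1 / y)
  have h2 : y * (1 / y) = 1 := mul_one_div_cancel hy
  nlinarith [sq_nonneg y]

/-- The real argument applies to the real parts of the evaluations. The additional point is that a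
weak-* limit of elements of the real interval `[0, e]` has no imaginary part. -/
theorem hasNormalFunctionals_of_isBanachDualC (h : IsBanachDualC ⟨LinfObj B⟩) :
    HasNormalFunctionals B := by
  obtain ⟨E, _, _, _, ψ, hψ⟩ := h
  change Cplx (LinfObj B) ≃ₗ[ℂ] StrongDual ℂ E at ψ
  change ∀ z : Cplx (LinfObj B), ‖ψ z‖ = ‖z.modulus‖ at hψ
  let φ : E → LinfObj B →ₗ[ℝ] ℝ := fun e =>
    { toFun := fun x => (ψ (Cplx.ofReal x) e).re
      map_add' := fun x y => by simp [Cplx.ofReal_add]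
      map_smul' := fun r x => by
        rw [Cplx.ofReal_smul, map_smul, _root_.smul_apply, smul_eq_mul,
          Complex.re_ofReal_mul]
        rfl }
  have hball : ∀ (z c : Cplx (LinfObj B)) (r : ℝ), 0 ≤ r →
      (‖ψ (z - c)‖ ≤ r ↔ ∀ P, ‖cpt P z - cpt P c‖ ≤ r) := fun z c r hr => by
    rw [hψ, norm_modulus_le_iff hr]
    simp only [cpt_sub]
  have hreal : ∀ (P : Point B) (x c : LinfObj B),
      ‖cpt P (Cplx.ofReal x) - cpt P (Cplx.ofReal c)‖ = |pt P x - pt P c| := fun P x c => by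
    rw [← cpt_sub, ← Cplx.ofReal_sub]
    have : cpt P (Cplx.ofReal (x - c)) = ((pt P x - pt P c : ℝ) : ℂ) :=
      Complex.ext (by simp [cpt, Cplx.ofReal]) (by simp [cpt, Cplx.ofReal])
    rw [this, Complex.norm_real, Real.norm_eq_abs]
  refine ⟨Set.range φ, fun x hx => ?_, ?_, fun U hU => ?_⟩
  · have : ψ (Cplx.ofReal x) = 0 := ContinuousLinearMap.ext fun e => Complex.ext (hx _ ⟨e, rfl⟩) (by
      -- Multiplying the argument by `-i` turns the imaginary part into a real part.
      have := hx _ ⟨-Complex.I • e, rfl⟩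
      simpa [φ] using this)
    rw [map_eq_zero_iff ψ ψ.injective] at this
    exact congrArg Cplx.re this
  · rintro _ ⟨e, rfl⟩
    refine ⟨1 * ‖e‖, fun b => ?_⟩
    refine (Complex.abs_re_le_norm _).trans
      ((ContinuousLinearMap.le_opNorm (ψ (Cplx.ofReal (chiL b))) e).trans
      (mul_le_mul_of_nonneg_right ?_ (norm_nonneg e)))
    rw [hψ, Cplx.modulus_ofReal, norm_le_iff_pt zero_le_one]
    intro P
    classical
    rw [pt_abs, pt_chiL]
    split_ifs <;> simp
  · obtain ⟨z, hz, hzb⟩ := exists_weakStar_limit ψ (U.map Cplx.ofReal) (R := 1)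
      (Ultrafilter.mem_map.2 <| mem_of_superset hU fun x hx => by
        have := (hball (Cplx.ofReal x) (Cplx.ofReal 0) 1 zero_le_one).2 fun P => by
          have h1 := pt_mono P hx.1
          have h2 := pt_mono P hx.2
          rw [pt_unit] at h2
          rw [hreal]
          rw [map_zero] at h1 ⊢
          rw [sub_zero, abs_of_nonneg h1]
          exact h2
        have h0 : (Cplx.ofReal 0 : Cplx (LinfObj B)) = 0 := rfl
        rwa [h0, sub_zero] at this)
    -- For every real `l` the interval `[0, e]` lies in the ball of radius `√(1 + l²)` about `-i l
    -- e`. An element of all these balls satisfies `(im + l)² ≤ 1 + l²` for all `l` at each point.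
    have him : z.im = 0 := by
      refine eq_zero_of_pt fun P => eq_zero_of_forall_sq_le fun l => ?_
      have h1 : ∀ (P : Point B) (w : Cplx (LinfObj B)),
          ‖cpt P w - cpt P ⟨0, (-l) • (LinfObj B).unit⟩‖ =
            √((pt P w.re) ^ 2 + (pt P w.im + l) ^ 2) := fun P w => by
        rw [Complex.norm_eq_sqrt_sq_add_sq]
        simp [cpt, pt_unit]
      have h2 := hzb ⟨0, (-l) • (LinfObj B).unit⟩ (√(1 + l ^ 2))
        (Ultrafilter.mem_map.2 <| mem_of_superset hU fun x hx => (hball _ _ _ (Real.sqrt_nonneg _)).2 fun P => by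
          rw [h1]
          have h3 := pt_mono P hx.1
          have h4 := pt_mono P hx.2
          rw [pt_unit] at h4
          rw [map_zero] at h3
          refine Real.sqrt_le_sqrt ?_
          simp only [Cplx.ofReal, map_zero, zero_add]
          nlinarith)
      rw [hball _ _ _ (Real.sqrt_nonneg _)] at h2
      have h3 := h2 P
      rw [h1, Real.sqrt_le_sqrt_iff (by positivity)] at h3
      nlinarith [sq_nonneg (pt P z.re)]
    have hzre : z = Cplx.ofReal z.re := Cplx.ext rfl him
    refine ⟨z.re, ?_, fun a b hab => ?_⟩
    · rintro _ ⟨e, rfl⟩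
      have h1 := hz e
      rw [hzre] at h1
      exact (Complex.continuous_re.tendsto _).comp h1
    · have hl := norm_nonneg (b - a)
      have hmem : ∀ x ∈ Set.Icc a b, ∀ P,
          |pt P x - (pt P a + ‖b - a‖)| ≤ ‖b - a‖ ∧ |pt P x - (pt P b - ‖b - a‖)| ≤ ‖b - a‖ :=
        fun x hx P => abs_sub_le_of_mem_Icc (by
          rw [← map_sub]
          exact (le_abs_self _).trans (abs_pt_le P _)) ⟨pt_mono P hx.1, pt_mono P hx.2⟩
      have h1 := hzb (Cplx.ofReal (a + ‖b - a‖ • (LinfObj B).unit)) ‖b - a‖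
        (Ultrafilter.mem_map.2 <| mem_of_superset hab fun x hx => (hball _ _ _ hl).2 fun P => by
          rw [hreal, map_add, map_smul, pt_unit, smul_eq_mul, mul_one]
          exact (hmem x hx P).1)
      have h2 := hzb (Cplx.ofReal (b - ‖b - a‖ • (LinfObj B).unit)) ‖b - a‖
        (Ultrafilter.mem_map.2 <| mem_of_superset hab fun x hx => (hball _ _ _ hl).2 fun P => by
          rw [hreal, map_sub, map_smul, pt_unit, smul_eq_mul, mul_one]
          exact (hmem x hx P).2)
      rw [hball _ _ _ hl, hzre] at h1 h2
      simp only [hreal] at h1 h2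
      refine ⟨le_iff_pt.2 fun P => ?_, le_iff_pt.2 fun P => ?_⟩
      · have := h1 P
        rw [map_add, map_smul, pt_unit, smul_eq_mul, mul_one] at this
        linarith [(abs_le.1 this).1]
      · have := h2 P
        rw [map_sub, map_smul, pt_unit, smul_eq_mul, mul_one] at this
        linarith [(abs_le.1 this).2]

end

end RieszBool

namespace RieszBool

/-! ### Semi-finite normal measures -/

noncomputable section

open Filter Topology

variable {B : Type u} [BooleanAlgebra B]

/-- A strictly positive semi-finite normal measure with values `M b` on the ideal `F` of
elements of finite measure. -/
structure IsSemifinite (F : Set B) (M : B → ℝ) : Prop where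
  of_le : ∀ p ∈ F, ∀ q ≤ p, q ∈ F
  normal : ∀ p ∈ F, IsNormalMeasure fun b => M (b ⊓ p)
  pos : ∀ p ∈ F, p ≠ ⊥ → 0 < M p
  exists_le : ∀ b, b ≠ ⊥ → ∃ p ∈ F, p ≤ b ∧ p ≠ ⊥

theorem partialSups_le_of_directedOn {α : Type*} [SemilatticeSup α] {D : Set α}
    (hd : DirectedOn (· ≤ ·) D) {e : ℕ → α} (he : ∀ n, e n ∈ D) (n : ℕ) :
    ∃ d ∈ D, partialSups e n ≤ d := by
  induction n with
  | zero => exact ⟨e 0, he 0, by simp⟩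
  | succ n ih =>
    obtain ⟨d, hd', h⟩ := ih
    obtain ⟨c, hc, h1, h2⟩ := hd d hd' (e (n + 1)) (he (n + 1))
    exact ⟨c, hc, by
      rw [partialSups_add_one]
      exact sup_le (h.trans h1) h2⟩

section Measure

variable {μ : B → ENNReal} (hbot : μ ⊥ = 0)
  (hμ : ∀ (x : ℕ → B) (s : B), (∀ i j, i ≠ j → x i ⊓ x j = ⊥) → IsLUB (Set.range x) s →
    μ s = ∑' i, μ (x i))

include hbot hμ

/-- Countable additivity is applied to `a, b, ⊥, ⊥, …`. -/
theorem measure_sup {a b : B} (hab : a ⊓ b = ⊥) : μ (a ⊔ b) = μ a + μ b := by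
  let x : ℕ → B := fun | 0 => a | 1 => b | _ + 2 => ⊥
  have hba : b ⊓ a = ⊥ := by rw [inf_comm, hab]
  have h1 := hμ x (a ⊔ b) (by
    rintro (_ | _ | i) (_ | _ | j) hij
    all_goals first | exact absurd rfl hij | exact hab | exact hba | exact bot_inf_eq _ |
      exact inf_bot_eq _) ⟨by
    rintro _ ⟨_ | _ | n, rfl⟩
    exacts [le_sup_left, le_sup_right, bot_le], fun c hc => sup_le (hc ⟨0, rfl⟩) (hc ⟨1, rfl⟩)⟩
  rw [h1, tsum_eq_sum (s := Finset.range 2) fun n hn => ?_]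
  · rw [Finset.sum_range_succ, Finset.sum_range_one]
  · obtain ⟨n, rfl⟩ := Nat.exists_eq_add_of_le' (not_lt.1 (mt Finset.mem_range.2 hn))
    exact hbot

theorem measure_mono {a b : B} (hab : a ≤ b) : μ a ≤ μ b := by
  have : b = a ⊔ b ⊓ aᶜ := by
    rw [sup_inf_left, sup_compl_eq_top, inf_top_eq, sup_eq_right.2 hab]
  rw [this, measure_sup hbot hμ (by rw [inf_left_comm, inf_compl_eq_bot, inf_bot_eq])]
  exact le_self_add

/-- Continuity from below: countable additivity is applied to the disjointed sequence, whose finite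
joins are the partial suprema. -/
theorem measure_le_of_partialSups {e : ℕ → B} {s p : B} (hs : IsLUB (Set.range e) s)
    {α : ENNReal} (h : ∀ n, μ (partialSups e n ⊓ p) ≤ α) : μ (s ⊓ p) ≤ α := by
  have hdisj : ∀ i j, i ≠ j → (disjointed e i ⊓ p) ⊓ (disjointed e j ⊓ p) = ⊥ := fun i j hij => by
    rw [inf_inf_inf_comm, (disjoint_disjointed e hij).eq_bot, bot_inf_eq]
  have hlub : IsLUB (Set.range fun i => disjointed e i ⊓ p) (s ⊓ p) := by
    have h1 : IsLUB (Set.range (disjointed e)) s := by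
      rwa [IsLUB, ← upperBounds_range_partialSups, partialSups_disjointed,
        upperBounds_range_partialSups]
    have := isLUB_inf h1 p
    rwa [← Set.range_comp] at this
  have hsum : ∀ n, ∑ i ∈ Finset.range (n + 1), μ (disjointed e i ⊓ p) =
      μ (partialSups e n ⊓ p) := fun n => by
    induction n with
    | zero => simp
    | succ n ih =>
      rw [Finset.sum_range_succ, ih, ← measure_sup hbot hμ, ← inf_sup_right,
        disjointed_add_one, sup_sdiff_self_right, partialSups_add_one]
      rw [disjointed_add_one, inf_inf_inf_comm, inf_sdiff_self_right, bot_inf_eq]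
  rw [hμ _ _ hdisj hlub, ENNReal.tsum_eq_iSup_nat]
  refine iSup_le fun n => ?_
  refine (Finset.sum_le_sum_of_subset (Finset.range_mono n.le_succ)).trans ?_
  rw [hsum]
  exact h n

/-- Strict positivity upgrades continuity along sequences to continuity along directed sets. A
sequence in `D` whose measures approach the supremum `α` has a join `t` that already contains every
`d ⊓ p`, hence also `s ⊓ p`. -/
theorem measure_normal (hB : DedekindComplete B) (hpos : ∀ x, x ≠ ⊥ → 0 < μ x) {p : B}
    (hp : μ p ≠ ⊤) {D : Set B} {s : B} (hne : D.Nonempty) (hd : DirectedOn (· ≤ ·) D)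
    (hs : IsLUB D s) : μ (s ⊓ p) ≤ ⨆ d ∈ D, μ (d ⊓ p) := by
  have hmono : ∀ {a b : B}, a ≤ b → μ a ≤ μ b := measure_mono hbot hμ
  set α := ⨆ d ∈ D, μ (d ⊓ p) with hα
  have hle : ∀ b, (∃ d ∈ D, b ≤ d) → μ (b ⊓ p) ≤ α := by
    rintro b ⟨d, hd, hbd⟩
    exact (hmono (inf_le_inf_right p hbd)).trans (le_iSup₂ (f := fun d (_ : d ∈ D) => μ (d ⊓ p)) d hd)
  have hα' : α ≠ ⊤ := ((iSup₂_le fun d _ => hmono inf_le_right).trans_lt hp.lt_top).ne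
  obtain ⟨w, -, hw, hwS⟩ := exists_seq_tendsto_sSup (hne.image fun d => μ (d ⊓ p))
    (OrderTop.bddAbove _)
  rw [sSup_image, ← hα] at hw
  choose e he hew using hwS
  obtain ⟨t, ht⟩ := hB (Set.range e) (Set.range_nonempty e) (OrderTop.bddAbove _)
  have hzero : ∀ d ∈ D, d ⊓ p ⊓ tᶜ = ⊥ := fun d hd' => by
    by_contra hcon
    -- A remainder of `d ⊓ p` outside `t` is disjoint from every `e n`, and both lie under a common
    -- member of `D`. In the limit its measure plus `α` is at most `α`; since `α` is finite and `μ`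
    -- is strictly positive, the remainder vanishes.
    have h1 : ∀ n, μ (d ⊓ p ⊓ tᶜ) + w n ≤ α := fun n => by
      rw [← hew n]
      show _ + μ (e n ⊓ p) ≤ α
      rw [← measure_sup hbot hμ]
      · obtain ⟨c, hc, hc1, hc2⟩ := hd d hd' (e n) (he n)
        refine le_trans (hmono ?_) (hle c ⟨c, hc, le_rfl⟩)
        exact sup_le (inf_le_left.trans (inf_le_inf_right p hc1)) (inf_le_inf_right p hc2)
      · refine le_bot_iff.1 ((inf_le_inf inf_le_right (inf_le_left.trans (ht.1 ⟨n, rfl⟩))).trans ?_)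
        rw [compl_inf_eq_bot]
    have h2 : μ (d ⊓ p ⊓ tᶜ) + α ≤ α := le_of_tendsto' (hw.const_add _) h1
    have h3 := ENNReal.lt_add_right hα' (hpos _ hcon).ne'
    rw [add_comm] at h3
    exact absurd h2 h3.not_ge
  have hst : s ⊓ p ≤ t := (isLUB_inf hs p).2 (by
    rintro _ ⟨d, hd, rfl⟩
    exact disjoint_compl_right_iff.1 (disjoint_iff.2 (hzero d hd)))
  exact (hmono (le_inf hst inf_le_right)).trans (measure_le_of_partialSups hbot hμ ht fun n =>
    hle _ (partialSups_le_of_directedOn hd he n))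

theorem isSemifinite_of_measure (hB : DedekindComplete B) (hpos : ∀ x, x ≠ ⊥ → 0 < μ x)
    (hfin : ∀ x, μ x = ⊤ → ∃ y, y ≤ x ∧ 0 < μ y ∧ μ y < ⊤) :
    IsSemifinite {p | μ p ≠ ⊤} fun p => (μ p).toReal := by
  have hmono : ∀ {a b : B}, a ≤ b → μ a ≤ μ b := measure_mono hbot hμ
  have hlt : ∀ {p : B}, μ p ≠ ⊤ → ∀ b, μ (b ⊓ p) ≠ ⊤ := fun hp b =>
    ((hmono inf_le_right).trans_lt hp.lt_top).ne
  refine ⟨fun p hp q hq => ((hmono hq).trans_lt (Ne.lt_top hp)).ne, fun p hp => ⟨fun b =>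
    ENNReal.toReal_nonneg, fun a b hab => ?_, fun D s hne hd hs ε hε => ?_⟩, fun p hp hp0 =>
    ENNReal.toReal_pos (hpos p hp0).ne' hp, fun b hb => ?_⟩
  · rw [inf_sup_right, measure_sup hbot hμ, ENNReal.toReal_add (hlt hp a) (hlt hp b)]
    rw [inf_inf_inf_comm, hab, bot_inf_eq]
  · by_contra hcon
    push Not at hcon
    obtain ⟨d₀, hd₀⟩ := hne
    have h1 : μ (s ⊓ p) ≤ ENNReal.ofReal ((μ (s ⊓ p)).toReal - ε) :=
      (measure_normal hbot hμ hB hpos hp ⟨d₀, hd₀⟩ hd hs).trans (iSup₂_le fun d hd => by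
        rw [← ENNReal.ofReal_toReal (hlt hp d)]
        exact ENNReal.ofReal_le_ofReal (by linarith [hcon d hd]))
    -- Without this bound `ENNReal.ofReal` would truncate the difference to zero.
    have h2 : 0 ≤ (μ (s ⊓ p)).toReal - ε := by
      have : 0 ≤ (μ (d₀ ⊓ p)).toReal := ENNReal.toReal_nonneg
      linarith [hcon d₀ hd₀]
    have h3 := ENNReal.toReal_mono ENNReal.ofReal_ne_top h1
    rw [ENNReal.toReal_ofReal h2] at h3
    linarith
  · by_cases hbt : μ b = ⊤
    · obtain ⟨y, hy, h0, h1⟩ := hfin b hbt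
      refine ⟨y, h1.ne, hy, ?_⟩
      rintro rfl
      exact h0.ne' hbot
    · exact ⟨b, hbt, le_rfl, hb⟩

end Measure

/-! ### Integration -/

/-- Continuous functionals on `L∞(B)` are determined by their values on the elements of `B`. -/
theorem clm_ext {f g : LinfObj B →L[ℝ] ℝ} (h : ∀ b, f (chiL b) = g (chiL b)) : f = g := by
  refine ContinuousLinearMap.ext fun x => denseRange_incl.induction_on
    (p := fun x => f x = g x) x (isClosed_eq f.continuous g.continuous) fun v => ?_
  induction v using Simple.induction with
  | zero => simp
  | add v r b ih =>
    rw [map_add, map_smul, map_add, map_add, map_smul, map_smul, ih]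
    exact congrArg _ (congrArg _ (h b))

namespace IsNormalMeasure

variable {m : B → ℝ}

/-- The integral of a simple function. -/
def simpleIntegral (hm : IsNormalMeasure m) : Simple B →ₗ[ℝ] ℝ :=
  (addRel B).liftQ (Finsupp.linearCombination ℝ m) (by
    rw [addRel, Submodule.span_le]
    rintro _ ⟨x, y, h, rfl⟩
    simp [hm.map_sup x y h])

theorem simpleIntegral_mk (hm : IsNormalMeasure m) (c : B →₀ ℝ) :
    hm.simpleIntegral (Simple.mk B c) = c.sum fun b r => r * m b :=
  ((addRel B).liftQ_apply _ _).trans (Finsupp.linearCombination_apply ℝ c)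

theorem simpleIntegral_chi (hm : IsNormalMeasure m) (b : B) :
    hm.simpleIntegral (Simple.chi b) = m b := by
  rw [Simple.chi, simpleIntegral_mk]
  simp

theorem simpleIntegral_mono (hm : IsNormalMeasure m) {v w : Simple B} (h : v ≤ w) :
    hm.simpleIntegral v ≤ hm.simpleIntegral w := by
  obtain ⟨c, hc, hcv⟩ := Simple.le_def.1 h
  rw [← sub_nonneg, ← map_sub, ← hcv, simpleIntegral_mk]
  exact Finset.sum_nonneg fun b _ => mul_nonneg (hc b) (hm.nonneg b)

theorem abs_simpleIntegral_le (hm : IsNormalMeasure m) (v : Simple B) :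
    |hm.simpleIntegral v| ≤ m ⊤ * ‖v‖ := by
  have h := abs_le'.1 (Simple.abs_le_norm_smul v)
  have h1 := hm.simpleIntegral_mono h.1
  have h2 := hm.simpleIntegral_mono h.2
  rw [map_smul, simpleIntegral_chi, smul_eq_mul, mul_comm] at h1 h2
  rw [map_neg] at h2
  exact abs_le'.2 ⟨h1, h2⟩

/-- The integral with respect to a normal measure. -/
def integral (hm : IsNormalMeasure m) : LinfObj B →L[ℝ] ℝ :=
  extendL (hm.simpleIntegral.mkContinuous (m ⊤) hm.abs_simpleIntegral_le)

theorem integral_incl (hm : IsNormalMeasure m) (v : Simple B) :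
    hm.integral (incl v) = hm.simpleIntegral v := extendL_incl _ v

theorem integral_chiL (hm : IsNormalMeasure m) (b : B) : hm.integral (chiL b) = m b := by
  rw [chiL, integral_incl, simpleIntegral_chi]

/-- Approximants of a positive element need not be positive, but their moduli are. As `x ↦ |x|` is
continuous, positivity of the integral of `|x|` passes to the completion. -/
theorem integral_nonneg (hm : IsNormalMeasure m) {x : LinfObj B} (hx : 0 ≤ x) :
    0 ≤ hm.integral x := by
  have hc : Continuous fun x : LinfObj B => |x| := continuous_sup' continuous_id continuous_neg
  have : ∀ x : LinfObj B, 0 ≤ hm.integral |x| := fun x =>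
    denseRange_incl.induction_on (p := fun x => 0 ≤ hm.integral |x|) x
      (isClosed_le continuous_const (hm.integral.continuous.comp hc)) fun v => by
        rw [← incl_abs, integral_incl, ← map_zero hm.simpleIntegral]
        exact hm.simpleIntegral_mono (abs_nonneg v)
  have h := this x
  rwa [abs_of_nonneg hx] at h

end IsNormalMeasure

namespace IsSemifinite

variable {F : Set B} {M : B → ℝ} (hM : IsSemifinite F M)

include hM

theorem map_bot {p : B} (hp : p ∈ F) : M ⊥ = 0 := by
  have := (hM.normal p hp).map_bot
  rwa [bot_inf_eq] at this

theorem nonneg {p : B} (hp : p ∈ F) : 0 ≤ M p := by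
  have := (hM.normal p hp).nonneg p
  rwa [inf_idem] at this

theorem inf_mem {p : B} (hp : p ∈ F) (b : B) : p ⊓ b ∈ F := hM.of_le p hp _ inf_le_left

theorem map_eq_add {p : B} (hp : p ∈ F) (b : B) : M p = M (p ⊓ b) + M (p ⊓ bᶜ) := by
  have := (hM.normal p hp).map_eq_add p b
  simp only [inf_idem] at this
  rwa [inf_eq_left.2 (inf_le_left : p ⊓ b ≤ p), inf_eq_left.2 (inf_le_left : p ⊓ bᶜ ≤ p)] at this

open Classical in
/-- The integral over `p`, or zero if `p` has infinite measure. -/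
def setIntegral (p : B) : LinfObj B →L[ℝ] ℝ :=
  if hp : p ∈ F then (hM.normal p hp).integral else 0

theorem setIntegral_of_notMem {p : B} (hp : p ∉ F) : hM.setIntegral p = 0 := dif_neg hp

theorem setIntegral_chiL {p : B} (hp : p ∈ F) (b : B) :
    hM.setIntegral p (chiL b) = M (b ⊓ p) := by
  rw [setIntegral, dif_pos hp]
  exact (hM.normal p hp).integral_chiL b

theorem setIntegral_unit {p : B} (hp : p ∈ F) : hM.setIntegral p (LinfObj B).unit = M p := by
  rw [unit_eq, hM.setIntegral_chiL hp, top_inf_eq]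

/-- The integral over `p` ignores `χ(pᶜ)`, so adding a large multiple of it makes `y - x` positive
everywhere without changing the integral. -/
theorem setIntegral_mono {p : B} (hp : p ∈ F) {x y : LinfObj B}
    (h : ∀ P : Point B, P p → pt P x ≤ pt P y) : hM.setIntegral p x ≤ hM.setIntegral p y := by
  have h1 : 0 ≤ y - x + ‖y - x‖ • chiL pᶜ := le_iff_pt.2 fun P => by
    rw [map_zero, map_add, map_smul, smul_eq_mul]
    by_cases hP : P p
    · rw [pt_chiL_of_not P (by rwa [P.compl_iff, not_not]), mul_zero, add_zero, map_sub]
      exact sub_nonneg.2 (h P hP)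
    · rw [pt_chiL_of P ((P.compl_iff p).2 hP), mul_one]
      linarith [(abs_le.1 (abs_pt_le P (y - x))).1]
  have h2 : 0 ≤ hM.setIntegral p (y - x + ‖y - x‖ • chiL pᶜ) := by
    rw [setIntegral, dif_pos hp]
    exact (hM.normal p hp).integral_nonneg h1
  rw [map_add, map_smul, hM.setIntegral_chiL hp, compl_inf_eq_bot, hM.map_bot hp, smul_zero,
    add_zero, map_sub] at h2
  exact sub_nonneg.1 h2

theorem setIntegral_eq_add {p : B} (hp : p ∈ F) (b : B) :
    hM.setIntegral p = hM.setIntegral (p ⊓ b) + hM.setIntegral (p ⊓ bᶜ) := clm_ext fun a => by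
  rw [_root_.add_apply, hM.setIntegral_chiL hp, hM.setIntegral_chiL (hM.inf_mem hp b),
    hM.setIntegral_chiL (hM.inf_mem hp bᶜ), hM.map_eq_add (hM.of_le p hp _ inf_le_right) b,
    inf_assoc, inf_assoc]

theorem abs_setIntegral_le {p : B} (hp : p ∈ F) (x : LinfObj B) :
    |hM.setIntegral p x| ≤ M p * ‖x‖ := by
  have h1 : hM.setIntegral p x ≤ hM.setIntegral p (‖x‖ • (LinfObj B).unit) :=
    hM.setIntegral_mono hp fun P _ => pt_mono P (MISpace.le_norm_smul x)
  have h2 : hM.setIntegral p (-x) ≤ hM.setIntegral p (‖x‖ • (LinfObj B).unit) :=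
    hM.setIntegral_mono hp fun P _ => pt_mono P ((neg_le_abs x).trans (MISpace.abs_le_norm_smul x))
  rw [map_smul, hM.setIntegral_unit hp, smul_eq_mul, mul_comm] at h1 h2
  rw [map_neg] at h2
  exact abs_le'.2 ⟨h1, h2⟩

/-- The norm is determined by integrals. -/
theorem exists_lt_setIntegral {x : LinfObj B} {P : Point B} {r : ℝ} (h : r < pt P x) :
    ∃ p ∈ F, 0 < M p ∧ r * M p ≤ hM.setIntegral p x := by
  obtain ⟨t, hrt, htx⟩ := exists_between h
  obtain ⟨b, hb⟩ := exists_cut x hrt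
  have hPb : P b := by
    by_contra hPb
    linarith [(hb P).2 hPb]
  -- Semi-finiteness puts a nonzero element of finite measure inside a region where `x ≥ r`.
  obtain ⟨p, hp, hpb, hp0⟩ := hM.exists_le b fun h0 => P.not_bot (h0 ▸ hPb)
  refine ⟨p, hp, hM.pos p hp hp0, ?_⟩
  have := hM.setIntegral_mono hp (x := r • (LinfObj B).unit) (y := x) fun Q hQ => by
    rw [map_smul, pt_unit, smul_eq_mul, mul_one]
    exact (hb Q).1 (Q.mono hpb hQ)
  rwa [map_smul, hM.setIntegral_unit hp, smul_eq_mul] at this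

end IsSemifinite

end

end RieszBool

namespace RieszBool

/-! ### Densities and preduals -/

noncomputable section

open Filter Topology

variable {B : Type u} [BooleanAlgebra B]

namespace IsSemifinite

variable {F : Set B} {M : B → ℝ} (hM : IsSemifinite F M)

include hM

/-- The Hahn decomposition. -/
theorem exists_nonneg_below (hB : DedekindComplete B) {ν : B → ℝ}
    (hν : ∀ p ∈ F, ∀ b, ν p = ν (p ⊓ b) + ν (p ⊓ bᶜ)) {C : ℝ} (hC : ∀ p ∈ F, |ν p| ≤ C * M p)
    {p : B} (hp : p ∈ F) (h : 0 < ν p) : ∃ q ∈ F, q ≠ ⊥ ∧ ∀ r ≤ q, 0 ≤ ν r := by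
  have hbF : ⊥ ∈ F := hM.of_le p hp _ bot_le
  have hbot : ν ⊥ = 0 := by
    have := hν ⊥ hbF ⊥
    simpa using this
  have hC0 : 0 ≤ C := by
    have hpos : 0 < M p := hM.pos p hp fun h0 => by
      rw [h0, hbot] at h
      exact lt_irrefl _ h
    by_contra hcon
    have := h.trans_le ((le_abs_self _).trans (hC p hp))
    exact absurd this (mul_neg_of_neg_of_pos (not_le.1 hcon) hpos).not_gt
  -- Choose `r ≤ p` maximal with `ν r ≤ 0`; the sought element is `p ⊓ rᶜ`. Chains are bounded
  -- because `ν` is dominated by `M`, which is continuous along them.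
  obtain ⟨r, -, hr⟩ := zorn_le_nonempty₀ {r : B | r ≤ p ∧ ν r ≤ 0} (by
    intro c hc hchain y hy
    obtain ⟨s, hs⟩ := hB c ⟨y, hy⟩ (OrderTop.bddAbove c)
    have hsp : s ≤ p := hs.2 fun d hd => (hc hd).1
    refine ⟨s, ⟨hsp, le_of_forall_pos_le_add fun ε hε => ?_⟩, hs.1⟩
    -- The denominator is `C + 1` because `C` may be zero.
    have hε' : 0 < ε / (C + 1) := by positivity
    obtain ⟨d, hd, hlt⟩ := (hM.normal p hp).normal c s ⟨y, hy⟩ hchain.directedOn hs _ hε'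
    have hsF := hM.of_le p hp s hsp
    rw [inf_eq_left.2 hsp, inf_eq_left.2 (hc hd).1, hM.map_eq_add hsF d,
      inf_eq_right.2 (hs.1 hd), add_lt_add_iff_left] at hlt
    have h1 := (le_abs_self _).trans (hC _ (hM.inf_mem hsF dᶜ))
    have h2 : C * M (s ⊓ dᶜ) ≤ ε := (mul_le_mul_of_nonneg_left hlt.le hC0).trans (by
      rw [mul_div_assoc', div_le_iff₀ (by positivity)]
      nlinarith)
    rw [hν s hsF d, inf_eq_right.2 (hs.1 hd)]
    linarith [(hc hd).2]) ⊥ ⟨bot_le, hbot.le⟩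
  have hsplit := hν p hp r
  rw [inf_eq_right.2 hr.prop.1] at hsplit
  refine ⟨p ⊓ rᶜ, hM.inf_mem hp _, fun h0 => ?_, fun t ht => ?_⟩
  · rw [h0, hbot] at hsplit
    linarith [hr.prop.2]
  -- An element `t` of negative `ν` below `p ⊓ rᶜ` could be joined to `r`, against maximality.
  · by_contra hcon
    rw [not_le] at hcon
    have htr : t ⊓ r = ⊥ := le_bot_iff.1 ((inf_le_inf_right r (ht.trans inf_le_right)).trans
      compl_inf_eq_bot.le)
    have htp : r ⊔ t ≤ p := sup_le hr.prop.1 (ht.trans inf_le_left)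
    have h1 := hν (r ⊔ t) (hM.of_le p hp _ htp) r
    rw [inf_eq_right.2 le_sup_left, inf_sup_right, inf_compl_eq_bot, bot_sup_eq,
      inf_eq_left.2 (ht.trans inf_le_right)] at h1
    have h2 : t ≤ r := le_sup_right.trans
      (hr.le_of_ge (y := r ⊔ t) ⟨htp, by linarith [hr.prop.2]⟩ le_sup_left)
    rw [inf_eq_left.2 h2] at htr
    rw [htr, hbot] at hcon
    exact lt_irrefl _ hcon

/-- The Radon-Nikodym theorem. -/
theorem exists_density (hB : DedekindComplete B) {ν : B → ℝ}
    (hν : ∀ p ∈ F, ∀ b, ν p = ν (p ⊓ b) + ν (p ⊓ bᶜ)) {C : ℝ} (hC : ∀ p ∈ F, |ν p| ≤ C * M p) :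
    ∃ x, ∀ p ∈ F, hM.setIntegral p x = ν p := by
  -- The density will be the largest element whose integrals do not exceed `ν`.
  let A : Set (LinfObj B) := {y | ∀ p ∈ F, hM.setIntegral p y ≤ ν p}
  have hne : A.Nonempty := ⟨(-C) • (LinfObj B).unit, fun p hp => by
    rw [map_smul, hM.setIntegral_unit hp, smul_eq_mul]
    linarith [(abs_le.1 (hC p hp)).1]⟩
  have hbdd : BddAbove A := ⟨C • (LinfObj B).unit, fun y hy => le_iff_pt.2 fun P => by
    rw [map_smul, pt_unit, smul_eq_mul, mul_one]
    by_contra hcon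
    rw [not_le] at hcon
    obtain ⟨t, hCt, hty⟩ := exists_between hcon
    obtain ⟨p, hp, hp0, h⟩ := hM.exists_lt_setIntegral hty
    have h1 := (le_abs_self _).trans (hC p hp)
    have h2 := hy p hp
    exact absurd ((h.trans h2).trans h1) (mul_lt_mul_of_pos_right hCt hp0).not_ge⟩
  -- Cutting `w - y` between `-δ` and 0 splits `p` into a part where `y ⊔ w ≤ w + δ` and a part
  -- where `y ⊔ w = y`. Thus `A` is directed up to no loss, as `δ` is arbitrary.
  have hsup : ∀ y ∈ A, ∀ w ∈ A, y ⊔ w ∈ A := fun y hy w hw p hp => by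
    refine le_of_forall_pos_le_add fun ε hε => ?_
    have hMp := hM.nonneg hp
    have hδ : 0 < ε / (M p + 1) := by positivity
    set δ := ε / (M p + 1) with hδ'
    obtain ⟨b, hb⟩ := exists_cut (w - y) (neg_neg_iff_pos.2 hδ)
    simp only [map_sub] at hb
    have hpb := hM.inf_mem hp b
    have hpc := hM.inf_mem hp bᶜ
    have h1 : hM.setIntegral (p ⊓ b) (y ⊔ w) ≤
        hM.setIntegral (p ⊓ b) (w + δ • (LinfObj B).unit) :=
      hM.setIntegral_mono hpb fun P hP => by
        rw [pt_sup, map_add, map_smul, pt_unit, smul_eq_mul, mul_one]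
        exact max_le (by linarith [(hb P).1 (P.mono inf_le_right hP)]) (by linarith)
    have h2 : hM.setIntegral (p ⊓ bᶜ) (y ⊔ w) ≤ hM.setIntegral (p ⊓ bᶜ) y :=
      hM.setIntegral_mono hpc fun P hP => by
        rw [pt_sup]
        exact max_le le_rfl (by
          linarith [(hb P).2 ((P.compl_iff b).1 (P.mono inf_le_right hP))])
    rw [map_add, map_smul, hM.setIntegral_unit hpb, smul_eq_mul] at h1
    have h3 : δ * M (p ⊓ b) ≤ ε := by
      have h4 : M (p ⊓ b) ≤ M p + 1 := by
        have := hM.map_eq_add hp b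
        have := hM.nonneg hpc
        linarith
      calc δ * M (p ⊓ b) ≤ δ * (M p + 1) := mul_le_mul_of_nonneg_left h4 hδ.le
        _ = ε := div_mul_cancel₀ _ (by positivity)
    rw [hM.setIntegral_eq_add hp b, _root_.add_apply, hν p hp b]
    linarith [hw _ hpb, hy _ hpc]
  obtain ⟨x, hx⟩ := dedekindComplete_linf_iff.2 hB A hne hbdd
  -- Monotone convergence: `exists_squeeze` bounds `x - y` by a small constant plus a multiple of
  -- `χ(c)`, and normality makes `M (c ⊓ p)` small.
  have hxA : x ∈ A := fun p hp => by
    refine le_of_forall_pos_le_add fun ε hε => ?_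
    have hMp := hM.nonneg hp
    obtain ⟨K, D, hK, hDne, hDd, hD, happ⟩ := exists_squeeze hne
      (fun y hy w hw => ⟨_, hsup y hy w hw, le_sup_left, le_sup_right⟩) hx
      (show 0 < ε / (2 * (M p + 1)) by positivity)
    obtain ⟨c, hc, hlt⟩ := (hM.normal p hp).exists_lt_of_isGLB hDne hDd hD
      (show 0 < ε / (2 * (K + 1)) by positivity)
    obtain ⟨y, hy, hxy⟩ := happ c hc
    have h1 := hM.setIntegral_mono hp fun P _ => pt_mono P hxy
    rw [map_sub, map_add, map_smul, map_smul, hM.setIntegral_unit hp, hM.setIntegral_chiL hp,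
      smul_eq_mul, smul_eq_mul] at h1
    have h2 : K * M (c ⊓ p) ≤ ε / 2 := by
      rw [lt_div_iff₀ (by positivity)] at hlt
      have := (hM.normal p hp).nonneg c
      nlinarith
    have h3 : ε / (2 * (M p + 1)) * M p ≤ ε / 2 := by
      rw [div_mul_eq_mul_div, div_le_div_iff₀ (by positivity) two_pos]
      nlinarith
    linarith [hy p hp]
  refine ⟨x, fun p hp => le_antisymm (hxA p hp) ?_⟩
  refine le_of_forall_pos_le_add fun ε hε => ?_
  by_contra hcon
  rw [not_le] at hcon
  have hMp := hM.nonneg hp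
  have hδ : 0 < ε / (M p + 1) := by positivity
  set δ := ε / (M p + 1) with hδ'
  have hδM : δ * M p ≤ ε := by
    calc δ * M p ≤ δ * (M p + 1) := mul_le_mul_of_nonneg_left (by linarith) hδ.le
      _ = ε := div_mul_cancel₀ _ (by positivity)
  -- If `ν` exceeds the integral of `x` over `p` by more than `ε ≥ δ * M p`, the Hahn decomposition
  -- of `ν - ∫ x - δ M` yields a nonzero `q` below which this difference is nonnegative. Then `x + δ
  -- χ(q)` is still in `A`, although `x` bounds `A`.
  obtain ⟨q, hq, hq0, hqle⟩ := hM.exists_nonneg_below hB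
    (ν := fun r => ν r - hM.setIntegral r x - δ * M r) (C := C + ‖x‖ + δ) (fun r hr b => by
      rw [hν r hr b, hM.setIntegral_eq_add hr b, _root_.add_apply, hM.map_eq_add hr b]
      ring) (fun r hr => by
      have h1 := hM.abs_setIntegral_le hr x
      have h2 := hC r hr
      have h3 := hM.nonneg hr
      calc |ν r - hM.setIntegral r x - δ * M r|
          ≤ |ν r| + |hM.setIntegral r x| + |δ * M r| :=
            (abs_sub _ _).trans (add_le_add_left (abs_sub _ _) _)
        _ ≤ _ := by
          rw [abs_of_nonneg (mul_nonneg hδ.le h3)]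
          linarith) hp (by linarith)
  have hmem : x + δ • chiL q ∈ A := fun r hr => by
    have hrq := hM.inf_mem hr q
    have hrc := hM.inf_mem hr qᶜ
    have h1 := hqle (r ⊓ q) inf_le_right
    have h2 := hxA _ hrc
    rw [map_add, map_smul, hM.setIntegral_chiL hr, smul_eq_mul, hM.setIntegral_eq_add hr q,
      _root_.add_apply, hν r hr q, inf_comm q r]
    linarith
  refine hq0 (chiL_injective ?_)
  have h1 : δ • chiL q ≤ 0 := by
    have := hx.1 hmem
    rwa [add_le_iff_nonpos_right] at this
  rw [chiL_bot]
  refine le_antisymm (le_iff_pt.2 fun P => ?_) (chiL_nonneg q)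
  have h2 := pt_mono P h1
  rw [map_smul, map_zero, smul_eq_mul] at h2
  rw [map_zero]
  exact nonpos_of_mul_nonpos_right h2 hδ

theorem norm_setIntegral_le {p : B} (hp : p ∈ F) : ‖hM.setIntegral p‖ ≤ M p :=
  ContinuousLinearMap.opNorm_le_bound _ (hM.nonneg hp) fun x => hM.abs_setIntegral_le hp x

end IsSemifinite

/-- A space that is paired with a Banach space `W` is a dual space if `W` has a norming subset and
the functionals on the span of this set come from the pairing. -/
theorem exists_predual_of_pairing {𝕜 : Type} [RCLike 𝕜] {V W : Type u} [NormedAddCommGroup V]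
    [NormedSpace 𝕜 V] [NormedAddCommGroup W] [NormedSpace 𝕜 W] [CompleteSpace W] {ι : Type*}
    (I : ι → W) (T : V →ₗ[𝕜] StrongDual 𝕜 W) (hT : ∀ v, ‖T v‖ ≤ ‖v‖)
    (hnorm : ∀ v r, 0 ≤ r → r < ‖v‖ → ∃ i c, 0 < c ∧ ‖I i‖ ≤ c ∧ r * c ≤ ‖T v (I i)‖)
    (hrep : ∀ (E : Submodule 𝕜 W) (hI : ∀ i, I i ∈ E) (Λ : StrongDual 𝕜 E),
      ∃ v, ∀ i, Λ ⟨I i, hI i⟩ = T v (I i)) :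
    ∃ (E : Type u) (_ : NormedAddCommGroup E) (_ : NormedSpace 𝕜 E) (_ : CompleteSpace E)
      (φ : V ≃ₗ[𝕜] StrongDual 𝕜 E), ∀ v, ‖φ v‖ = ‖v‖ := by
  -- The predual is the closed span of the norming family.
  let E : Submodule 𝕜 W := (Submodule.span 𝕜 (Set.range I)).topologicalClosure
  have hI : ∀ i, I i ∈ E := fun i =>
    Submodule.le_topologicalClosure _ (Submodule.subset_span ⟨i, rfl⟩)
  have hE : IsClosed (E : Set W) := Submodule.isClosed_topologicalClosure _
  have hcomp : CompleteSpace E := hE.completeSpace_coe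
  let J : V →ₗ[𝕜] StrongDual 𝕜 E :=
    { toFun := fun v => (T v).comp E.subtypeL
      map_add' := fun v w => by rw [map_add]; rfl
      map_smul' := fun c v => by rw [map_smul]; rfl }
  have hJ : ∀ v (f : E), J v f = T v f := fun _ _ => rfl
  have hJnorm : ∀ v, ‖J v‖ = ‖v‖ := fun v => by
    refine le_antisymm (ContinuousLinearMap.opNorm_le_bound _ (norm_nonneg v) fun f => ?_) ?_
    · exact ((T v).le_opNorm f).trans (mul_le_mul_of_nonneg_right (hT v) (norm_nonneg _))
    · refine le_of_forall_lt fun r hr => ?_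
      rcases lt_or_ge r 0 with h0 | h0
      · exact h0.trans_le (norm_nonneg _)
      obtain ⟨s, hrs, hsv⟩ := exists_between hr
      obtain ⟨i, c, hc, hIc, hle⟩ := hnorm v s (h0.trans hrs.le) hsv
      refine hrs.trans_le (le_of_mul_le_mul_right (hle.trans ?_) hc)
      exact ((J v).le_opNorm ⟨I i, hI i⟩).trans (mul_le_mul_of_nonneg_left hIc (norm_nonneg _))
  refine ⟨E, inferInstance, inferInstance, hcomp, LinearEquiv.ofBijective J ⟨?_, fun Λ => ?_⟩,
    hJnorm⟩
  · refine (injective_iff_map_eq_zero J).2 fun v hv => ?_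
    rw [← norm_eq_zero, ← hJnorm, hv, norm_zero]
  · obtain ⟨v, hv⟩ := hrep E hI Λ
    refine ⟨v, ?_⟩
    -- The set where `J v` and `Λ` agree is a closed subspace containing all `I i`, hence all of
    -- `E`.
    have hker : IsClosed ((Submodule.map E.subtype (J v - Λ).ker : Submodule 𝕜 _) : Set W) := by
      rw [Submodule.map_coe]
      exact hE.isClosedEmbedding_subtypeVal.isClosedMap _ (J v - Λ).isClosed_ker
    have hle : E ≤ Submodule.map E.subtype (J v - Λ).ker := by
      refine Submodule.topologicalClosure_minimal _ (Submodule.span_le.2 ?_) hker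
      rintro _ ⟨i, rfl⟩
      refine ⟨⟨I i, hI i⟩, ?_, rfl⟩
      show J v ⟨I i, hI i⟩ - Λ ⟨I i, hI i⟩ = 0
      rw [hv, hJ, sub_self]
    refine ContinuousLinearMap.ext fun f => ?_
    obtain ⟨g, hg, hgf⟩ := hle f.2
    obtain rfl : g = f := Subtype.ext hgf
    exact sub_eq_zero.1 hg

/-- A space with a norming set of functionals is a dual space if the functionals on the span of
this set are evaluations. -/
theorem exists_predual {𝕜 : Type} [RCLike 𝕜] {V : Type u} [NormedAddCommGroup V]
    [NormedSpace 𝕜 V] {ι : Type*} (I : ι → StrongDual 𝕜 V)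
    (hnorm : ∀ v r, 0 ≤ r → r < ‖v‖ → ∃ i c, 0 < c ∧ ‖I i‖ ≤ c ∧ r * c ≤ ‖I i v‖)
    (hrep : ∀ (E : Submodule 𝕜 (StrongDual 𝕜 V)) (hI : ∀ i, I i ∈ E) (Λ : E →ₗ[𝕜] 𝕜) (C : ℝ),
      0 ≤ C → (∀ f : E, ‖Λ f‖ ≤ C * ‖f.1‖) → ∃ v, ∀ i, Λ ⟨I i, hI i⟩ = I i v) :
    ∃ (E : Type u) (_ : NormedAddCommGroup E) (_ : NormedSpace 𝕜 E) (_ : CompleteSpace E)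
      (φ : V ≃ₗ[𝕜] StrongDual 𝕜 E), ∀ v, ‖φ v‖ = ‖v‖ :=
  exists_predual_of_pairing I (NormedSpace.inclusionInDoubleDual 𝕜 V).toLinearMap
    (NormedSpace.double_dual_bound 𝕜 V) hnorm fun E hI Λ =>
      hrep E hI Λ.toLinearMap ‖Λ‖ (norm_nonneg Λ) Λ.le_opNorm

theorem IsMcb.exists_isSemifinite (h : IsMcb B) :
    ∃ (F : Set B) (M : B → ℝ), IsSemifinite F M := by
  obtain ⟨hB, μ, hbot, hμ, hpos, hfin⟩ := h
  exact ⟨_, _, isSemifinite_of_measure hbot hμ hB hpos hfin⟩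

theorem isBanachDual_of_predual {X : MISpace.{u}}
    (h : ∃ (E : Type u) (_ : NormedAddCommGroup E) (_ : NormedSpace ℝ E) (_ : CompleteSpace E)
      (φ : X ≃ₗ[ℝ] StrongDual ℝ E), ∀ v, ‖φ v‖ = ‖v‖) : IsBanachDual X := by
  obtain ⟨E, i1, i2, i3, φ, hφ⟩ := h
  exact ⟨E, i1, i2, i3, ⟨⟨φ, hφ⟩⟩⟩

/-- The predual is a copy of `L¹`, realized as the closed span of the functionals `∫_p` in the dual
of `L∞(B)`. A bounded functional `Λ` on it gives the additive function `p ↦ Λ(∫_p)`, dominated by a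
multiple of the measure, and its density represents `Λ`. -/
theorem IsMcb.isBanachDual (h : IsMcb B) : IsBanachDual (LinfObj B) := by
  obtain ⟨F, M, hM⟩ := h.exists_isSemifinite
  refine isBanachDual_of_predual (exists_predual (V := LinfObj B) hM.setIntegral
    (fun x r hr hrx => ?_) fun E hE Λ C hC0 hC => ?_)
  · rw [← not_le, norm_le_iff_pt hr] at hrx
    push Not at hrx
    obtain ⟨P, hP⟩ := hrx
    rcases lt_abs.1 hP with hP | hP
    · obtain ⟨p, hp, h0, hle⟩ := hM.exists_lt_setIntegral hP
      exact ⟨p, M p, h0, hM.norm_setIntegral_le hp, hle.trans (le_abs_self _)⟩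
    · rw [← map_neg] at hP
      obtain ⟨p, hp, h0, hle⟩ := hM.exists_lt_setIntegral hP
      rw [map_neg] at hle
      exact ⟨p, M p, h0, hM.norm_setIntegral_le hp, hle.trans (neg_le_abs _)⟩
  · obtain ⟨x, hx⟩ := hM.exists_density h.1 (ν := fun p => Λ ⟨_, hE p⟩) (C := C)
      (fun p hp b => by
        rw [← map_add]
        exact congrArg Λ (Subtype.ext (hM.setIntegral_eq_add hp b))) fun p hp =>
        (hC _).trans (mul_le_mul_of_nonneg_left (hM.norm_setIntegral_le hp) hC0)
    refine ⟨x, fun p => ?_⟩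
    by_cases hp : p ∈ F
    · exact (hx p hp).symm
    -- For `p` of infinite measure the functional is zero by convention, so the family can be
    -- indexed by all of `B`.
    · have h0 : (⟨_, hE p⟩ : E) = 0 := Subtype.ext (hM.setIntegral_of_notMem hp)
      rw [h0, map_zero, hM.setIntegral_of_notMem hp, zero_apply]

theorem isProperAbstractLinf_linf_iff : IsProperAbstractLinf (LinfObj B) ↔ IsMcb B :=
  ⟨fun h => (hasNormalFunctionals_of_isBanachDual h.2).isMcb, fun h =>
    ⟨(dedekindComplete_linf_iff.2 h.1).countablyComplete', h.isBanachDual⟩⟩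

/-! ### The complex case -/

/-- A normed structure is needed only on the complexification of `L∞(B)`, where evaluation at points
gives the triangle inequality; other spaces are reached through the counit. -/
instance : Norm (Cplx (LinfObj B)) := ⟨fun z => ‖z.modulus‖⟩

theorem norm_cplx_le_iff {z : Cplx (LinfObj B)} {r : ℝ} (hr : 0 ≤ r) :
    ‖z‖ ≤ r ↔ ∀ P, ‖cpt P z‖ ≤ r := norm_modulus_le_iff hr

theorem norm_cpt_le (P : Point B) (z : Cplx (LinfObj B)) : ‖cpt P z‖ ≤ ‖z‖ :=
  (norm_cplx_le_iff (norm_nonneg z.modulus)).1 le_rfl P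

theorem norm_smul_cplx_le (c : ℂ) (z : Cplx (LinfObj B)) : ‖c • z‖ ≤ ‖c‖ * ‖z‖ :=
  (norm_cplx_le_iff (mul_nonneg (norm_nonneg c) (norm_nonneg z.modulus))).2 fun P => by
    rw [cpt_smul, norm_mul]
    exact mul_le_mul_of_nonneg_left (norm_cpt_le P z) (norm_nonneg c)

theorem normedSpaceCore_cplx : NormedSpace.Core ℂ (Cplx (LinfObj B)) where
  norm_nonneg z := norm_nonneg z.modulus
  norm_smul c z := by
    refine le_antisymm (norm_smul_cplx_le c z) ?_
    rcases eq_or_ne c 0 with rfl | hc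
    · rw [norm_zero, zero_mul]
      exact norm_nonneg ((0 : ℂ) • z).modulus
    · have := norm_smul_cplx_le c⁻¹ (c • z)
      rwa [inv_smul_smul₀ hc, norm_inv, ← div_eq_inv_mul, le_div_iff₀' (norm_pos_iff.2 hc)] at this
  norm_triangle z w := (norm_cplx_le_iff (add_nonneg (norm_nonneg z.modulus)
    (norm_nonneg w.modulus))).2 fun P => by
      rw [cpt_add]
      exact (norm_add_le _ _).trans (add_le_add (norm_cpt_le P z) (norm_cpt_le P w))
  norm_eq_zero_iff z := by
    refine ⟨fun h => ?_, ?_⟩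
    · have h1 : ∀ P, cpt P z = 0 := fun P => norm_le_zero_iff.1 ((norm_cpt_le P z).trans h.le)
      exact Cplx.ext (eq_zero_of_pt fun P => congrArg Complex.re (h1 P))
        (eq_zero_of_pt fun P => congrArg Complex.im (h1 P))
    · rintro rfl
      refine le_antisymm ((norm_cplx_le_iff le_rfl).2 fun P => ?_) (norm_nonneg (0 : Cplx (LinfObj B)).modulus)
      have : cpt P (0 : Cplx (LinfObj B)) = 0 := Complex.ext (map_zero (pt P)) (map_zero (pt P))
      rw [this, norm_zero]

instance : NormedAddCommGroup (Cplx (LinfObj B)) := .ofCore normedSpaceCore_cplx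

instance : NormedSpace ℂ (Cplx (LinfObj B)) := .ofCore normedSpaceCore_cplx

theorem norm_rotation_le (z : Cplx (LinfObj B)) (θ : ℝ) :
    ‖Real.cos θ • z.re + Real.sin θ • z.im‖ ≤ ‖z‖ := by
  rw [norm_le_iff_pt (norm_nonneg z)]
  intro P
  have h1 := rotation_le_norm (cpt P z) θ
  have h2 := rotation_le_norm (-cpt P z) θ
  have h3 := norm_cpt_le P z
  rw [norm_neg, Complex.neg_re, Complex.neg_im] at h2
  rw [map_add, map_smul, map_smul, smul_eq_mul, smul_eq_mul, abs_le']
  exact ⟨h1.trans h3, le_trans (by simp only [cpt]; linarith) (h2.trans h3)⟩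

/-- The complex linear extension of a real functional. -/
def complexifyL (f : LinfObj B →L[ℝ] ℝ) : StrongDual ℂ (Cplx (LinfObj B)) :=
  LinearMap.mkContinuous
    { toFun := fun z => (⟨f z.re, f z.im⟩ : ℂ)
      map_add' := fun z w => Complex.ext (map_add f _ _) (map_add f _ _)
      map_smul' := fun c z => Complex.ext (by simp) (by simp) } ‖f‖ fun z => by
    -- Rotating the value onto the positive real axis reduces the estimate to the real functional on
    -- a rotation of `z`, so the norm does not grow.
    obtain ⟨θ, hθ⟩ := norm_eq_rotation ⟨f z.re, f z.im⟩
    refine hθ.trans_le ?_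
    have h1 := (le_abs_self _).trans (f.le_opNorm (Real.cos θ • z.re + Real.sin θ • z.im))
    rw [map_add, map_smul, map_smul] at h1
    exact h1.trans (mul_le_mul_of_nonneg_left (norm_rotation_le z θ) (norm_nonneg f))

theorem norm_complexifyL_le (f : LinfObj B →L[ℝ] ℝ) : ‖complexifyL f‖ ≤ ‖f‖ :=
  LinearMap.mkContinuous_norm_le _ (norm_nonneg f) _

theorem complexifyL_add (f g : LinfObj B →L[ℝ] ℝ) :
    complexifyL (f + g) = complexifyL f + complexifyL g :=
  ContinuousLinearMap.ext fun _ => Complex.ext rfl rfl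

theorem complexifyL_zero : complexifyL (0 : LinfObj B →L[ℝ] ℝ) = 0 :=
  ContinuousLinearMap.ext fun _ => Complex.ext rfl rfl

/-- The real and imaginary parts of `p ↦ Λ(∫_p)` have separate densities. The family is norming
because a suitable rotation of `z` has real part `|z|` at a given point. -/
theorem IsMcb.isBanachDualC (h : IsMcb B) : IsBanachDualC ⟨LinfObj B⟩ := by
  obtain ⟨F, M, hM⟩ := h.exists_isSemifinite
  have hnorm : ∀ p ∈ F, ‖complexifyL (hM.setIntegral p)‖ ≤ M p := fun p hp =>
    (norm_complexifyL_le _).trans (hM.norm_setIntegral_le hp)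
  refine exists_predual (V := Cplx (LinfObj B)) (fun p => complexifyL (hM.setIntegral p))
    (fun z r hr hrz => ?_) fun E hE Λ C hC0 hC => ?_
  · rw [← not_le, norm_cplx_le_iff hr] at hrz
    push Not at hrz
    obtain ⟨P, hP⟩ := hrz
    obtain ⟨θ, hθ⟩ := norm_eq_rotation (cpt P z)
    have h1 : r < pt P (Real.cos θ • z.re + Real.sin θ • z.im) := by
      rw [map_add, map_smul, map_smul]
      exact hP.trans_eq hθ
    obtain ⟨p, hp, h0, hle⟩ := hM.exists_lt_setIntegral h1
    rw [map_add, map_smul, map_smul] at hle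
    exact ⟨p, M p, h0, hnorm p hp,
      hle.trans (rotation_le_norm (complexifyL (hM.setIntegral p) z) θ)⟩
  · have hadd : ∀ p ∈ F, ∀ b, Λ ⟨_, hE p⟩ = Λ ⟨_, hE (p ⊓ b)⟩ + Λ ⟨_, hE (p ⊓ bᶜ)⟩ :=
      fun p hp b => by
        rw [← map_add]
        exact congrArg Λ (Subtype.ext
          ((congrArg complexifyL (hM.setIntegral_eq_add hp b)).trans (complexifyL_add _ _)))
    have hle : ∀ p ∈ F, ‖Λ ⟨_, hE p⟩‖ ≤ C * M p := fun p hp =>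
      (hC _).trans (mul_le_mul_of_nonneg_left (hnorm p hp) hC0)
    obtain ⟨x, hx⟩ := hM.exists_density h.1 (ν := fun p => (Λ ⟨_, hE p⟩).re) (C := C)
      (fun p hp b => by rw [hadd p hp b, Complex.add_re])
      fun p hp => (Complex.abs_re_le_norm _).trans (hle p hp)
    obtain ⟨y, hy⟩ := hM.exists_density h.1 (ν := fun p => (Λ ⟨_, hE p⟩).im) (C := C)
      (fun p hp b => by rw [hadd p hp b, Complex.add_im])
      fun p hp => (Complex.abs_im_le_norm _).trans (hle p hp)
    refine ⟨⟨x, y⟩, fun p => ?_⟩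
    by_cases hp : p ∈ F
    · exact Complex.ext (hx p hp).symm (hy p hp).symm
    · have h0 : (⟨_, hE p⟩ : E) = 0 := Subtype.ext
        ((congrArg complexifyL (hM.setIntegral_of_notMem hp)).trans complexifyL_zero)
      rw [h0, map_zero, hM.setIntegral_of_notMem hp, complexifyL_zero, zero_apply]

theorem isProperAbstractLinfC_linf_iff : IsProperAbstractLinfC ⟨LinfObj B⟩ ↔ IsMcb B :=
  ⟨fun h => (hasNormalFunctionals_of_isBanachDualC h.2).isMcb, fun h =>
    ⟨(dedekindComplete_linf_iff.2 h.1).countablyComplete', h.isBanachDualC⟩⟩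

end

end RieszBool

namespace RieszBool

/-! ### Equivalences of subcategories -/

section Restriction

variable {C : Type*} [Category* C] {D : Type*} [Category* D]

/-- An isomorphism whose two directions lie in a subcategory. -/
def Subcat.isoMk (S : Subcat C) {X Y : S.Obj} (f : X.val ≅ Y.val) (h : S.hom f.hom)
    (h' : S.hom f.inv) : X ≅ Y where
  hom := ⟨f.hom, h⟩
  inv := ⟨f.inv, h'⟩
  hom_inv_id := Subtype.ext f.hom_inv_id
  inv_hom_id := Subtype.ext f.inv_hom_id

/-- A functor `F` with a left inverse `G` and a natural transformation `G ⋙ F ⟶ 𝟭` that is an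
isomorphism on `T` restricts to an equivalence of `S` and `T` if the conditions that define `S`
and `T` correspond to each other under `F` and hold for isomorphisms. -/
theorem restrictToEquivalence {F : C ⥤ D} {G : D ⥤ C} (η : 𝟭 C ≅ F ⋙ G) (ε : G ⋙ F ⟶ 𝟭 D)
    {S : Subcat C} {T : Subcat D} (hobj : ∀ X, S.obj X ↔ T.obj (F.obj X))
    (hε : ∀ Y, T.obj Y → IsIso (ε.app Y))
    (hT : ∀ {Y Y' : D}, (Y ≅ Y') → T.obj Y → T.obj Y')
    (hhom : ∀ {X X' : C} (f : X ⟶ X'), S.hom f ↔ T.hom (F.map f))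
    (hiso : ∀ {Y Y' : D} (f : Y ≅ Y'), T.hom f.hom) : RestrictToEquivalence F G S T := by
  have hSiso : ∀ {X X' : C} (f : X ≅ X'), S.hom f.hom := fun f =>
    (hhom _).2 (hiso (F.mapIso f))
  have hGobj : ∀ Y, T.obj Y → S.obj (G.obj Y) := fun Y hY => by
    have := hε Y hY
    exact (hobj _).2 (hT (asIso (ε.app Y)).symm hY)
  have hF : Restricts F S T := ⟨fun X => (hobj X).1, fun X Y f _ _ => (hhom f).1⟩
  have hG : Restricts G T S := ⟨hGobj, fun X Y f hX hY hf => by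
    have := hε X hX
    have := hε Y hY
    -- By naturality of `ε`, the morphism `F(G(f))` is `f` conjugated by isomorphisms, and
    -- isomorphisms satisfy the condition defining `T`.
    have h : F.map (G.map f) = (asIso (ε.app X)).hom ≫ f ≫ (asIso (ε.app Y)).symm.hom := by
      have := ε.naturality f
      simp only [Functor.comp_map, Functor.id_map] at this
      simp [← reassoc_of% this]
    rw [hhom, h]
    exact T.comp_mem _ _ (hiso _) (T.comp_mem _ _ hf (hiso _))⟩
  refine ⟨hF, hG, ⟨NatIso.ofComponents (fun Y => ?_) fun {Y Y'} f => ?_⟩,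
    ⟨NatIso.ofComponents (fun X => ?_) fun {X X'} f => ?_⟩⟩
  · have := hε Y.val Y.property
    let e : F.obj (G.obj Y.val) ≅ Y.val := asIso (ε.app Y.val)
    exact T.isoMk (X := (hG.functor ⋙ hF.functor).obj Y) (Y := (𝟭 T.Obj).obj Y)
      e (hiso e) (hiso e.symm)
  · exact Subtype.ext (ε.naturality f.1)
  · exact S.isoMk (X := (hF.functor ⋙ hG.functor).obj X) (Y := (𝟭 S.Obj).obj X)
      (η.app X.val).symm (hSiso _) (hSiso (η.app X.val))
  · exact Subtype.ext (η.inv.naturality f.1)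

end Restriction

noncomputable section

/-! ### The unit and the counit -/

/-- The natural isomorphism of `B` and `PrjB(L∞(B))`. -/
def unitIso : 𝟭 BoolAlg.{u} ≅ Linf ⋙ PrjB :=
  NatIso.ofComponents (fun B => BoolAlg.Iso.mk (β := PrjB.obj (Linf.obj B)) (unitOrderIso B))
    fun {A B} f => BoolAlg.ext fun a => by
      show (isSplit_chiL (f.hom a)).band =
        ProjBand.map (LinfMap f.hom) (isSplit_chiL a).band
      apply unitComponent_injective
      rw [unitComponent_map, unitComponent_band, unitComponent_band, linfMap_chiL]

/-- The natural transformation from `L∞(PrjB(X))` to `X`. -/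
def counit : PrjB ⋙ Linf ⟶ 𝟭 MISpace.{u} where
  app X := counitHom X
  naturality {X Y} f := linf_hom_ext (f := LinfMap (ProjBand.mapHom f) ≫ counitHom Y)
    (g := counitHom X ≫ f) fun P => by
      rw [MISpace.comp_apply, MISpace.comp_apply, linfMap_chiL, counitHom_chiL, counitHom_chiL]
      exact unitComponent_map f P

/-- The counit is invertible at `L∞(B)`, and naturality carries this along an isomorphism `L∞(B) ≅
X`. -/
theorem isIso_counit_of_catbLinf {X : MISpace.{u}} (hX : catbLinf.obj X) :
    IsIso (counit.app X) := by
  obtain ⟨B, f, hf⟩ := hX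
  have h1 : IsIso (counitHom (LinfObj B)) :=
    (MISpace.isIso_iff_bijective _).2 (bijective_counitHom_linf B)
  have h2 : IsIso f := (MISpace.isIso_iff_bijective f).2 hf.1
  have h3 : IsIso (counit.app (Linf.obj B)) := h1
  have h4 := counit.naturality f
  have h5 : IsIso ((PrjB ⋙ Linf).map f ≫ counit.app X) := by
    rw [h4]
    exact IsIso.comp_isIso' h3 h2
  exact IsIso.of_isIso_comp_left ((PrjB ⋙ Linf).map f) _

theorem isIso_counit_of_countablyComplete {X : MISpace.{u}} (hX : CountablyComplete X) :
    IsIso (counit.app X) :=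
  (MISpace.isIso_iff_bijective (counitHom X)).2 (bijective_counitHom_of_countablyComplete hX)

theorem catbLinf_of_countablyComplete {X : MISpace.{u}} (hX : CountablyComplete X) :
    catbLinf.obj X :=
  ⟨PrjB.obj X, counitHom X,
    MISpace.isIsometricIso_iff.2 (bijective_counitHom_of_countablyComplete hX)⟩

theorem isIso_iff_bijective_boolAlg {A B : BoolAlg.{u}} (f : A ⟶ B) :
    IsIso f ↔ Function.Bijective fun x => f x := by
  constructor
  · intro h
    refine Function.bijective_iff_has_inverse.2 ⟨fun y => (inv f) y, fun x => ?_, fun y => ?_⟩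
    · show (f ≫ inv f) x = x
      rw [IsIso.hom_inv_id]; rfl
    · show (inv f ≫ f) y = y
      rw [IsIso.inv_hom_id]; rfl
  · intro h
    let e : A ≃o B :=
      { toEquiv := Equiv.ofBijective _ h
        map_rel_iff' := fun {a b} => by
          show f a ≤ f b ↔ a ≤ b
          rw [← sup_eq_right, ← sup_eq_right (a := a), ← SupHomClass.map_sup f.hom]
          exact h.1.eq_iff }
    have : f = (BoolAlg.Iso.mk e).hom := BoolAlg.ext fun _ => rfl
    rw [this]
    infer_instance

theorem orderContinuous_of_bijective_boolAlg {A B : BoolAlg.{u}} {f : A ⟶ B}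
    (h : Function.Bijective fun x => f x) : OrderContinuous fun x => f x := by
  let e : A ≃o B :=
    { toEquiv := Equiv.ofBijective _ h
      map_rel_iff' := fun {a b} => by
        show f a ≤ f b ↔ a ≤ b
        rw [← sup_eq_right, ← sup_eq_right (a := a), ← SupHomClass.map_sup f.hom]
        exact h.1.eq_iff }
  exact OrderContinuous.of_orderIso e

/-- If `L∞(f)` is an isomorphism, so is `PrjB(L∞(f))`, which is conjugate to `f` by the unit. -/
theorem bijective_linf_map_iff {A B : BoolAlg.{u}} (f : A ⟶ B) :
    (Function.Bijective fun x => (Linf.map f) x) ↔ Function.Bijective fun x => f x := by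
  rw [← isIso_iff_bijective_boolAlg, ← MISpace.isIso_iff_bijective]
  refine ⟨fun h => ?_, fun h => inferInstance⟩
  have h1 : f = unitIso.hom.app A ≫ (Linf ⋙ PrjB).map f ≫ unitIso.inv.app B := by
    rw [← unitIso.hom.naturality_assoc, unitIso.hom_inv_id_app, Category.comp_id]
    rfl
  have h2 : IsIso ((Linf ⋙ PrjB).map f) := Functor.map_isIso PrjB (Linf.map f)
  rw [h1]
  infer_instance

/-! ### The real case -/

section Real

variable {X Y : MISpace.{u}}

theorem bijective_iso (f : X ≅ Y) : Function.Bijective fun x => f.hom x :=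
  (MISpace.isIso_iff_bijective f.hom).1 inferInstance

theorem isIsometricIso_iso (f : X ≅ Y) : IsIsometricIso f.hom :=
  MISpace.isIsometricIso_iff.2 (bijective_iso f)

theorem catbLinf_of_iso (f : X ≅ Y) (h : catbLinf.obj X) : catbLinf.obj Y := by
  obtain ⟨B, g, hg⟩ := h
  exact ⟨B, g ≫ f.hom, hg.comp (isIsometricIso_iso f)⟩

theorem countablyComplete_of_iso (f : X ≅ Y) (h : CountablyComplete X) : CountablyComplete Y :=
  h.of_orderIso (MISpace.orderIso f.hom (bijective_iso f))

theorem dedekindComplete_of_iso (f : X ≅ Y) (h : DedekindComplete X) : DedekindComplete Y :=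
  h.of_orderIso (MISpace.orderIso f.hom (bijective_iso f))

/-- A bijective Riesz homomorphism as a linear isometry. -/
def isometryEquiv (f : X ≅ Y) : X ≃ₗᵢ[ℝ] Y where
  toLinearEquiv := LinearEquiv.ofBijective f.hom.toLinearMap (bijective_iso f)
  norm_map' := (isIsometricIso_iso f).2

theorem isBanachDual_of_iso (f : X ≅ Y) (h : IsBanachDual X) : IsBanachDual Y := by
  obtain ⟨E, i1, i2, i3, ⟨e⟩⟩ := h
  exact ⟨E, i1, i2, i3, ⟨(isometryEquiv f).symm.trans e⟩⟩

theorem isProperAbstractLinf_of_iso (f : X ≅ Y) (h : IsProperAbstractLinf X) :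
    IsProperAbstractLinf Y :=
  ⟨countablyComplete_of_iso f h.1, isBanachDual_of_iso f h.2⟩

/-- The isomorphism of `L∞(PrjB(X))` and `X` if `X` is countably complete. -/
def counitIso (hX : CountablyComplete X) : LinfObj (ProjBand X) ≅ X :=
  MISpace.isoOfBijective (counitHom X) (bijective_counitHom_of_countablyComplete hX)

/-- Being a dual forces full Dedekind completeness: transported to `L∞(PrjB(X))`, duality makes
`PrjB(X)` an mcb-algebra. The inclusion of `catLinfc` in `catDcaLinfc` depends on this. -/
theorem IsProperAbstractLinf.dedekindComplete (h : IsProperAbstractLinf X) :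
    DedekindComplete X := by
  have h1 := isProperAbstractLinf_of_iso (counitIso h.1).symm h
  exact dedekindComplete_of_iso (counitIso h.1)
    (dedekindComplete_linf_iff.2 (isProperAbstractLinf_linf_iff.1 h1).1)

theorem isIsometricIso_linf_map_iff {A B : BoolAlg.{u}} (f : A ⟶ B) :
    (Function.Bijective fun x => f x) ↔ IsIsometricIso (Linf.map f) := by
  rw [MISpace.isIsometricIso_iff, bijective_linf_map_iff]

theorem equivalence_catB : RestrictToEquivalence Linf.{u} PrjB.{u} catB catbLinf :=
  restrictToEquivalence unitIso counit
    (fun B => iff_of_true trivial ⟨B, 𝟙 _, IsIsometricIso.id _⟩)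
    (fun _ => isIso_counit_of_catbLinf) catbLinf_of_iso (fun _ => Iff.rfl) fun _ => trivial

theorem equivalence_catccB : RestrictToEquivalence Linf.{u} PrjB.{u} catccB cataLinf :=
  restrictToEquivalence unitIso counit (fun _ => countablyComplete_linf_iff.symm)
    (fun _ => isIso_counit_of_countablyComplete) countablyComplete_of_iso (fun _ => Iff.rfl)
    fun _ => trivial

theorem equivalence_catDcBc : RestrictToEquivalence Linf.{u} PrjB.{u} catDcBc catDcaLinfc :=
  restrictToEquivalence unitIso counit
    (fun _ => ⟨fun h => ⟨(dedekindComplete_linf_iff.2 h).countablyComplete',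
      dedekindComplete_linf_iff.2 h⟩, fun h => dedekindComplete_linf_iff.1 h.2⟩)
    (fun _ h => isIso_counit_of_countablyComplete h.1)
    (fun f h => ⟨countablyComplete_of_iso f h.1, dedekindComplete_of_iso f h.2⟩)
    (fun f => (orderContinuous_linfMap_iff f.hom).symm)
    fun f => orderContinuous_of_bijective (bijective_iso f)

theorem equivalence_catmcBc : RestrictToEquivalence Linf.{u} PrjB.{u} catmcBc catLinfc :=
  restrictToEquivalence unitIso counit (fun _ => isProperAbstractLinf_linf_iff.symm)
    (fun _ h => isIso_counit_of_countablyComplete h.1) isProperAbstractLinf_of_iso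
    (fun f => (orderContinuous_linfMap_iff f.hom).symm)
    fun f => orderContinuous_of_bijective (bijective_iso f)

theorem equivalence_catccBi : RestrictToEquivalence Linf.{u} PrjB.{u} catccBi cataLinfi :=
  restrictToEquivalence unitIso counit (fun _ => countablyComplete_linf_iff.symm)
    (fun _ => isIso_counit_of_countablyComplete) countablyComplete_of_iso
    (fun f => (injective_linfMap_iff f.hom).symm) fun f => (bijective_iso f).1

theorem equivalence_catccBIso : RestrictToEquivalence Linf.{u} PrjB.{u} catccBIso cataLinfIso :=
  restrictToEquivalence unitIso counit (fun _ => countablyComplete_linf_iff.symm)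
    (fun _ => isIso_counit_of_countablyComplete) countablyComplete_of_iso
    isIsometricIso_linf_map_iff isIsometricIso_iso

theorem equivalence_catmcBIso : RestrictToEquivalence Linf.{u} PrjB.{u} catmcBIso catLinfIso :=
  restrictToEquivalence unitIso counit (fun _ => isProperAbstractLinf_linf_iff.symm)
    (fun _ h => isIso_counit_of_countablyComplete h.1) isProperAbstractLinf_of_iso
    isIsometricIso_linf_map_iff isIsometricIso_iso

end Real

/-! ### The complex case -/

section Complex

variable {X Y : CMISpace.{u}}

/-- The restriction of a homomorphism to the real parts. -/
abbrev realHom (f : X ⟶ Y) : X.re ⟶ Y.re := realPart.map f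

theorem realPart_apply (f : X ⟶ Y) (x : X.re) :
    Cplx.ofReal ((realHom f) x) = f (Cplx.ofReal x) := (CMISpace.map_ofReal f x).symm

/-- Every homomorphism is the complexification of its real part. -/
theorem apply_eq (f : X ⟶ Y) (z : Cplx X.re) :
    f z = ⟨(realHom f) z.re, (realHom f) z.im⟩ := by
  have hz : z = Cplx.ofReal z.re + Complex.I • Cplx.ofReal z.im := by
    ext <;> simp [Cplx.ofReal]
  conv_lhs => rw [hz]
  rw [map_add, map_smul, ← realPart_apply, ← realPart_apply]
  refine Cplx.ext ?_ ?_
  · show (realHom f) z.re + (Complex.I.re • (realHom f) z.im -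
      Complex.I.im • (0 : Y.re)) = (realHom f) z.re
    simp
  · show (0 : Y.re) + (Complex.I.re • (0 : Y.re) +
      Complex.I.im • (realHom f) z.im) = (realHom f) z.im
    simp

/-- Homomorphisms are recovered from their real parts, so the conditions on complex morphisms can be
tested there. -/
theorem complexify_realPart (f : X ⟶ Y) : complexify.map (realHom f) = f :=
  CMISpace.hom_ext fun z => (apply_eq f z).symm

theorem bijective_realPart_iff (f : X ⟶ Y) :
    (Function.Bijective fun x => (realHom f) x) ↔ Function.Bijective fun z => f z := by
  constructor
  · intro h
    have h1 := (MISpace.isIso_iff_bijective _).2 h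
    have h2 : IsIso (complexify.map (realHom f)) := inferInstance
    rw [complexify_realPart] at h2
    have h3 : IsIso f := h2
    refine Function.bijective_iff_has_inverse.2 ⟨fun y => (inv f) y, fun x => ?_, fun y => ?_⟩
    · show (f ≫ inv f) x = x
      rw [IsIso.hom_inv_id]; rfl
    · show (inv f ≫ f) y = y
      rw [IsIso.inv_hom_id]; rfl
  · refine fun h => ⟨fun x y hxy => ?_, fun y => ?_⟩
    · exact Cplx.ofReal_injective (h.1 ((realPart_apply f x).symm.trans
        ((congrArg Cplx.ofReal hxy).trans (realPart_apply f y))))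
    · obtain ⟨z, hz⟩ := h.2 (Cplx.ofReal y)
      refine ⟨z.re, ?_⟩
      have := congrArg Cplx.re ((apply_eq f z).symm.trans hz)
      exact this

theorem injective_realPart_iff (f : X ⟶ Y) :
    (Function.Injective fun x => (realHom f) x) ↔ Function.Injective fun z => f z := by
  refine ⟨fun h z w hzw => ?_, fun h x y hxy => ?_⟩
  · have h1 := (apply_eq f z).symm.trans (hzw.trans (apply_eq f w))
    have h2 : (realHom f) z.re = (realHom f) w.re := (Cplx.mk.inj h1).1
    have h3 : (realHom f) z.im = (realHom f) w.im := (Cplx.mk.inj h1).2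
    exact Cplx.ext (h h2) (h h3)
  · exact Cplx.ofReal_injective (h ((realPart_apply f x).symm.trans
      ((congrArg Cplx.ofReal hxy).trans (realPart_apply f y))))

/-- A homomorphism commutes with the modulus and the complex norm is the norm of the modulus, so
only bijectivity is at stake. -/
theorem isIsometricIsoC_iff (f : X ⟶ Y) :
    IsIsometricIsoC f ↔ IsIsometricIso (realHom f) := by
  rw [MISpace.isIsometricIso_iff, bijective_realPart_iff]
  refine ⟨fun h => h.1, fun h => ⟨h, fun z => ?_⟩⟩
  have h1 : (realHom f) z.modulus = (f z).modulus :=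
    congrArg Cplx.re (CMISpace.map_modulus f z)
  rw [← h1]
  exact MISpace.norm_map ((bijective_realPart_iff f).2 h).1 _

theorem isIsometricIsoC_iso (f : X ≅ Y) : IsIsometricIsoC f.hom :=
  (isIsometricIsoC_iff _).2 (isIsometricIso_iso (realPart.mapIso f))

theorem catbLinfC_iff : catbLinfC.obj X ↔ catbLinf.obj X.re := by
  constructor
  · rintro ⟨B, f, hf⟩
    exact ⟨B, realPart.map f, (isIsometricIsoC_iff f).1 hf⟩
  · rintro ⟨B, f, hf⟩
    exact ⟨B, complexify.map f, (isIsometricIsoC_iff _).2 hf⟩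

/-- The natural isomorphism of `B` and `PrjB(L∞(B))` in the complex case. -/
def unitIsoC : 𝟭 BoolAlg.{u} ≅ LinfC ⋙ PrjBC :=
  NatIso.ofComponents (fun B => unitIso.app B) fun f => unitIso.hom.naturality f

/-- The natural transformation from `L∞(PrjB(X))` to `X` in the complex case. -/
def counitC : PrjBC ⋙ LinfC ⟶ 𝟭 CMISpace.{u} where
  app X := complexify.map (counit.app X.re)
  naturality {X Y} f := by
    have h := congrArg (fun g => complexify.map g) (counit.naturality (realPart.map f))
    simp only [Functor.map_comp] at h
    refine h.trans ?_
    exact congrArg (fun g => complexify.map (counit.app X.re) ≫ g) (complexify_realPart f)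

theorem isIso_counitC (h : IsIso (counit.app X.re)) : IsIso (counitC.app X) :=
  Functor.map_isIso complexify (counit.app X.re)

theorem isBanachDualC_of_iso (f : X ≅ Y) (h : IsBanachDualC X) : IsBanachDualC Y := by
  obtain ⟨E, i1, i2, i3, φ, hφ⟩ := h
  have hf := isIsometricIsoC_iso f
  refine ⟨E, i1, i2, i3, (LinearEquiv.ofBijective f.hom.toLinearMap hf.1).symm.trans φ,
    fun z => ?_⟩
  obtain ⟨w, rfl⟩ := hf.1.2 z
  have h1 : (LinearEquiv.ofBijective f.hom.toLinearMap hf.1).symm (f.hom w) = w :=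
    LinearEquiv.symm_apply_apply _ _
  rw [LinearEquiv.trans_apply]
  refine (congrArg (fun w => ‖φ w‖) h1).trans ?_
  rw [hφ]
  exact (hf.2 w).symm

theorem isProperAbstractLinfC_of_iso (f : X ≅ Y) (h : IsProperAbstractLinfC X) :
    IsProperAbstractLinfC Y :=
  ⟨countablyComplete_of_iso (realPart.mapIso f) h.1, isBanachDualC_of_iso f h.2⟩

theorem IsProperAbstractLinfC.dedekindComplete (h : IsProperAbstractLinfC X) :
    DedekindComplete X.re := by
  have h1 : IsProperAbstractLinfC ⟨LinfObj (ProjBand X.re)⟩ :=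
    isProperAbstractLinfC_of_iso (complexify.mapIso (counitIso h.1).symm) h
  exact dedekindComplete_of_iso (counitIso h.1)
    (dedekindComplete_linf_iff.2 (isProperAbstractLinfC_linf_iff.1 h1).1)

theorem orderContinuousC_iso (f : X ≅ Y) : OrderContinuousC f.hom :=
  orderContinuous_of_bijective (bijective_iso (realPart.mapIso f))

theorem isIsometricIsoC_linfC_map_iff {A B : BoolAlg.{u}} (f : A ⟶ B) :
    (Function.Bijective fun x => f x) ↔ IsIsometricIsoC (LinfC.map f) :=
  (isIsometricIso_linf_map_iff f).trans (isIsometricIsoC_iff (LinfC.map f)).symm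

theorem equivalenceC_catB : RestrictToEquivalence LinfC.{u} PrjBC.{u} catB catbLinfC :=
  restrictToEquivalence unitIsoC counitC
    (fun B => iff_of_true trivial ⟨B, 𝟙 _, IsIsometricIsoC.id _⟩)
    (fun _ h => isIso_counitC (isIso_counit_of_catbLinf (catbLinfC_iff.1 h)))
    (fun f h => catbLinfC_iff.2 (catbLinf_of_iso (realPart.mapIso f) (catbLinfC_iff.1 h)))
    (fun _ => Iff.rfl) fun _ => trivial

theorem equivalenceC_catccB : RestrictToEquivalence LinfC.{u} PrjBC.{u} catccB cataLinfC :=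
  restrictToEquivalence unitIsoC counitC (fun _ => countablyComplete_linf_iff.symm)
    (fun _ h => isIso_counitC (isIso_counit_of_countablyComplete h))
    (fun f => countablyComplete_of_iso (realPart.mapIso f)) (fun _ => Iff.rfl)
    fun _ => trivial

theorem equivalenceC_catDcBc : RestrictToEquivalence LinfC.{u} PrjBC.{u} catDcBc catDcaLinfcC :=
  restrictToEquivalence unitIsoC counitC
    (fun _ => ⟨fun h => ⟨(dedekindComplete_linf_iff.2 h).countablyComplete',
      dedekindComplete_linf_iff.2 h⟩, fun h => dedekindComplete_linf_iff.1 h.2⟩)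
    (fun _ h => isIso_counitC (isIso_counit_of_countablyComplete h.1))
    (fun f h => ⟨countablyComplete_of_iso (realPart.mapIso f) h.1,
      dedekindComplete_of_iso (realPart.mapIso f) h.2⟩)
    (fun f => (orderContinuous_linfMap_iff f.hom).symm) orderContinuousC_iso

theorem equivalenceC_catmcBc : RestrictToEquivalence LinfC.{u} PrjBC.{u} catmcBc catLinfcC :=
  restrictToEquivalence unitIsoC counitC (fun _ => isProperAbstractLinfC_linf_iff.symm)
    (fun _ h => isIso_counitC (isIso_counit_of_countablyComplete h.1))
    isProperAbstractLinfC_of_iso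
    (fun f => (orderContinuous_linfMap_iff f.hom).symm) orderContinuousC_iso

theorem equivalenceC_catccBi : RestrictToEquivalence LinfC.{u} PrjBC.{u} catccBi cataLinfiC :=
  restrictToEquivalence unitIsoC counitC (fun _ => countablyComplete_linf_iff.symm)
    (fun _ h => isIso_counitC (isIso_counit_of_countablyComplete h))
    (fun f => countablyComplete_of_iso (realPart.mapIso f))
    (fun f => (injective_linfMap_iff f.hom).symm.trans (injective_realPart_iff (LinfC.map f)))
    fun f => (isIsometricIsoC_iso f).1.1

theorem equivalenceC_catccBIso :
    RestrictToEquivalence LinfC.{u} PrjBC.{u} catccBIso cataLinfIsoC :=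
  restrictToEquivalence unitIsoC counitC (fun _ => countablyComplete_linf_iff.symm)
    (fun _ h => isIso_counitC (isIso_counit_of_countablyComplete h))
    (fun f => countablyComplete_of_iso (realPart.mapIso f))
    isIsometricIsoC_linfC_map_iff isIsometricIsoC_iso

theorem equivalenceC_catmcBIso :
    RestrictToEquivalence LinfC.{u} PrjBC.{u} catmcBIso catLinfIsoC :=
  restrictToEquivalence unitIsoC counitC (fun _ => isProperAbstractLinfC_linf_iff.symm)
    (fun _ h => isIso_counitC (isIso_counit_of_countablyComplete h.1))
    isProperAbstractLinfC_of_iso isIsometricIsoC_linfC_map_iff isIsometricIsoC_iso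

end Complex

/-! ### Inclusions of subcategories -/

theorem inclusions_boolAlg : catmcBc.{u} ≤ catDcBc ∧ catDcBc.{u} ≤ catccB ∧ catccB.{u} ≤ catB ∧
    catmcBIso.{u} ≤ catccBIso ∧ catccBIso.{u} ≤ catccBi ∧ catmcBIso.{u} ≤ catmcBc ∧
    catccBi.{u} ≤ catccB :=
  ⟨⟨fun _ h => h.1, fun _ _ _ _ _ h => h⟩,
    ⟨fun _ h => h.countablyComplete, fun _ _ _ _ _ _ => trivial⟩,
    ⟨fun _ _ => trivial, fun _ _ _ _ _ _ => trivial⟩,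
    ⟨fun _ h => h.1.countablyComplete, fun _ _ _ _ _ h => h⟩,
    ⟨fun _ h => h, fun _ _ _ _ _ h => h.1⟩,
    ⟨fun _ h => h, fun _ _ _ _ _ h => orderContinuous_of_bijective_boolAlg h⟩,
    ⟨fun _ h => h, fun _ _ _ _ _ _ => trivial⟩⟩

/-- The inclusions with content are that proper spaces are Dedekind complete, that countably
complete spaces are of the form `L∞(B)`, and that isomorphisms are order continuous. -/
theorem inclusions_real : catLinfc.{u} ≤ catDcaLinfc ∧ catDcaLinfc.{u} ≤ cataLinf ∧
    cataLinf.{u} ≤ catbLinf ∧ catLinfIso.{u} ≤ cataLinfIso ∧ cataLinfIso.{u} ≤ cataLinfi ∧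
    catLinfIso.{u} ≤ catLinfc ∧ cataLinfi.{u} ≤ cataLinf :=
  ⟨⟨fun _ h => ⟨h.1, h.dedekindComplete⟩, fun _ _ _ _ _ h => h⟩,
    ⟨fun _ h => h.1, fun _ _ _ _ _ _ => trivial⟩,
    ⟨fun _ h => catbLinf_of_countablyComplete h, fun _ _ _ _ _ _ => trivial⟩,
    ⟨fun _ h => h.1, fun _ _ _ _ _ h => h⟩,
    ⟨fun _ h => h, fun _ _ _ _ _ h => h.1.1⟩,
    ⟨fun _ h => h, fun _ _ _ _ _ h => orderContinuous_of_bijective h.1⟩,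
    ⟨fun _ h => h, fun _ _ _ _ _ _ => trivial⟩⟩

theorem inclusions_complex : catLinfcC.{u} ≤ catDcaLinfcC ∧ catDcaLinfcC.{u} ≤ cataLinfC ∧
    cataLinfC.{u} ≤ catbLinfC ∧ catLinfIsoC.{u} ≤ cataLinfIsoC ∧
    cataLinfIsoC.{u} ≤ cataLinfiC ∧ catLinfIsoC.{u} ≤ catLinfcC ∧
    cataLinfiC.{u} ≤ cataLinfC :=
  ⟨⟨fun _ h => ⟨h.1, h.dedekindComplete⟩, fun _ _ _ _ _ h => h⟩,
    ⟨fun _ h => h.1, fun _ _ _ _ _ _ => trivial⟩,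
    ⟨fun _ h => catbLinfC_iff.2 (catbLinf_of_countablyComplete h), fun _ _ _ _ _ _ => trivial⟩,
    ⟨fun _ h => h.1, fun _ _ _ _ _ h => h⟩,
    ⟨fun _ h => h, fun _ _ _ _ _ h => h.1.1⟩,
    ⟨fun _ h => h, fun _ _ f _ _ h =>
      orderContinuous_of_bijective ((bijective_realPart_iff f).2 h.1)⟩,
    ⟨fun _ h => h, fun _ _ _ _ _ _ => trivial⟩⟩

end

end RieszBool

open RieszBool

theorem mainTheorem10 :
    -- the equivalences given by `L∞` and `PrjB`, real scalars
    RestrictToEquivalence Linf.{u} PrjB.{u} catB catbLinf ∧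
    RestrictToEquivalence Linf.{u} PrjB.{u} catccB cataLinf ∧
    RestrictToEquivalence Linf.{u} PrjB.{u} catDcBc catDcaLinfc ∧
    RestrictToEquivalence Linf.{u} PrjB.{u} catmcBc catLinfc ∧
    RestrictToEquivalence Linf.{u} PrjB.{u} catccBi cataLinfi ∧
    RestrictToEquivalence Linf.{u} PrjB.{u} catccBIso cataLinfIso ∧
    RestrictToEquivalence Linf.{u} PrjB.{u} catmcBIso catLinfIso ∧
    -- the equivalences given by `L∞` and `PrjB`, complex scalars
    RestrictToEquivalence LinfC.{u} PrjBC.{u} catB catbLinfC ∧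
    RestrictToEquivalence LinfC.{u} PrjBC.{u} catccB cataLinfC ∧
    RestrictToEquivalence LinfC.{u} PrjBC.{u} catDcBc catDcaLinfcC ∧
    RestrictToEquivalence LinfC.{u} PrjBC.{u} catmcBc catLinfcC ∧
    RestrictToEquivalence LinfC.{u} PrjBC.{u} catccBi cataLinfiC ∧
    RestrictToEquivalence LinfC.{u} PrjBC.{u} catccBIso cataLinfIsoC ∧
    RestrictToEquivalence LinfC.{u} PrjBC.{u} catmcBIso catLinfIsoC ∧
    -- the inclusions between the categories of boolean algebras
    (catmcBc.{u} ≤ catDcBc ∧ catDcBc.{u} ≤ catccB ∧ catccB.{u} ≤ catB ∧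
      catmcBIso.{u} ≤ catccBIso ∧ catccBIso.{u} ≤ catccBi ∧ catmcBIso.{u} ≤ catmcBc ∧
      catccBi.{u} ≤ catccB) ∧
    -- the inclusions between the categories of real abstract `L∞` spaces
    (catLinfc.{u} ≤ catDcaLinfc ∧ catDcaLinfc.{u} ≤ cataLinf ∧ cataLinf.{u} ≤ catbLinf ∧
      catLinfIso.{u} ≤ cataLinfIso ∧ cataLinfIso.{u} ≤ cataLinfi ∧ catLinfIso.{u} ≤ catLinfc ∧
      cataLinfi.{u} ≤ cataLinf) ∧
    -- the inclusions between the categories of complex abstract `L∞` spaces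
    (catLinfcC.{u} ≤ catDcaLinfcC ∧ catDcaLinfcC.{u} ≤ cataLinfC ∧ cataLinfC.{u} ≤ catbLinfC ∧
      catLinfIsoC.{u} ≤ cataLinfIsoC ∧ cataLinfIsoC.{u} ≤ cataLinfiC ∧
      catLinfIsoC.{u} ≤ catLinfcC ∧ cataLinfiC.{u} ≤ cataLinfC) := by
  exact ⟨equivalence_catB, equivalence_catccB, equivalence_catDcBc, equivalence_catmcBc,
    equivalence_catccBi, equivalence_catccBIso, equivalence_catmcBIso, equivalenceC_catB,
    equivalenceC_catccB, equivalenceC_catDcBc, equivalenceC_catmcBc, equivalenceC_catccBi,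
    equivalenceC_catccBIso, equivalenceC_catmcBIso, inclusions_boolAlg, inclusions_real,
    inclusions_complex⟩
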